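/- **Conventions.** An instance of CSP is a triple $I=(V,D,\mathcal C)$ where $V$ is a finite set of variables, $D$ a finite set of values and $\mathcal C$ a finite set of constraints $(S,R)$; the scope $S$ is a non-empty sequence of distinct variables and $R$ is a set of tuples over $D$ of length $|S|$. Every variable occurs in some scope and every value occurs in some relation. CSP asks whether there is $\tau\colon V\to D$ such that $(\tau(x_1),\dots,\tau(x_r))\in R$ for every constraint $((x_1,\dots,x_r),R)\in\mathcal C$. Write $n=|V|$ and $\mathrm{dom}=|D|$, and let $\deg(I)$ be the maximum, over the variables $x\in V$, of the number of constraints whose scope contains $x$. For computable $f,g\colon\mathbb N\to\mathbb N$, $f(n)=o(g(n))$ means (effectively) that there are a computable, nondecreasing, unbounded $\mu\colon\mathbb N\to\mathbb N$ and $n_0$ with $f(n)\le g(n)/\mu(n)$ for all $n\ge n_0$. A restriction of CSP to a class of instances is solvable in subexponential time if a single (multi-tape Turing machine) algorithm decides all instances $I$ of the class in time $\mathrm{dom}^{o(n)}|I|^{O(1)}$, where $|I|$ is the length of the encoding of $I$ and $\mathrm{dom}$ is replaced by $1$ if $D=\emptyset$. $k$-CNF-Sat is satisfiability of CNF formulas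 all of whose clauses contain at most $k$ literals; it is solvable in time $2^{o(n)}$ if one algorithm decides all such formulas $F$ with $n$ variables in time $2^{o(n)}|F|^{O(1)}$. The Exponential Time Hypothesis (ETH) states that for every $k\ge 3$, $k$-CNF-Sat is not solvable in time $2^{o(n)}$. **Theorem.** Assume the ETH. Then for every integer $d\ge 2$, CSP restricted to the instances $I$ with $\deg(I)\le d$ is not solvable in subexponential time. In particular this holds for instances in which every variable occurs in at most two constraints. -/

import Mathlib

/-! ### Running time and subexponential time

Algorithms are Mathlib's multi-stack Turing machines `Turing.FinTM2`; time is the number of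
steps of the machine. -/

/-- The finite tape alphabet in which instances are written. -/
inductive TapeSymbol where
  | tally
  | comma
  | semicolon
  | hash
  | plus
  | minus
  deriving DecidableEq

/-- `f(n) = o(g(n))` in the effective sense: `f` and `g` are computable and there are a computable,
nondecreasing, unbounded `μ` and an `n₀` with `f(n) ≤ g(n) / μ(n)` for all `n ≥ n₀`. -/
def IsEffLittleO (f g : ℕ → ℕ) : Prop :=
  Computable f ∧ Computable g ∧
    ∃ (μ : ℕ → ℕ) (n₀ : ℕ), Computable μ ∧ Monotone μ ∧ (∀ b, ∃ n, b ≤ μ n) ∧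
      ∀ n, n₀ ≤ n → μ n * f n ≤ g n

/-- The decision problem with instances `α`, written on the tape by `encode`, and yes-instances
`yes`, is decided by a Turing machine that on every instance `a` halts after at most `time a`
steps with the one-symbol output `true` or `false`. Nothing is asked of the machine on inputs that
do not encode an element of `α`. -/
def SolvableInTime {α : Type} (encode : α → List TapeSymbol) (yes : α → Prop)
    (time : α → ℕ) : Prop :=
  ∃ M : Turing.TM2ComputableAux TapeSymbol Bool, ∀ a : α, ∃ answer : Bool,
    (answer = true ↔ yes a) ∧
      Nonempty (Turing.TM2OutputsInTime M.tm
        ((encode a).map M.inputAlphabet.invFun)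
        (some ([answer].map M.outputAlphabet.invFun))
        (time a))

/-- Solvability in (uniform) subexponential time `base ^ o(n) * |I| ^ O(1)`, where `n` is the number
of variables of the instance `I` and `|I|` is the length of its encoding. -/
def SolvableInSubexpTime {α : Type} (encode : α → List TapeSymbol) (yes : α → Prop)
    (base n : α → ℕ) : Prop :=
  ∃ (f : ℕ → ℕ) (c : ℕ), IsEffLittleO f id ∧
    SolvableInTime encode yes
      (fun a => c * base a ^ f (n a) * ((encode a).length + 1) ^ c)

/-! ### CNF satisfiability and the exponential time hypothesis -/

/-- A propositional formula in conjunctive normal form over `vars` variables. -/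
structure CNFFormula where
  vars : ℕ
  formula : Std.Sat.CNF (Fin vars)

namespace CNFFormula

def Satisfiable (F : CNFFormula) : Prop :=
  ∃ τ : Fin F.vars → Bool, Std.Sat.CNF.Sat τ F.formula

/-- Every clause contains at most `k` literals. -/
def WidthLE (F : CNFFormula) (k : ℕ) : Prop :=
  ∀ C ∈ F.formula.clauses, C.length ≤ k

/-- The number of variables and `hash`; then clause by clause its literals and `semicolon`. A literal
is the name of its variable followed by its sign. Numbers are written in tally notation: the number
of variables is the parameter `n` of the running time, so this changes the input length only by
a factor that is absorbed in `2 ^ o(n)`. -/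
def encode (F : CNFFormula) : List TapeSymbol :=
  List.replicate F.vars .tally ++ [.hash] ++
    F.formula.clauses.toList.flatMap fun C =>
      (C.flatMap fun l =>
        List.replicate (l.1 : ℕ) .tally ++ [if l.2 then .plus else .minus]) ++ [.semicolon]

end CNFFormula

/-- `k`-CNF-Sat is solvable in time `2 ^ o(n)`, up to a factor polynomial in the input length. -/
def KCNFSatSubexp (k : ℕ) : Prop :=
  SolvableInSubexpTime (α := {F : CNFFormula // F.WidthLE k})
    (fun F => F.1.encode) (fun F => F.1.Satisfiable) (fun _ => 2) (fun F => F.1.vars)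

/-- The exponential time hypothesis. -/
def ExponentialTimeHypothesis : Prop :=
  ∀ k : ℕ, 3 ≤ k → ¬ KCNFSatSubexp k

/-! ### Constraint satisfaction -/

/-- A constraint `(S, R)` over the variables `Fin n` and the values `Fin d`: the scope `S` is a
non-empty sequence of distinct variables; the relation `R` is a set of tuples (listed without
repetition) of the length of `S`. -/
structure CSPConstraint (n d : ℕ) where
  scope : List (Fin n)
  scope_ne_nil : scope ≠ []
  scope_nodup : scope.Nodup
  rel : List (List (Fin d))
  rel_nodup : rel.Nodup
  rel_length : ∀ t ∈ rel, t.length = scope.length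

/-- A CSP instance `(V, D, 𝒞)` with `V = Fin vars` and `D = Fin dom`. The finite set `𝒞` of
constraints is listed without repetition. Every variable occurs in a constraint scope and every
domain value occurs in a constraint relation. -/
structure CSPInstance where
  vars : ℕ
  dom : ℕ
  constraints : List (CSPConstraint vars dom)
  constraints_nodup : (constraints.map fun C => (C.scope, C.rel.toFinset)).Nodup
  var_occurs : ∀ x : Fin vars, ∃ C ∈ constraints, x ∈ C.scope
  val_occurs : ∀ v : Fin dom, ∃ C ∈ constraints, ∃ t ∈ C.rel, v ∈ t

namespace CSPInstance

/-- Some assignment of values to the variables satisfies all constraints. -/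
def Consistent (I : CSPInstance) : Prop :=
  ∃ τ : Fin I.vars → Fin I.dom, ∀ C ∈ I.constraints, C.scope.map τ ∈ C.rel

/-- The number of constraints whose scope contains `x`. -/
def degree (I : CSPInstance) (x : Fin I.vars) : ℕ :=
  (I.constraints.filter fun C => decide (x ∈ C.scope)).length

/-- The degree of an instance: the maximum degree of a variable. -/
def deg (I : CSPInstance) : ℕ :=
  Finset.univ.sup I.degree

/-- The number of variables, `hash`, the number of values, `hash`; then constraint by constraint its
scope, its tuples and `hash`, where the scope and each tuple are ended by `semicolon` and their
entries are each ended by `comma`. Numbers are written in tally notation: every variable and every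
value occurs in the instance, so this is polynomially equivalent to writing them in binary. -/
def encode (I : CSPInstance) : List TapeSymbol :=
  List.replicate I.vars .tally ++ [.hash] ++ List.replicate I.dom .tally ++ [.hash] ++
    I.constraints.flatMap fun C =>
      (C.scope.flatMap fun x => List.replicate (x : ℕ) .tally ++ [.comma]) ++ [.semicolon] ++
        (C.rel.flatMap fun t =>
          (t.flatMap fun v => List.replicate (v : ℕ) .tally ++ [.comma]) ++ [.semicolon]) ++
        [.hash]

end CSPInstance

/-- CSP restricted to the instances of degree at most `d` is solvable in subexponential time
`dom ^ o(n) * |I| ^ O(1)`. (The base is `1` if the domain is empty.) -/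
def CSPDegSubexp (d : ℕ) : Prop :=
  SolvableInSubexpTime (α := {I : CSPInstance // I.deg ≤ d})
    (fun I => I.1.encode) (fun I => I.1.Consistent) (fun I => max 1 I.1.dom) (fun I => I.1.vars)

/-! A subexponential algorithm for CSP of degree at most `d` is turned into a `2 ^ o(n)` algorithm
for 3-CNF-Sat; the ETH is needed only for width three.

Cut the `n` variables of a formula into `t = n / b + 1` blocks of size `b`. For each of the `t ^ 3`
triples of blocks take fresh Boolean copies of its `3 * b` variables, and put on this group one
constraint that lists those of its `8 ^ b` assignments which falsify no clause visible in the group.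
One further constraint per variable of the formula says that all its copies are equal. A copy lies
only in the constraint of its group and in one equality constraint, so the degree is at most two
(`degree_le`); the price is paid in arity and in the length of the relations. A clause of at most
three literals is visible in some group, so consistency of the instance is satisfiability of the
formula (`constraints_consistent_iff`).

The instance has `N = 3 * b * t ^ 3` variables, two values, and a size polynomial in the length of
the formula and `8 ^ b`. Let `f(N) = o(N)`. If `n / b` is about a sufficiently slowly growing `s`,
then `N ≤ 3 * s ^ 3 * b` and `f(N) ≤ N / s ^ 4`, hence `f(N) ≤ b` while `b = o(n)`
(`IsEffLittleO.exists_block_size`). Then everything fits into time `2 ^ O(b)` up to a polynomial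
factor, which is `2 ^ o(n)`.

A good `b` need not be computed. The instances for all `b ≥ 2` have the same answer, so the CSP
machine is run for `b = 2, 3, …`, each time with a clock polynomial in `8 ^ b` and the length of the
instance. The first answer obtained is correct, and one is obtained at the latest for the good `b`
(`exec_search`).

The remaining work is to realize this on a Turing machine. Structured programs that contain the CSP
machine as a subroutine are compiled to `FinTM2` (`Exec.runs`, `solvableInTime_of_exec`). The
reduction is an expression `Gen` with bounded loops only; every such expression can be evaluated in
polynomial time (`Gen.exec_compile`), and the calculus of `Den`, `Num` and `Tr` shows that it
generates the encoding of the instance (`Params.reduction`). -/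

namespace StackProg

open Turing Function

/-! ### A structured language for stack machines

Programs act on stacks of tape symbols, numbered by natural numbers, and on the configuration of
an embedded stack machine `T`. -/

inductive Cmd (T : FinTM2)
  | push (x : ℕ) (a : TapeSymbol)
  | pop (x : ℕ)
  | move (x y : ℕ)
  | feed (x : ℕ)
  | start
  | step
  | drop (k : T.K)

inductive Test (T : FinTM2)
  | nonempty (x : ℕ)
  | top (x : ℕ) (a : TapeSymbol)
  | running
  | stackNonempty (k : T.K)

inductive Prog (T : FinTM2)
  | cmd (c : Cmd T)
  | seq (p q : Prog T)
  | cond (t : Test T) (p : Prog T)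
  | loop (t : Test T) (p : Prog T)

structure Memory (T : FinTM2) where
  reg : ℕ → List TapeSymbol
  cfg : TM2.Cfg T.Γ T.Λ T.σ

variable {T : FinTM2} (sym : TapeSymbol → T.Γ T.k₀)

def Cmd.eval (s : Memory T) : Cmd T → Memory T
  | push x a => ⟨update s.reg x (a :: s.reg x), s.cfg⟩
  | pop x => ⟨update s.reg x (s.reg x).tail, s.cfg⟩
  | move x y =>
    match (s.reg x).head? with
    | none => s
    | some a =>
      let r := update s.reg x (s.reg x).tail
      ⟨update r y (a :: r y), s.cfg⟩
  | feed x =>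
    match (s.reg x).head? with
    | none => s
    | some a =>
      ⟨update s.reg x (s.reg x).tail,
        ⟨s.cfg.l, s.cfg.var, update s.cfg.stk T.k₀ (sym a :: s.cfg.stk T.k₀)⟩⟩
  | start => ⟨s.reg, ⟨some T.main, T.initialState, s.cfg.stk⟩⟩
  | step => ⟨s.reg, (TM2.step T.m s.cfg).getD s.cfg⟩
  | drop k => ⟨s.reg, ⟨s.cfg.l, s.cfg.var, update s.cfg.stk k (s.cfg.stk k).tail⟩⟩

def Test.eval (s : Memory T) : Test T → Bool
  | nonempty x => (s.reg x).head?.isSome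
  | top x a => (s.reg x).head? == some a
  | running => s.cfg.l.isSome
  | stackNonempty k => (s.cfg.stk k).head?.isSome

/-- `Exec sym p s s' n`: the program `p` transforms the memory `s` into `s'` in at most `n`
steps. -/
inductive Exec : Prog T → Memory T → Memory T → ℕ → Prop
  | cmd (c s) : Exec (.cmd c) s (c.eval sym s) 1
  | seq {p q s s' s'' m n} : Exec p s s' m → Exec q s' s'' n → Exec (.seq p q) s s'' (m + n)
  | condTrue {t p s s' n} : t.eval s = true → Exec p s s' n → Exec (.cond t p) s s' (n + 1)
  | condFalse {t p s} : t.eval s = false → Exec (.cond t p) s s 1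
  | loopTrue {t p s s' s'' m n} : t.eval s = true → Exec p s s' m →
      Exec (.loop t p) s' s'' n → Exec (.loop t p) s s'' (m + n + 1)
  | loopFalse {t p s} : t.eval s = false → Exec (.loop t p) s s 1
  | weaken {p s s' m n} : Exec p s s' m → m ≤ n → Exec p s s' n

def Cmd.Bounded (m : ℕ) : Cmd T → Prop
  | push x _ => x ≤ m
  | pop x => x ≤ m
  | move x y => x ≤ m ∧ y ≤ m
  | feed x => x ≤ m
  | _ => True

def Test.Bounded (m : ℕ) : Test T → Prop
  | nonempty x => x ≤ m
  | top x _ => x ≤ m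
  | _ => True

/-- All registers of the program are at most `m`. -/
def Prog.Bounded (m : ℕ) : Prog T → Prop
  | cmd c => c.Bounded m
  | seq p q => p.Bounded m ∧ q.Bounded m
  | cond t p => t.Bounded m ∧ p.Bounded m
  | loop t p => t.Bounded m ∧ p.Bounded m

theorem Cmd.Bounded.mono {m n : ℕ} (h : m ≤ n) {c : Cmd T} (hc : c.Bounded m) : c.Bounded n := by
  cases c <;> simp only [Cmd.Bounded] at * <;> omega

theorem Test.Bounded.mono {m n : ℕ} (h : m ≤ n) {c : Test T} (hc : c.Bounded m) :
    c.Bounded n := by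
  cases c <;> simp only [Test.Bounded] at * <;> omega

theorem Prog.Bounded.mono {m n : ℕ} (h : m ≤ n) {p : Prog T} (hp : p.Bounded m) :
    p.Bounded n := by
  induction p with
  | cmd c => exact Cmd.Bounded.mono h hp
  | seq p q ihp ihq => exact ⟨ihp hp.1, ihq hp.2⟩
  | cond t p ih => exact ⟨hp.1.mono h, ih hp.2⟩
  | loop t p ih => exact ⟨hp.1.mono h, ih hp.2⟩

theorem Prog.exists_bounded (p : Prog T) : ∃ m, p.Bounded m := by
  induction p with
  | cmd c =>
    cases c with
    | push x a => exact ⟨x, le_rfl⟩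
    | pop x => exact ⟨x, le_rfl⟩
    | move x y => exact ⟨max x y, le_max_left _ _, le_max_right _ _⟩
    | feed x => exact ⟨x, le_rfl⟩
    | _ => exact ⟨0, trivial⟩
  | seq p q ihp ihq =>
    obtain ⟨m, hm⟩ := ihp
    obtain ⟨n, hn⟩ := ihq
    exact ⟨max m n, hm.mono (le_max_left _ _), hn.mono (le_max_right _ _)⟩
  | cond t p ih | loop t p ih =>
    obtain ⟨m, hm⟩ := ih
    obtain ⟨n, hn⟩ : ∃ n, t.Bounded n := by
      cases t with
      | nonempty x => exact ⟨x, le_rfl⟩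
      | top x _ => exact ⟨x, le_rfl⟩
      | _ => exact ⟨0, trivial⟩
    exact ⟨max m n, hn.mono (le_max_right _ _), hm.mono (le_max_left _ _)⟩

/-! ### Compilation to a stack machine -/

variable (T) in
-- The components are the outcome of the last test, the symbol in transit during `move` or `feed`,
-- and the label and the internal state of the embedded machine, where the label `none` means that
-- it has halted.
abbrev Ctl : Type := Bool × Option TapeSymbol × Option T.Λ × T.σ

variable (T) in
abbrev Idx (m : ℕ) : Type := Fin (m + 1) ⊕ T.K

variable (T) in
@[reducible] def Alph (m : ℕ) : Idx T m → Type
  | Sum.inl _ => TapeSymbol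
  | Sum.inr k => T.Γ k

variable {m : ℕ} {Λ : Type}

/-- The reduction modulo `m + 1` only makes the index total; programs satisfying `Bounded m` are
unaffected by it. -/
abbrev Idx.reg (x : ℕ) : Idx T m := Sum.inl (Fin.ofNat (m + 1) x)

/-- The statement of the embedded machine, where a jump is recorded in the control state and the
machine continues at the label `next`. -/
def liftStmt (next : Λ) : TM2.Stmt T.Γ T.Λ T.σ → TM2.Stmt (Alph T m) Λ (Ctl T)
  | .push k f q => .push (Sum.inr k) (fun v => f v.2.2.2) (liftStmt next q)
  | .peek k f q =>
    .peek (Sum.inr k) (fun v o => (v.1, v.2.1, v.2.2.1, f v.2.2.2 o)) (liftStmt next q)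
  | .pop k f q =>
    .pop (Sum.inr k) (fun v o => (v.1, v.2.1, v.2.2.1, f v.2.2.2 o)) (liftStmt next q)
  | .load f q => .load (fun v => (v.1, v.2.1, v.2.2.1, f v.2.2.2)) (liftStmt next q)
  | .branch f q₁ q₂ => .branch (fun v => f v.2.2.2) (liftStmt next q₁) (liftStmt next q₂)
  | .goto f => .load (fun v => (v.1, v.2.1, some (f v.2.2.2), v.2.2.2)) (.goto fun _ => next)
  | .halt => .load (fun v => (v.1, v.2.1, none, v.2.2.2)) (.goto fun _ => next)

open Classical in
-- The label of the embedded machine is data in the control state, so one of its steps is a dispatch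
-- over all labels inside a single statement. A halted machine matches none of them and stays as it
-- is.
noncomputable def stepStmt (next : Λ) : List T.Λ → TM2.Stmt (Alph T m) Λ (Ctl T)
  | [] => .goto fun _ => next
  | l :: ls =>
    .branch (fun v => decide (v.2.2.1 = some l)) (liftStmt next (T.m l)) (stepStmt next ls)

noncomputable def Cmd.stmt (next : Λ) : Cmd T → TM2.Stmt (Alph T m) Λ (Ctl T)
  | push x a => .push (Idx.reg x) (fun _ => a) (.goto fun _ => next)
  | pop x => .pop (Idx.reg x) (fun v _ => v) (.goto fun _ => next)
  | move x y =>
    .peek (Idx.reg x) (fun v o => (v.1, o, v.2.2))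
      (.branch (fun v => v.2.1.isSome)
        (.pop (Idx.reg x) (fun v _ => v)
          -- The default symbol is never used: this branch is taken only after a symbol has been
          -- seen.
          (.push (Idx.reg y) (fun v => (v.2.1.getD .tally : TapeSymbol)) (.goto fun _ => next)))
        (.goto fun _ => next))
  | feed x =>
    .peek (Idx.reg x) (fun v o => (v.1, o, v.2.2))
      (.branch (fun v => v.2.1.isSome)
        (.pop (Idx.reg x) (fun v _ => v)
          (.push (Sum.inr T.k₀) (fun v => sym (v.2.1.getD .tally)) (.goto fun _ => next)))
        (.goto fun _ => next))
  | start => .load (fun v => (v.1, v.2.1, some T.main, T.initialState)) (.goto fun _ => next)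
  | step =>
    haveI := T.ΛFin
    stepStmt next (Finset.univ : Finset T.Λ).toList
  | drop k => .pop (Sum.inr k) (fun v _ => v) (.goto fun _ => next)

def Test.stmt (yes no : Λ) : Test T → TM2.Stmt (Alph T m) Λ (Ctl T)
  | nonempty x =>
    .peek (Idx.reg x) (fun v o => (o.isSome, v.2)) (.goto fun v => cond v.1 yes no)
  | top x a =>
    .peek (Idx.reg x) (fun v (o : Option TapeSymbol) => (o == some a, v.2))
      (.goto fun v => cond v.1 yes no)
  | running => .goto fun v => cond v.2.2.1.isSome yes no
  | stackNonempty k =>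
    .peek (Sum.inr k) (fun v o => (o.isSome, v.2)) (.goto fun v => cond v.1 yes no)

/-- Each command and each test occupies one label; `none` is the label of the test of a conditional
or a loop. -/
def Prog.Lbl : Prog T → Type
  | cmd _ => Unit
  | seq p q => p.Lbl ⊕ q.Lbl
  | cond _ p => Option p.Lbl
  | loop _ p => Option p.Lbl

def Prog.entry : (p : Prog T) → p.Lbl
  | cmd _ => ()
  | seq p _ => Sum.inl p.entry
  | cond _ _ => none
  | loop _ _ => none

theorem Prog.finite_lbl : (p : Prog T) → Finite p.Lbl
  | cmd _ => inferInstanceAs (Finite Unit)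
  | seq p q =>
    haveI := p.finite_lbl
    haveI := q.finite_lbl
    inferInstanceAs (Finite (p.Lbl ⊕ q.Lbl))
  | cond _ p =>
    haveI := p.finite_lbl
    inferInstanceAs (Finite (Option p.Lbl))
  | loop _ p =>
    haveI := p.finite_lbl
    inferInstanceAs (Finite (Option p.Lbl))

/-- The code is written in continuation style: `emb` places the labels of the program among those of
the whole machine, and `exit` is the label to go to at the end. The body of a loop exits to the test
of the loop. -/
noncomputable def Prog.code :
    (p : Prog T) → (p.Lbl → Λ) → Λ → p.Lbl → TM2.Stmt (Alph T m) Λ (Ctl T)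
  | cmd c, _, exit, _ => c.stmt sym exit
  | seq p q, emb, exit, l =>
    match l with
    | Sum.inl l => p.code (emb ∘ Sum.inl) (emb (Sum.inr q.entry)) l
    | Sum.inr l => q.code (emb ∘ Sum.inr) exit l
  | cond t p, emb, exit, l =>
    match l with
    | none => t.stmt (emb (some p.entry)) exit
    | some l => p.code (emb ∘ some) exit l
  | loop t p, emb, exit, l =>
    match l with
    | none => t.stmt (emb (some p.entry)) exit
    | some l => p.code (emb ∘ some) (emb none) l

/-! ### Correctness of the compilation -/

/-- `n` steps of the partial function `f` lead from `a` to `b`. -/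
def Runs {C : Type} (f : C → Option C) (n : ℕ) (a b : C) : Prop :=
  (flip bind f)^[n] (some a) = some b

theorem Runs.trans {C : Type} {f : C → Option C} {m n : ℕ} {a b c : C}
    (h : Runs f m a b) (h' : Runs f n b c) : Runs f (m + n) a c := by
  unfold Runs at *
  rw [add_comm, iterate_add_apply, h, h']

theorem Runs.single {C : Type} {f : C → Option C} {a b : C} (h : f a = some b) :
    Runs f 1 a b := by
  simpa [Runs, flip] using h

def Memory.stk (s : Memory T) : ∀ k : Idx T m, List (Alph T m k)
  | Sum.inl i => s.reg i
  | Sum.inr k => s.cfg.stk k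

theorem Memory.stk_update_reg (r : ℕ → List TapeSymbol) (c) {x : ℕ} (hx : x ≤ m) (l) :
    (Memory.mk (T := T) (update r x l) c).stk (m := m) =
      update (Memory.mk r c).stk (Idx.reg x) l := by
  funext k
  rcases k with i | k
  · by_cases h : i = Fin.ofNat (m + 1) x
    · subst h
      have : x % (m + 1) = x := Nat.mod_eq_of_lt (by omega)
      simp only [update_self]
      simp [Memory.stk, Fin.ofNat, this]
    · have h' : (i : ℕ) ≠ x := by
        rintro rfl
        exact h (by simp)
      rw [update_of_ne (by simpa using h)]
      simp [Memory.stk, update_of_ne h']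
  · rw [update_of_ne (by simp)]
    rfl

theorem Memory.stk_update_stk (r : ℕ → List TapeSymbol) (a b S) (k : T.K) (l) :
    (Memory.mk (T := T) r ⟨a, b, update S k l⟩).stk (m := m) =
      update (Memory.mk r ⟨a, b, S⟩).stk (Sum.inr k) l := by
  funext k'
  rcases k' with i | k'
  · rw [update_of_ne (by simp)]
    rfl
  · by_cases h : k' = k
    · subst h
      simp [Memory.stk]
    · rw [update_of_ne (by simpa using h)]
      simp [Memory.stk, update_of_ne h]

theorem Memory.stk_cfg (r : ℕ → List TapeSymbol) (a b a' b' S) :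
    (Memory.mk (T := T) r ⟨a, b, S⟩).stk (m := m) = (Memory.mk r ⟨a', b', S⟩).stk := by
  funext k
  cases k <;> rfl

theorem Memory.stk_reg (s : Memory T) {x : ℕ} (hx : x ≤ m) :
    s.stk (m := m) (Idx.reg x) = s.reg x := by
  have : x % (m + 1) = x := Nat.mod_eq_of_lt (by omega)
  simp [Memory.stk, Idx.reg, Fin.ofNat, this]

variable (m) in
/-- The configuration of the compiled machine at the label `l` with the memory `s`. -/
def Memory.toCfg (s : Memory T) (l : Λ) (b : Bool) (o : Option TapeSymbol) :
    TM2.Cfg (Alph T m) Λ (Ctl T) :=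
  ⟨some l, (b, o, s.cfg.l, s.cfg.var), s.stk⟩

/-- The recorded label is carried along unread until `goto` or `halt` overwrites it, so the
induction goes through for any label. -/
theorem stepAux_liftStmt (next : Λ) (q : TM2.Stmt T.Γ T.Λ T.σ) (b o l) (v : T.σ) (S r) :
    TM2.stepAux (liftStmt (m := m) next q) (b, o, l, v) (Memory.mk r ⟨l, v, S⟩).stk =
      (Memory.mk r (TM2.stepAux q v S)).toCfg m next b o := by
  induction q generalizing l v S with
  | push k f q ih =>
    simp only [liftStmt, TM2.stepAux]
    rw [← ih, Memory.stk_update_stk]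
    rfl
  | peek k f q ih =>
    simp only [liftStmt, TM2.stepAux]
    rw [← ih, Memory.stk_cfg]
    rfl
  | pop k f q ih =>
    simp only [liftStmt, TM2.stepAux]
    rw [← ih, Memory.stk_update_stk, Memory.stk_cfg]
    rfl
  | load f q ih =>
    simp only [liftStmt, TM2.stepAux]
    rw [← ih, Memory.stk_cfg]
  | branch f q₁ q₂ ih₁ ih₂ =>
    simp only [liftStmt, TM2.stepAux]
    cases f v
    · exact ih₂ _ _ _
    · exact ih₁ _ _ _
  | goto f =>
    simp only [liftStmt, TM2.stepAux, Memory.toCfg]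
    rw [Memory.stk_cfg]
  | halt =>
    simp only [liftStmt, TM2.stepAux, Memory.toCfg]
    rw [Memory.stk_cfg]

theorem stepAux_stepStmt (next : Λ) (ls : List T.Λ) (s : Memory T) (b o)
    (h : ∀ l, s.cfg.l = some l → l ∈ ls) :
    TM2.stepAux (stepStmt (m := m) next ls) (b, o, s.cfg.l, s.cfg.var) s.stk =
      (Cmd.eval sym s .step).toCfg m next b o := by
  obtain ⟨r, l, v, S⟩ := s
  cases l with
  | none =>
    have : ∀ ls, TM2.stepAux (stepStmt (m := m) next ls) (b, o, none, v)
        (Memory.mk (T := T) r ⟨none, v, S⟩).stk = (Memory.mk r ⟨none, v, S⟩).toCfg m next b o := by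
      intro ls
      induction ls with
      | nil => rfl
      | cons l ls ih => simpa [stepStmt] using ih
    exact this ls
  | some l =>
    simp only [Option.some.injEq, forall_eq'] at h
    induction ls with
    | nil => simp at h
    | cons l' ls ih =>
      by_cases hl : l = l'
      · subst hl
        simp [stepStmt, stepAux_liftStmt, Cmd.eval]
      · simpa [stepStmt, hl] using ih (by simpa [hl] using h)

theorem stepAux_cmd (next : Λ) {c : Cmd T} (hc : c.Bounded m) (s : Memory T) (b o) :
    ∃ b' o', TM2.stepAux (c.stmt (m := m) sym next) (b, o, s.cfg.l, s.cfg.var) s.stk =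
      (c.eval sym s).toCfg m next b' o' := by
  cases c with
  | push x a =>
    refine ⟨b, o, ?_⟩
    simp only [Cmd.stmt, TM2.stepAux, Memory.toCfg, Cmd.eval]
    rw [Memory.stk_update_reg _ _ hc, Memory.stk_reg s hc]
  | pop x =>
    refine ⟨b, o, ?_⟩
    simp only [Cmd.stmt, TM2.stepAux, Memory.toCfg, Cmd.eval]
    rw [Memory.stk_update_reg _ _ hc, Memory.stk_reg s hc]
  | move x y =>
    refine ⟨b, (s.reg x).head?, ?_⟩
    simp only [Cmd.stmt, TM2.stepAux, Cmd.eval, Memory.stk_reg s hc.1]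
    cases h : (s.reg x).head? with
    | none => rfl
    | some a =>
      simp only [Option.isSome_some, cond_true, Memory.toCfg, Option.getD_some]
      have := Memory.stk_reg (m := m) ⟨update s.reg x (s.reg x).tail, s.cfg⟩ hc.2
      rw [Memory.stk_update_reg _ _ hc.2, Memory.stk_update_reg _ _ hc.1] at *
      rw [this]
  | feed x =>
    refine ⟨b, (s.reg x).head?, ?_⟩
    simp only [Cmd.stmt, TM2.stepAux, Cmd.eval, Memory.stk_reg s hc]
    cases h : (s.reg x).head? with
    | none => rfl
    | some a =>
      simp only [Option.isSome_some, cond_true, Memory.toCfg, Option.getD_some]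
      rw [Memory.stk_update_stk, Memory.stk_update_reg _ _ hc, update_of_ne (by simp)]
      rfl
  | start =>
    refine ⟨b, o, ?_⟩
    simp only [Cmd.stmt, TM2.stepAux, Cmd.eval, Memory.toCfg]
    rw [Memory.stk_cfg]
  | step =>
    refine ⟨b, o, ?_⟩
    have := T.ΛFin
    exact stepAux_stepStmt sym next _ s b o (by simp)
  | drop k =>
    refine ⟨b, o, ?_⟩
    simp only [Cmd.stmt, TM2.stepAux, Memory.toCfg, Cmd.eval]
    rw [Memory.stk_update_stk]
    rfl

theorem stepAux_test (yes no : Λ) {t : Test T} (ht : t.Bounded m) (s : Memory T) (b o) :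
    ∃ b', TM2.stepAux (t.stmt (m := m) yes no) (b, o, s.cfg.l, s.cfg.var) s.stk =
      s.toCfg m (cond (t.eval s) yes no) b' o := by
  cases t with
  | nonempty x =>
    refine ⟨(s.reg x).head?.isSome, ?_⟩
    simp only [Test.stmt, TM2.stepAux, Memory.stk_reg s ht]
    rfl
  | top x a =>
    refine ⟨(s.reg x).head? == some a, ?_⟩
    simp only [Test.stmt, TM2.stepAux, Memory.stk_reg s ht]
    rfl
  | running => exact ⟨b, rfl⟩
  | stackNonempty k => exact ⟨(s.cfg.stk k).head?.isSome, rfl⟩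

/-- Induction on the execution, where each command and each test costs one machine step. The test
flag and the symbol buffer are left with unspecified contents, which does no harm because both are
rewritten before they are read. -/
theorem Exec.runs {p : Prog T} {s s' : Memory T} {n : ℕ} (h : Exec sym p s s' n)
    (hp : p.Bounded m) (code : Λ → TM2.Stmt (Alph T m) Λ (Ctl T)) (emb : p.Lbl → Λ) (exit : Λ)
    (hcode : ∀ l, code (emb l) = p.code sym emb exit l) (b : Bool) (o : Option TapeSymbol) :
    ∃ b' o' k, k ≤ n ∧
      Runs (TM2.step code) k (s.toCfg m (emb p.entry) b o) (s'.toCfg m exit b' o') := by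
  induction h generalizing exit b o with
  | cmd c s =>
    obtain ⟨b', o', h⟩ := stepAux_cmd sym exit hp s b o
    refine ⟨b', o', 1, le_rfl, Runs.single ?_⟩
    simp only [Memory.toCfg, TM2.step, hcode, Prog.code] at h ⊢
    rw [h]
  | @seq p q s s' s'' m n _ _ ih₁ ih₂ =>
    obtain ⟨b₁, o₁, k₁, hk₁, h₁⟩ := ih₁ hp.1 (emb ∘ Sum.inl) (emb (Sum.inr q.entry))
      (fun l => hcode (Sum.inl l)) b o
    obtain ⟨b₂, o₂, k₂, hk₂, h₂⟩ := ih₂ hp.2 (emb ∘ Sum.inr) exit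
      (fun l => hcode (Sum.inr l)) b₁ o₁
    exact ⟨b₂, o₂, k₁ + k₂, by omega, h₁.trans h₂⟩
  | @condTrue t p s s' n ht _ ih =>
    obtain ⟨b₁, h₁⟩ := stepAux_test (emb (some p.entry)) exit hp.1 s b o
    obtain ⟨b₂, o₂, k₂, hk₂, h₂⟩ := ih hp.2 (emb ∘ some) exit (fun l => hcode (some l)) b₁ o
    refine ⟨b₂, o₂, 1 + k₂, by omega, (Runs.single ?_).trans h₂⟩
    have := hcode none
    simp only [Memory.toCfg, TM2.step, Prog.code, Prog.entry, ht, cond_true] at h₁ this ⊢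
    rw [this, h₁]
    rfl
  | @condFalse t p s ht =>
    obtain ⟨b₁, h₁⟩ := stepAux_test (emb (some p.entry)) exit hp.1 s b o
    refine ⟨b₁, o, 1, le_rfl, Runs.single ?_⟩
    have := hcode none
    simp only [Memory.toCfg, TM2.step, Prog.code, Prog.entry, ht, cond_false] at h₁ this ⊢
    rw [this, h₁]
  | @loopTrue t p s s' s'' m n ht _ _ ih₁ ih₂ =>
    obtain ⟨b₁, h₁⟩ := stepAux_test (emb (some p.entry)) exit hp.1 s b o
    obtain ⟨b₂, o₂, k₂, hk₂, h₂⟩ := ih₁ hp.2 (emb ∘ some) (emb none)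
      (fun l => hcode (some l)) b₁ o
    obtain ⟨b₃, o₃, k₃, hk₃, h₃⟩ := ih₂ hp emb exit hcode b₂ o₂
    refine ⟨b₃, o₃, 1 + k₂ + k₃, by omega, ((Runs.single ?_).trans h₂).trans h₃⟩
    have := hcode none
    simp only [Memory.toCfg, TM2.step, Prog.code, Prog.entry, ht, cond_true] at h₁ this ⊢
    rw [this, h₁]
    rfl
  | @loopFalse t p s ht =>
    obtain ⟨b₁, h₁⟩ := stepAux_test (emb (some p.entry)) exit hp.1 s b o
    refine ⟨b₁, o, 1, le_rfl, Runs.single ?_⟩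
    have := hcode none
    simp only [Memory.toCfg, TM2.step, Prog.code, Prog.entry, ht, cond_false] at h₁ this ⊢
    rw [this, h₁]
  | weaken _ hle ih =>
    obtain ⟨b', o', k, hk, h⟩ := ih hp emb exit hcode b o
    exact ⟨b', o', k, hk.trans hle, h⟩

/-- The machine that runs the program `p` on the input in register `0` and then halts with the
output of the embedded machine. -/
noncomputable def Prog.machine (p : Prog T) (m : ℕ) : FinTM2 :=
  haveI := T.kFin
  haveI := T.ΛFin
  haveI := T.σFin
  haveI : Fintype TapeSymbol :=
    ⟨{.tally, .comma, .semicolon, .hash, .plus, .minus}, fun a => by cases a <;> simp⟩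
  haveI := p.finite_lbl
  { K := Idx T m
    k₀ := Idx.reg 0
    k₁ := Sum.inr T.k₁
    Γ := Alph T m
    Λ := Option p.Lbl
    main := some p.entry
    ΛFin := Fintype.ofFinite _
    σ := Ctl T
    initialState := (false, none, none, T.initialState)
    Γk₀Fin := inferInstanceAs (Fintype TapeSymbol)
    m := fun l => l.elim
      -- A halting configuration has the initial internal state, so the control is reset first.
      (.load (fun _ => (false, none, none, T.initialState)) .halt)
      (p.code sym some none) }

def Memory.initial (input : List TapeSymbol) : Memory T :=
  ⟨update (fun _ => []) 0 input, ⟨none, T.initialState, fun _ => []⟩⟩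

/-- In a halting configuration all stacks except the output stack are empty; a program therefore has
to clear its registers. -/
noncomputable def Memory.final (output : List (T.Γ T.k₁)) : Memory T :=
  ⟨fun _ => [], haltList T output⟩

theorem initList_eq (tm : FinTM2) (l : List (tm.Γ tm.k₀)) :
    initList tm l = ⟨some tm.main, tm.initialState, update (fun _ => []) tm.k₀ l⟩ := by
  unfold initList
  congr 1
  funext k
  by_cases h : k = tm.k₀
  · subst h
    simp
  · simp [h]

theorem haltList_eq (tm : FinTM2) (l : List (tm.Γ tm.k₁)) :
    haltList tm l = ⟨none, tm.initialState, update (fun _ => []) tm.k₁ l⟩ := by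
  unfold haltList
  congr 1
  funext k
  by_cases h : k = tm.k₁
  · subst h
    simp
  · simp [h]

/-- A program that on every instance computes the answer within the time bound yields a machine
that decides the problem. -/
theorem solvableInTime_of_exec {α : Type} (encode : α → List TapeSymbol) (yes : α → Prop)
    (time : α → ℕ) (out : T.Γ T.k₁ ≃ Bool) (p : Prog T)
    (h : ∀ a, ∃ answer : Bool, (answer = true ↔ yes a) ∧
      Exec sym p (Memory.initial (encode a)) (Memory.final [out.symm answer]) (time a)) :
    SolvableInTime encode yes (fun a => time a + 1) := by
  obtain ⟨m, hm⟩ := p.exists_bounded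
  refine ⟨⟨p.machine sym m, Equiv.refl TapeSymbol, out⟩, fun a => ?_⟩
  obtain ⟨answer, hans, hexec⟩ := h a
  refine ⟨answer, hans, ?_⟩
  obtain ⟨b, o, k, hk, hrun⟩ := hexec.runs (m := m) (Λ := Option p.Lbl) sym hm
    (p.machine sym m).m some none (fun l => rfl) false none
  have hstart : initList (p.machine sym m) ((encode a).map (Equiv.refl TapeSymbol).invFun) =
      (Memory.initial (T := T) (encode a)).toCfg m (some p.entry) false none := by
    rw [initList_eq]
    change TM2.Cfg.mk _ _ _ = TM2.Cfg.mk _ _ _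
    congr 1
    have h₀ : (Memory.mk (T := T) (fun _ => []) ⟨none, T.initialState, fun _ => []⟩).stk (m := m) =
        fun _ => [] := by
      funext k
      cases k <;> rfl
    rw [Memory.initial, Memory.stk_update_reg _ _ (Nat.zero_le m), h₀]
    erw [List.map_id]
    rfl
  have hend : haltList (p.machine sym m) ([answer].map out.invFun) =
      ⟨none, (false, none, none, T.initialState),
        (Memory.final (T := T) [out.symm answer]).stk⟩ := by
    rw [haltList_eq]
    change TM2.Cfg.mk _ _ _ = TM2.Cfg.mk _ _ _
    congr 1
    have h₀ : (Memory.mk (T := T) (fun _ => []) ⟨none, T.initialState, fun _ => []⟩).stk (m := m) =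
        fun _ => [] := by
      funext k
      cases k <;> rfl
    rw [Memory.final, haltList_eq, Memory.stk_update_stk, h₀]
    rfl
  -- This last step, at the label `none`, accounts for the `+ 1` in the time bound.
  have hlast : Runs (TM2.step (p.machine sym m).m)
      1 ((Memory.final (T := T) [out.symm answer]).toCfg m none b o)
      (haltList (p.machine sym m) ([answer].map out.invFun)) := by
    apply Runs.single
    rw [hend]
    rfl
  refine ⟨⟨⟨k + 1, ?_⟩, Nat.succ_le_succ hk⟩⟩
  rw [hstart]
  exact hrun.trans hlast

end StackProg

/-! ### Polynomially bounded functions -/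

/-- `f` is bounded by a polynomial. -/
def PolyLE (f : ℕ → ℕ) : Prop := ∃ C, ∀ W, f W ≤ (W + 2) ^ C

namespace PolyLE

theorem mono {f g : ℕ → ℕ} (hg : PolyLE g) (h : ∀ W, f W ≤ g W) : PolyLE f :=
  let ⟨C, hC⟩ := hg
  ⟨C, fun W => (h W).trans (hC W)⟩

theorem const (c : ℕ) : PolyLE fun _ => c :=
  ⟨c, fun W => (Nat.lt_pow_self (by omega)).le⟩

theorem id : PolyLE fun W => W :=
  ⟨1, fun W => by simp⟩

theorem mul {f g : ℕ → ℕ} (hf : PolyLE f) (hg : PolyLE g) : PolyLE fun W => f W * g W :=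
  let ⟨C, hC⟩ := hf
  let ⟨D, hD⟩ := hg
  ⟨C + D, fun W => by rw [pow_add]; exact Nat.mul_le_mul (hC W) (hD W)⟩

/-- The base `W + 2` is at least two, so the factor two that a sum costs is absorbed by one more
power. -/
theorem add {f g : ℕ → ℕ} (hf : PolyLE f) (hg : PolyLE g) : PolyLE fun W => f W + g W := by
  obtain ⟨C, hC⟩ := hf
  obtain ⟨D, hD⟩ := hg
  refine ⟨C + D + 1, fun W => ?_⟩
  have h₁ : (W + 2) ^ C ≤ (W + 2) ^ (C + D) := Nat.pow_le_pow_right (by omega) (by omega)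
  have h₂ : (W + 2) ^ D ≤ (W + 2) ^ (C + D) := Nat.pow_le_pow_right (by omega) (by omega)
  have h₃ : (W + 2) ^ (C + D) * 2 ≤ (W + 2) ^ (C + D) * (W + 2) :=
    Nat.mul_le_mul_left _ (by omega)
  rw [pow_succ]
  linarith [hC W, hD W]

theorem pow {f : ℕ → ℕ} (hf : PolyLE f) (c : ℕ) : PolyLE fun W => f W ^ c :=
  let ⟨C, hC⟩ := hf
  ⟨C * c, fun W => by rw [pow_mul]; exact Nat.pow_le_pow_left (hC W) c⟩

theorem comp {f g : ℕ → ℕ} (hf : PolyLE f) (hg : PolyLE g) : PolyLE fun W => f (g W) :=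
  let ⟨C, hC⟩ := hf
  ((hg.add (const 2)).pow C).mono fun W => hC (g W)

end PolyLE

namespace StackProg

open Turing Function

variable {T : FinTM2} {sym : TapeSymbol → T.Γ T.k₀}

/-! ### Loops that move the contents of registers -/

/-- All counting loops below are verified through this rule: it suffices to exhibit the memory `S i`
after `i` passes. -/
theorem Exec.loop_iterate {t : Test T} {p : Prog T} (S : ℕ → Memory T) (k c : ℕ)
    (ht : ∀ i < k, t.eval (S i) = true) (hk : t.eval (S k) = false)
    (hp : ∀ i < k, Exec sym p (S i) (S (i + 1)) c) :
    Exec sym (.loop t p) (S 0) (S k) (k * (c + 1) + 1) := by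
  induction k generalizing S with
  | zero => exact (Exec.loopFalse hk).weaken (by omega)
  | succ k ih =>
    refine (Exec.loopTrue (ht 0 (by omega)) (hp 0 (by omega))
      (ih (fun i => S (i + 1)) (fun i hi => ht _ (by omega)) hk
        fun i hi => hp _ (by omega))).weaken (le_of_eq ?_)
    ring

theorem Test.eval_nonempty (s : Memory T) (x : ℕ) :
    (Test.nonempty x : Test T).eval s = true ↔ s.reg x ≠ [] := by
  cases h : s.reg x <;> simp [Test.eval, h]

theorem Test.eval_nonempty_false (s : Memory T) (x : ℕ) :
    (Test.nonempty x : Test T).eval s = false ↔ s.reg x = [] := by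
  cases h : s.reg x <;> simp [Test.eval, h]

abbrev Prog.clear (x : ℕ) : Prog T := .loop (.nonempty x) (.cmd (.pop x))

abbrev Prog.moveAll (x y : ℕ) : Prog T := .loop (.nonempty x) (.cmd (.move x y))

/-- Adds the length of register `x` to the counter `y`. -/
abbrev Prog.addLength (x y : ℕ) : Prog T :=
  .loop (.nonempty x) (.seq (.cmd (.pop x)) (.cmd (.push y .tally)))

/-- Subtracts the length of register `x` from the counter `y`. -/
abbrev Prog.subLength (x y : ℕ) : Prog T :=
  .loop (.nonempty x) (.seq (.cmd (.pop x)) (.cmd (.pop y)))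

theorem exec_clear (R : ℕ → List TapeSymbol) (c) (x : ℕ) :
    Exec (T := T) sym (.clear x) ⟨R, c⟩ ⟨update R x [], c⟩ (2 * (R x).length + 1) := by
  have key := Exec.loop_iterate (sym := sym) (t := .nonempty x) (p := .cmd (.pop x))
    (fun i => ⟨update R x ((R x).drop i), c⟩) (R x).length 1
    (fun i hi => by simp [Test.eval_nonempty, hi]) (by simp [Test.eval_nonempty_false])
    (fun i hi => by
      convert! Exec.cmd (sym := sym) (Cmd.pop x : Cmd T) _ using 1
      simp [Cmd.eval])
  simp only [List.drop_zero, update_eq_self, List.drop_length] at key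
  exact key.weaken (by omega)

theorem exec_moveAll (R : ℕ → List TapeSymbol) (c) {x y : ℕ} (h : x ≠ y) :
    Exec (T := T) sym (.moveAll x y) ⟨R, c⟩
      ⟨update (update R x []) y ((R x).reverse ++ R y), c⟩ (2 * (R x).length + 1) := by
  have key := Exec.loop_iterate (sym := sym) (t := .nonempty x) (p := .cmd (.move x y))
    (fun i => ⟨update (update R x ((R x).drop i)) y (((R x).take i).reverse ++ R y), c⟩)
    (R x).length 1
    (fun i hi => by simp [Test.eval_nonempty, update_of_ne h, hi])
    (by simp [Test.eval_nonempty_false, update_of_ne h])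
    (fun i hi => by
      convert! Exec.cmd (sym := sym) (Cmd.move x y : Cmd T) _ using 1
      simp only [Cmd.eval, update_of_ne h, update_self, List.head?_drop,
        List.getElem?_eq_getElem hi, List.tail_drop, Memory.mk.injEq, and_true]
      funext z
      have : ((R x).take (i + 1)).reverse = (R x)[i] :: ((R x).take i).reverse := by
        rw [List.take_succ_eq_append_getElem hi, List.reverse_append]
        rfl
      simp only [update_apply, this]
      split_ifs <;> simp_all)
  simp only [List.drop_zero, update_eq_self, List.drop_length, List.take_zero, List.reverse_nil,
    List.nil_append, List.take_length] at key
  exact key.weaken (by omega)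

theorem exec_addLength (R : ℕ → List TapeSymbol) (c) {x y : ℕ} (h : x ≠ y) :
    Exec (T := T) sym (.addLength x y) ⟨R, c⟩
      ⟨update (update R x []) y (List.replicate (R x).length .tally ++ R y), c⟩
      (3 * (R x).length + 1) := by
  have key := Exec.loop_iterate (sym := sym) (t := .nonempty x)
    (p := .seq (.cmd (.pop x)) (.cmd (.push y .tally)))
    (fun i => ⟨update (update R x ((R x).drop i)) y (List.replicate i .tally ++ R y), c⟩)
    (R x).length 2
    (fun i hi => by simp [Test.eval_nonempty, update_of_ne h, hi])
    (by simp [Test.eval_nonempty_false, update_of_ne h])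
    (fun i hi => by
      refine (Exec.seq (Exec.cmd _ _) ?_ : Exec sym _ _ _ (1 + 1))
      convert! Exec.cmd (sym := sym) (Cmd.push y .tally : Cmd T) _ using 1
      simp only [Cmd.eval, update_of_ne h, update_self, List.tail_drop, Memory.mk.injEq, and_true]
      funext z
      simp only [update_apply, List.replicate_succ]
      split_ifs <;> simp_all)
  simp only [List.drop_zero, update_eq_self, List.drop_length, List.replicate_zero,
    List.nil_append] at key
  exact key.weaken (by omega)

theorem exec_subLength (R : ℕ → List TapeSymbol) (c) {x y : ℕ} (h : x ≠ y) :
    Exec (T := T) sym (.subLength x y) ⟨R, c⟩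
      ⟨update (update R x []) y ((R y).drop (R x).length), c⟩
      (3 * (R x).length + 1) := by
  have key := Exec.loop_iterate (sym := sym) (t := .nonempty x)
    (p := .seq (.cmd (.pop x)) (.cmd (.pop y)))
    (fun i => ⟨update (update R x ((R x).drop i)) y ((R y).drop i), c⟩)
    (R x).length 2
    (fun i hi => by simp [Test.eval_nonempty, update_of_ne h, hi])
    (by simp [Test.eval_nonempty_false, update_of_ne h])
    (fun i hi => by
      refine (Exec.seq (Exec.cmd _ _) ?_ : Exec sym _ _ _ (1 + 1))
      convert! Exec.cmd (sym := sym) (Cmd.pop y : Cmd T) _ using 1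
      simp only [Cmd.eval, update_of_ne h, update_self, List.tail_drop, Memory.mk.injEq, and_true]
      funext z
      simp only [update_apply]
      split_ifs <;> simp_all)
  simp only [List.drop_zero, update_eq_self, List.drop_length] at key
  exact key.weaken (by omega)

/-! ### List generators -/

/-- Expressions that generate lists of tape symbols. A number is represented by the length of a
list. Variables are numbered by their binding depth. `sum b g` concatenates the lists generated
by `g` when the new variable runs through the numbers below `b`; `iter i k g` starts from `i` and
`k` times replaces the new variable by its difference with `g`; `inp a g` tests whether the entry
number `g` of the input is `a`. -/
inductive Gen
  | emit (a : TapeSymbol)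
  | seq (g h : Gen)
  | sum (b g : Gen)
  | var (x : ℕ)
  | iter (i k g : Gen)
  | inp (a : TapeSymbol) (g : Gen)

namespace Gen

def eval (I : List TapeSymbol) : Gen → ℕ → (ℕ → ℕ) → List TapeSymbol
  | emit a, _, _ => [a]
  | seq g h, d, ρ => g.eval I d ρ ++ h.eval I d ρ
  | sum b g, d, ρ =>
    (List.range (b.eval I d ρ).length).flatMap fun y => g.eval I (d + 1) (update ρ d y)
  | var x, _, ρ => List.replicate (ρ x) .tally
  | iter i k g, d, ρ =>
    List.replicate ((fun x => x - (g.eval I (d + 1) (update ρ d x)).length)^[(k.eval I d ρ).length]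
      (i.eval I d ρ).length) .tally
  | inp a g, d, ρ => if I[(g.eval I d ρ).length]? = some a then [.tally] else []

/-- The register of the variable of depth `x`. -/
def envReg (x : ℕ) : ℕ := 2 * x + 4

/-- The register of the temporary number `x`. -/
def tmpReg (x : ℕ) : ℕ := 2 * x + 5

@[simp] theorem envReg_inj {x y : ℕ} : envReg x = envReg y ↔ x = y := by
  simp only [envReg]; omega

@[simp] theorem tmpReg_inj {x y : ℕ} : tmpReg x = tmpReg y ↔ x = y := by
  simp only [tmpReg]; omega

@[simp] theorem envReg_ne_tmpReg (x y : ℕ) : envReg x ≠ tmpReg y := by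
  simp only [envReg, tmpReg]; omega

@[simp] theorem tmpReg_ne_envReg (x y : ℕ) : tmpReg y ≠ envReg x := by
  simp only [envReg, tmpReg]; omega

theorem envReg_ne {x y : ℕ} (h : y < 4) : envReg x ≠ y := by
  simp only [envReg]; omega

theorem tmpReg_ne {x y : ℕ} (h : y < 4) : tmpReg x ≠ y := by
  simp only [tmpReg]; omega

/-- The program that appends the reversed list to register `r`, using temporaries from `e` on. -/
def compile : Gen → (d e r : ℕ) → Prog T
  | emit a, _, _, r => .cmd (.push r a)
  | seq g h, d, e, r => .seq (g.compile d e r) (h.compile d e r)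
  | sum b g, d, e, r =>
    .seq (b.compile d (e + 1) (tmpReg e))
      (.seq
        -- The temporary counts the remaining passes down while `envReg d` counts up from zero, so
        -- the body sees the current index.
        (.loop (.nonempty (tmpReg e)) (.seq (.cmd (.pop (tmpReg e)))
          (.seq (g.compile (d + 1) (e + 1) r) (.cmd (.push (envReg d) .tally)))))
        (.clear (envReg d)))
  | var x, _, e, r =>
    .seq
      -- A stack is read destructively: the variable is moved to a temporary while it is copied, and
      -- then moved back.
      (.loop (.nonempty (envReg x))
        (.seq (.cmd (.move (envReg x) (tmpReg e))) (.cmd (.push r .tally))))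
      (.moveAll (tmpReg e) (envReg x))
  | iter i k g, d, e, r =>
    .seq (k.compile d (e + 2) (tmpReg e))
      (.seq (i.compile d (e + 2) (tmpReg (e + 1)))
        (.seq (.addLength (tmpReg (e + 1)) (envReg d))
          (.seq
            (.loop (.nonempty (tmpReg e)) (.seq (.cmd (.pop (tmpReg e)))
              (.seq (g.compile (d + 1) (e + 2) (tmpReg (e + 1)))
                (.subLength (tmpReg (e + 1)) (envReg d)))))
            (.addLength (envReg d) r))))
  | inp a g, d, e, r =>
    .seq (g.compile d (e + 1) (tmpReg e))
      (.seq
        -- Access to an entry of the input: the preceding entries are parked in register `1` and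
        -- restored after the test.
        (.loop (.nonempty (tmpReg e)) (.seq (.cmd (.pop (tmpReg e))) (.cmd (.move 0 1))))
        (.seq (.cond (.top 0 a) (.cmd (.push r .tally))) (.moveAll 1 0)))

/-- This is why `iter` may only decrease its value: an unrestricted iteration could leave the
polynomial range. -/
theorem iterate_sub_le (f : ℕ → ℕ) (k n : ℕ) : (fun x => x - f x)^[k] n ≤ n := by
  induction k generalizing n with
  | zero => simp
  | succ k ih =>
    rw [iterate_succ_apply]
    exact (ih _).trans (Nat.sub_le _ _)

/-- All loops are bounded. In a `sum` the new variable stays below the length of the bound, so the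
environment of the body is bounded by `f W + W`, and polynomials are closed under this composition.
-/
theorem length_eval_le (g : Gen) : ∃ f, PolyLE f ∧ ∀ I d ρ W, (∀ x, ρ x ≤ W) →
    (g.eval I d ρ).length ≤ f W := by
  induction g with
  | emit a => exact ⟨fun _ => 1, .const 1, by simp [eval]⟩
  | seq g h ihg ihh =>
    obtain ⟨f, hf, hf'⟩ := ihg
    obtain ⟨f₂, hf₂, hf₂'⟩ := ihh
    refine ⟨_, hf.add hf₂, fun I d ρ W hρ => ?_⟩
    simp only [eval, List.length_append]
    exact Nat.add_le_add (hf' I d ρ W hρ) (hf₂' I d ρ W hρ)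
  | sum b g ihb ihg =>
    obtain ⟨f, hf, hf'⟩ := ihb
    obtain ⟨f₂, hf₂, hf₂'⟩ := ihg
    refine ⟨_, hf.mul (hf₂.comp (hf.add .id)), fun I d ρ W hρ => ?_⟩
    have hb := hf' I d ρ W hρ
    simp only [eval, List.length_flatMap]
    refine (List.sum_le_card_nsmul _ (f₂ (f W + W)) ?_).trans ?_
    · intro x hx
      simp only [List.mem_map, List.mem_range] at hx
      obtain ⟨y, hy, rfl⟩ := hx
      refine hf₂' _ _ _ _ fun x => ?_
      rw [update_apply]
      split_ifs
      · omega
      · exact (hρ x).trans (by omega)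
    · simp only [List.length_map, List.length_range, smul_eq_mul]
      exact Nat.mul_le_mul_right _ hb
  | var x => exact ⟨fun W => W, .id, fun I d ρ W hρ => by simpa [eval] using hρ x⟩
  | iter i k g ihi ihk ihg =>
    obtain ⟨f, hf, hf'⟩ := ihi
    refine ⟨f, hf, fun I d ρ W hρ => ?_⟩
    simp only [eval, List.length_replicate]
    exact (iterate_sub_le _ _ _).trans (hf' I d ρ W hρ)
  | inp a g ihg =>
    refine ⟨fun _ => 1, .const 1, fun I d ρ W hρ => ?_⟩
    simp only [eval]
    split_ifs <;> simp

/-- The registers hold the input `I` and the variables `ρ`, of which those from `d` on are zero;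
the temporaries from `e` on are empty. -/
structure Holds (I : List TapeSymbol) (d e : ℕ) (ρ : ℕ → ℕ) (R : ℕ → List TapeSymbol) : Prop where
  input : R 0 = I
  aux : R 1 = []
  env : ∀ x, R (envReg x) = List.replicate (ρ x) .tally
  zero : ∀ x, d ≤ x → ρ x = 0
  tmp : ∀ x, e ≤ x → R (tmpReg x) = []

/-- The register `r` may receive the output of a generator using temporaries from `e` on. -/
def Target (e r : ℕ) : Prop := r = 2 ∨ r = 3 ∨ ∃ x < e, r = tmpReg x

theorem Target.mono {e e' r : ℕ} (h : Target e r) (he : e ≤ e') : Target e' r := by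
  rcases h with h | h | ⟨x, hx, h⟩
  · exact .inl h
  · exact .inr (.inl h)
  · exact .inr (.inr ⟨x, by omega, h⟩)

theorem Target.tmp {e x : ℕ} (h : x < e) : Target e (tmpReg x) := .inr (.inr ⟨x, h, rfl⟩)

theorem Target.ne_env {e r : ℕ} (h : Target e r) (x : ℕ) : envReg x ≠ r := by
  rcases h with h | h | ⟨y, hy, h⟩ <;> simp only [h, envReg, tmpReg] <;> omega

theorem Target.ne_tmp {e r x : ℕ} (h : Target e r) (hx : e ≤ x) : tmpReg x ≠ r := by
  rcases h with h | h | ⟨y, hy, h⟩ <;> simp only [h, tmpReg] <;> omega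

theorem Target.ne_zero {e r : ℕ} (h : Target e r) : 0 ≠ r := by
  rcases h with h | h | ⟨y, hy, h⟩ <;> simp only [h, tmpReg] <;> omega

theorem Target.ne_one {e r : ℕ} (h : Target e r) : 1 ≠ r := by
  rcases h with h | h | ⟨y, hy, h⟩ <;> simp only [h, tmpReg] <;> omega

variable {I : List TapeSymbol} {d e e' r : ℕ} {ρ : ℕ → ℕ} {R : ℕ → List TapeSymbol}

theorem Holds.mono (h : Holds I d e ρ R) (he : e ≤ e') : Holds I d e' ρ R :=
  ⟨h.input, h.aux, h.env, h.zero, fun x hx => h.tmp x (he.trans hx)⟩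

theorem Holds.update_target (h : Holds I d e ρ R) (hr : Target e r) (l) :
    Holds I d e ρ (update R r l) where
  input := by rw [update_of_ne hr.ne_zero, h.input]
  aux := by rw [update_of_ne hr.ne_one, h.aux]
  env x := by rw [update_of_ne (hr.ne_env x), h.env]
  zero := h.zero
  tmp x hx := by rw [update_of_ne (hr.ne_tmp hx), h.tmp x hx]

theorem Holds.update_env (h : Holds I d e ρ R) (y : ℕ) :
    Holds I (d + 1) e (update ρ d y) (update R (envReg d) (List.replicate y .tally)) where
  input := by rw [update_of_ne (envReg_ne (by omega)).symm, h.input]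
  aux := by rw [update_of_ne (envReg_ne (by omega)).symm, h.aux]
  env x := by
    by_cases hx : x = d
    · simp [hx]
    · rw [update_of_ne (by simpa using hx), update_of_ne hx, h.env]
  zero x hx := by rw [update_of_ne (by omega), h.zero x (by omega)]
  tmp x hx := by rw [update_of_ne (tmpReg_ne_envReg _ _), h.tmp x hx]

theorem Holds.env_eq_nil (h : Holds I d e ρ R) : R (envReg d) = [] := by
  rw [h.env, h.zero d le_rfl, List.replicate_zero]

theorem exec_var (x : ℕ) (c) (h : Holds I d e ρ R) (hr : Target e r) :
    Exec (T := T) sym ((var x).compile d e r) ⟨R, c⟩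
      ⟨update R r (List.replicate (ρ x) .tally ++ R r), c⟩ (5 * ρ x + 2) := by
  have hx : R (envReg x) = List.replicate (ρ x) .tally := h.env x
  have hxt : envReg x ≠ tmpReg e := envReg_ne_tmpReg _ _
  have hxr := hr.ne_env x
  have htr := hr.ne_tmp le_rfl
  have hnil : R (tmpReg e) = [] := h.tmp e le_rfl
  let S : ℕ → ℕ → List TapeSymbol := fun i =>
    update (update (update R (envReg x) (List.replicate (ρ x - i) .tally))
      (tmpReg e) (List.replicate i .tally)) r (List.replicate i .tally ++ R r)
  have key := Exec.loop_iterate (sym := sym) (t := .nonempty (envReg x))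
    (p := .seq (.cmd (.move (envReg x) (tmpReg e))) (.cmd (.push r .tally)))
    (fun i => ⟨S i, c⟩)
    (ρ x) 2
    (fun i hi => by
      simp only [S, Test.eval_nonempty, update_of_ne hxr, update_of_ne hxt, update_self, ne_eq,
        List.replicate_eq_nil_iff]
      omega)
    (by simp [S, Test.eval_nonempty_false, update_of_ne hxr])
    (fun i hi => by
      refine (Exec.seq (Exec.cmd _ _) ?_ : Exec sym _ _ _ (1 + 1))
      convert! Exec.cmd (sym := sym) (Cmd.push r .tally : Cmd T) _ using 1
      obtain ⟨k, hk⟩ : ∃ k, ρ x - i = k + 1 := ⟨ρ x - i - 1, by omega⟩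
      have hk' : ρ x - (i + 1) = k := by omega
      simp only [S, Cmd.eval, update_of_ne hxr, update_of_ne hxt, update_self, hk, hk',
        List.replicate_succ, List.head?_cons, Memory.mk.injEq, and_true, List.tail_cons]
      funext z
      simp only [update_apply]
      split_ifs <;> simp_all)
  have key' := exec_moveAll (T := T) (sym := sym) (S (ρ x)) c hxt.symm
  have h₀ : S 0 = R := by
    funext z
    simp only [S, update_apply]
    split_ifs <;> simp_all
  have h₁ : update (update (S (ρ x)) (tmpReg e) []) (envReg x)
      ((S (ρ x) (tmpReg e)).reverse ++ S (ρ x) (envReg x)) =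
      update R r (List.replicate (ρ x) .tally ++ R r) := by
    funext z
    simp only [S, update_apply]
    split_ifs <;> simp_all
  have h₂ : (S (ρ x) (tmpReg e)).length = ρ x := by simp [S, update_of_ne htr]
  rw [h₁, h₂] at key'
  rw [h₀] at key
  exact (key.seq key').weaken (by omega)

/-- The output is pushed symbol by symbol and hence appears reversed. Only `r` differs in the end,
so the invariant `Holds` survives and compiled pieces can be composed; the configuration `c` of the
embedded machine is not touched. -/
theorem exec_compile (g : Gen) : ∃ f, PolyLE f ∧ ∀ I d e r ρ R c W, (∀ x, ρ x ≤ W) →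
    I.length ≤ W → Holds I d e ρ R → Target e r →
    Exec (T := T) sym (g.compile d e r) ⟨R, c⟩
      ⟨update R r ((g.eval I d ρ).reverse ++ R r), c⟩ (f W) := by
  induction g with
  | emit a =>
    exact ⟨fun _ => 1, .const 1, fun I d e r ρ R c W _ _ _ _ => Exec.cmd _ _⟩
  | var x =>
    refine ⟨fun W => 5 * W + 2, ((PolyLE.const 5).mul .id).add (.const 2),
      fun I d e r ρ R c W hρ _ hR hr => ?_⟩
    have := hρ x
    simpa [eval] using (exec_var x c hR hr).weaken (by omega)
  | seq g h ihg ihh =>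
    obtain ⟨f, hf, hf'⟩ := ihg
    obtain ⟨f₂, hf₂, hf₂'⟩ := ihh
    refine ⟨_, hf.add hf₂, fun I d e r ρ R c W hρ hI hR hr => ?_⟩
    have := (hf' I d e r ρ R c W hρ hI hR hr).seq
      (hf₂' I d e r ρ _ c W hρ hI (hR.update_target hr _) hr)
    simpa only [compile, eval, update_self, update_idem, List.reverse_append,
      List.append_assoc] using this
  | sum b g ihb ihg =>
    obtain ⟨f, hf, hf'⟩ := ihb
    obtain ⟨f₂, hf₂, hf₂'⟩ := ihg
    obtain ⟨l, hl, hl'⟩ := length_eval_le b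
    refine ⟨fun W => f W + (l W * (1 + (f₂ (l W + W) + 1) + 1) + 1 + (2 * l W + 1)),
      hf.add (((hl.mul (((PolyLE.const 1).add ((hf₂.comp (hl.add .id)).add (.const 1))).add
        (.const 1))).add (.const 1)).add (((PolyLE.const 2).mul hl).add (.const 1))),
      fun I d e r ρ R c W hρ hI hR hr => ?_⟩
    have hb := hf' I d (e + 1) (tmpReg e) ρ R c W hρ hI (hR.mono (by omega)) (.tmp (by omega))
    have hlen := hl' I d ρ W hρ
    have hnil := hR.tmp e le_rfl
    have henv := hR.env_eq_nil
    rw [hnil, List.append_nil] at hb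
    simp only [eval]
    generalize b.eval I d ρ = B at *
    have htr := hr.ne_tmp le_rfl
    have hdr := hr.ne_env d
    have hdt : envReg d ≠ tmpReg e := envReg_ne_tmpReg _ _
    -- Loop invariant: after `i` passes the variable is `i` and `r` has received the outputs for all
    -- smaller indices.
    let S : ℕ → ℕ → List TapeSymbol := fun i =>
      update (update (update R (tmpReg e) (B.reverse.drop i)) (envReg d)
        (List.replicate i .tally)) r
        (((List.range i).flatMap fun y => g.eval I (d + 1) (update ρ d y)).reverse ++ R r)
    have key := Exec.loop_iterate (sym := sym) (t := .nonempty (tmpReg e))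
      (p := .seq (.cmd (.pop (tmpReg e)))
          (.seq (g.compile (d + 1) (e + 1) r) (.cmd (.push (envReg d) .tally))))
      (fun i => ⟨S i, c⟩) B.length (1 + (f₂ (l W + W) + 1))
      (fun i hi => by
        simp [S, Test.eval_nonempty, update_of_ne htr, hi])
      (by simp [S, Test.eval_nonempty_false, update_of_ne htr])
      (fun i hi => by
        have hS : Holds I (d + 1) (e + 1) (update ρ d i)
            (update (S i) (tmpReg e) (S i (tmpReg e)).tail) := by
          have h₁ := (((hR.mono (by omega : e ≤ e + 1)).update_target
            (.tmp (by omega : e < e + 1)) (B.reverse.drop i)).update_env i).update_target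
              (hr.mono (by omega : e ≤ e + 1))
              (((List.range i).flatMap fun y => g.eval I (d + 1) (update ρ d y)).reverse ++ R r)
          exact h₁.update_target (.tmp (by omega)) _
        refine Exec.seq (Exec.cmd _ _) (Exec.seq (hf₂' I (d + 1) (e + 1) r (update ρ d i) _ c
          (l W + W) (fun x => ?_) (by omega) hS (hr.mono (by omega))) ?_)
        · rw [update_apply]
          split_ifs
          · omega
          · exact (hρ x).trans (by omega)
        · convert! Exec.cmd (sym := sym) (Cmd.push (envReg d) .tally : Cmd T) _ using 1
          simp only [Cmd.eval, Memory.mk.injEq, and_true]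
          funext z
          simp only [update_apply, S, List.range_succ, List.flatMap_append, List.flatMap_cons,
            List.flatMap_nil, List.append_nil, List.reverse_append, List.replicate_succ]
          split_ifs <;> simp_all)
    have hclear := exec_clear (T := T) (sym := sym) (S B.length) c (envReg d)
    have hS₀ : S 0 = update R (tmpReg e) B.reverse := by
      funext z
      simp only [S, update_apply]
      split_ifs <;> simp_all
    have hS₁ : update (S B.length) (envReg d) [] = update R r
        (((List.range B.length).flatMap fun y => g.eval I (d + 1) (update ρ d y)).reverse ++
          R r) := by
      funext z
      simp only [S, update_apply]
      split_ifs <;> simp_all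
    have hS₂ : (S B.length (envReg d)).length = B.length := by simp [S, update_of_ne hdr]
    rw [hS₁, hS₂] at hclear
    rw [hS₀] at key
    refine (hb.seq (key.seq hclear)).weaken ?_
    gcongr
  | iter i k g ihi ihk ihg =>
    obtain ⟨f, hf, hf'⟩ := ihk
    obtain ⟨f₁, hf₁, hf₁'⟩ := ihi
    obtain ⟨f₂, hf₂, hf₂'⟩ := ihg
    obtain ⟨l, hl, hl'⟩ := length_eval_le k
    obtain ⟨l₁, hl₁, hl₁'⟩ := length_eval_le i
    obtain ⟨l₂, hl₂, hl₂'⟩ := length_eval_le g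
    refine ⟨fun W => f W + (f₁ W + ((3 * l₁ W + 1) +
      (l W * (1 + (f₂ (l₁ W + W) + (3 * l₂ (l₁ W + W) + 1)) + 1) + 1 + (3 * l₁ W + 1)))),
      hf.add (hf₁.add ((((PolyLE.const 3).mul hl₁).add (.const 1)).add
        (((hl.mul (((PolyLE.const 1).add ((hf₂.comp (hl₁.add .id)).add
          (((PolyLE.const 3).mul (hl₂.comp (hl₁.add .id))).add (.const 1)))).add (.const 1))).add
            (.const 1)).add (((PolyLE.const 3).mul hl₁).add (.const 1))))),
      fun I d e r ρ R c W hρ hI hR hr => ?_⟩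
    have hlen := hl' I d ρ W hρ
    have hlen₁ := hl₁' I d ρ W hρ
    have hnil := hR.tmp e le_rfl
    have hnil' := hR.tmp (e + 1) (by omega)
    have henv := hR.env_eq_nil
    have htr := hr.ne_tmp le_rfl
    have htr' := hr.ne_tmp (by omega : e ≤ e + 1)
    have hdr := hr.ne_env d
    have hk := hf' I d (e + 2) (tmpReg e) ρ R c W hρ hI (hR.mono (by omega)) (.tmp (by omega))
    have hi := hf₁' I d (e + 2) (tmpReg (e + 1)) ρ _ c W hρ hI
      ((hR.mono (by omega : e ≤ e + 2)).update_target (.tmp (by omega : e < e + 2))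
        ((k.eval I d ρ).reverse ++ R (tmpReg e))) (.tmp (by omega))
    simp only [eval]
    generalize k.eval I d ρ = K at *
    generalize i.eval I d ρ = N at *
    generalize hF : (fun x => x - (g.eval I (d + 1) (update ρ d x)).length) = F
    have hFle : ∀ j, F^[j] N.length ≤ N.length := fun j => by
      rw [← hF]
      exact iterate_sub_le _ _ _
    -- Loop invariant: after `j` passes `envReg d` holds the `j`-th iterate.
    let S : ℕ → ℕ → List TapeSymbol := fun j =>
      update (update R (tmpReg e) (K.reverse.drop j)) (envReg d)
        (List.replicate (F^[j] N.length) .tally)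
    have key := Exec.loop_iterate (sym := sym) (t := .nonempty (tmpReg e))
      (p := .seq (.cmd (.pop (tmpReg e)))
        (.seq (g.compile (d + 1) (e + 2) (tmpReg (e + 1)))
          (.subLength (tmpReg (e + 1)) (envReg d))))
      (fun i => ⟨S i, c⟩) K.length (1 + (f₂ (l₁ W + W) + (3 * l₂ (l₁ W + W) + 1)))
      (fun i hi => by simp [S, Test.eval_nonempty, hi])
      (by simp [S, Test.eval_nonempty_false])
      (fun j hj => by
        have hS : Holds I (d + 1) (e + 2) (update ρ d (F^[j] N.length))
            (update (S j) (tmpReg e) (S j (tmpReg e)).tail) :=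
          (((hR.mono (by omega : e ≤ e + 2)).update_target
            (.tmp (by omega : e < e + 2)) (K.reverse.drop j)).update_env
              (F^[j] N.length)).update_target (.tmp (by omega)) _
        have hbound : ∀ x, update ρ d (F^[j] N.length) x ≤ l₁ W + W := fun x => by
          rw [update_apply]
          split_ifs
          · have := hFle j
            omega
          · exact (hρ x).trans (by omega)
        have h₁ := hf₂' I (d + 1) (e + 2) (tmpReg (e + 1)) _ _ c
          (l₁ W + W) hbound (by omega) hS (.tmp (by omega))
        have h₂ := hl₂' I (d + 1) _ _ hbound
        refine Exec.seq (Exec.cmd _ _) (Exec.seq h₁ ?_)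
        have h₃ := exec_subLength (T := T) (sym := sym)
          (update (update (S j) (tmpReg e) (S j (tmpReg e)).tail) (tmpReg (e + 1))
            ((g.eval I (d + 1) (update ρ d (F^[j] N.length))).reverse ++
              update (S j) (tmpReg e) (S j (tmpReg e)).tail (tmpReg (e + 1)))) c
          (tmpReg_ne_envReg d (e + 1))
        have h₄ : F^[j + 1] N.length = F^[j] N.length -
            (g.eval I (d + 1) (update ρ d (F^[j] N.length))).length := by
          rw [iterate_succ_apply', ← hF]
        convert! h₃.weaken ?_ using 2
        · funext z
          simp only [S, h₄, update_apply, if_true, tmpReg_ne_envReg, envReg_ne_tmpReg,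
            tmpReg_inj, if_false, List.tail_drop]
          clear * - hnil'
          split_ifs <;> simp_all
        · simp [S, hnil', h₂])
    have hadd := exec_addLength (T := T) (sym := sym)
      (update (update R (tmpReg e) K.reverse) (tmpReg (e + 1)) N.reverse) c
      (tmpReg_ne_envReg d (e + 1))
    have hadd' := exec_addLength (T := T) (sym := sym) (S K.length) c hdr
    have hS₀ : update (update (update (update R (tmpReg e) K.reverse) (tmpReg (e + 1)) N.reverse)
        (tmpReg (e + 1)) []) (envReg d) (List.replicate N.length .tally) = S 0 := by
      funext z
      simp only [S, update_apply, List.drop_zero, iterate_zero, id]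
      clear * - hnil'
      split_ifs <;> simp_all
    have hS₁ : update (update (S K.length) (envReg d) []) r
        (List.replicate (S K.length (envReg d)).length .tally ++ S K.length r) = update R r
          ((List.replicate (F^[K.length] N.length) .tally).reverse ++ R r) := by
      have hKlen : K.reverse.drop K.length = [] := by simp
      funext z
      simp only [S, update_apply, hKlen, List.reverse_replicate, List.length_replicate,
        if_neg hdr.symm, if_neg htr.symm, if_true]
      clear * - henv hnil
      split_ifs <;> simp_all
    have hS₂ : (S K.length (envReg d)).length = F^[K.length] N.length := by simp [S]
    rw [hS₁, hS₂] at hadd'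
    simp only [update_self, List.length_reverse, hnil, hnil', henv, List.append_nil,
      update_of_ne (envReg_ne_tmpReg _ _), ne_eq, tmpReg_inj, Nat.succ_ne_self,
      not_false_eq_true, update_of_ne] at hadd hk hi
    rw [hS₀] at hadd
    refine (hk.seq (hi.seq (hadd.seq (key.seq hadd')))).weaken ?_
    have := (hFle K.length).trans hlen₁
    gcongr
  | inp a g ihg =>
    obtain ⟨f, hf, hf'⟩ := ihg
    obtain ⟨l, hl, hl'⟩ := length_eval_le g
    refine ⟨fun W => f W + ((l W * (2 + 1) + 1) + ((1 + 1) + (2 * W + 1))),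
      hf.add (((hl.mul (.const 3)).add (.const 1)).add ((PolyLE.const 2).add
        (((PolyLE.const 2).mul .id).add (.const 1)))),
      fun I d e r ρ R c W hρ hI hR hr => ?_⟩
    have hlen := hl' I d ρ W hρ
    have hnil := hR.tmp e le_rfl
    have htr := hr.ne_tmp le_rfl
    have h0r := hr.ne_zero
    have h1r := hr.ne_one
    have hin := hR.input
    have haux := hR.aux
    have h0t : tmpReg e ≠ 0 := tmpReg_ne (by omega)
    have h1t : tmpReg e ≠ 1 := tmpReg_ne (by omega)
    have hg := hf' I d (e + 1) (tmpReg e) ρ R c W hρ hI (hR.mono (by omega)) (.tmp (by omega))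
    simp only [eval]
    generalize g.eval I d ρ = K at *
    -- Loop invariant: after `j` passes the first `j` entries of the input are in register `1`,
    -- reversed.
    let S : ℕ → ℕ → List TapeSymbol := fun j =>
      update (update (update R (tmpReg e) (K.reverse.drop j)) 0 (I.drop j)) 1 (I.take j).reverse
    have key := Exec.loop_iterate (sym := sym) (t := .nonempty (tmpReg e))
      (p := .seq (.cmd (.pop (tmpReg e))) (.cmd (.move 0 1)))
      (fun i => ⟨S i, c⟩) K.length 2
      (fun i hi => by simp [S, Test.eval_nonempty, hi, update_of_ne h0t, update_of_ne h1t])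
      (by simp [S, Test.eval_nonempty_false, update_of_ne h0t, update_of_ne h1t])
      (fun j hj => by
        refine (Exec.seq (Exec.cmd _ _) ?_ : Exec sym _ _ _ (1 + 1))
        convert! Exec.cmd (sym := sym) (Cmd.move 0 1 : Cmd T) _ using 1
        simp only [S, Cmd.eval, update_self, update_of_ne h0t, update_of_ne h1t,
          update_of_ne h0t.symm, update_of_ne zero_ne_one]
        have htake : I.take (j + 1) = I.take j ++ I[j]?.toList := List.take_add_one
        rw [List.head?_drop]
        cases hj' : I[j]? with
        -- Past the end of the input `move` does nothing, in agreement with `drop` and `take`.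
        | none =>
          have := List.getElem?_eq_none_iff.1 hj'
          simp only [Memory.mk.injEq, and_true]
          funext z
          simp only [update_apply, htake, hj', List.drop_eq_nil_of_le this,
            List.drop_eq_nil_of_le (this.trans (Nat.le_succ _))]
          clear * - h0t h1t
          split_ifs <;> simp_all
        | some a =>
          simp only [Memory.mk.injEq, and_true]
          funext z
          simp only [update_apply, htake, hj']
          clear * - h0t h1t
          split_ifs <;> simp_all)
    let U := if I[K.length]? = some a then [TapeSymbol.tally] else []
    have hcond : Exec (T := T) sym (.cond (.top 0 a) (.cmd (.push r .tally)))
        ⟨S K.length, c⟩ ⟨update (S K.length) r (U ++ S K.length r), c⟩ (1 + 1) := by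
      have htest : (Test.top 0 a : Test T).eval ⟨S K.length, c⟩ =
          (I[K.length]? == some a) := by
        simp [Test.eval, S]
      by_cases h : I[K.length]? = some a
      · have hU : U = [.tally] := if_pos h
        rw [hU]
        exact Exec.condTrue (by simp [htest, h]) (Exec.cmd _ _)
      · have hU : U = [] := if_neg h
        rw [hU, List.nil_append, update_eq_self]
        exact (Exec.condFalse (by simp [htest, h])).weaken (by omega)
    have hmove := exec_moveAll (T := T) (sym := sym)
      (update (S K.length) r (U ++ S K.length r)) c one_ne_zero
    have hS₀ : S 0 = update R (tmpReg e) K.reverse := by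
      funext z
      simp only [S, update_apply, List.drop_zero, List.take_zero]
      clear * - hin haux h0t h1t
      split_ifs <;> simp_all
    have hS₁ : update (update (update (S K.length) r (U ++ S K.length r)) 1 []) 0
        ((update (S K.length) r (U ++ S K.length r) 1).reverse ++
          update (S K.length) r (U ++ S K.length r) 0) = update R r (U.reverse ++ R r) := by
      have hU : U.reverse = U := by
        simp only [U]
        split_ifs <;> simp
      have hKlen : K.reverse.drop K.length = [] := by simp
      funext z
      simp only [S, update_apply, hKlen, hU, if_neg h0r, if_neg h1r, if_neg h0r.symm,
        if_neg h1r.symm, if_neg htr.symm]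
      clear * - hin haux hnil h0r h1r
      split_ifs <;> simp_all
    have hS₂ : (update (S K.length) r (U ++ S K.length r) 1).length ≤ W := by
      simp [S, update_of_ne h1r]
      omega
    rw [hS₁] at hmove
    rw [hnil, List.append_nil, ← hS₀] at hg
    refine (hg.seq (key.seq (hcond.seq hmove))).weaken ?_
    gcongr

end Gen

end StackProg

namespace StackProg

open Turing Function

/-! ### Generators with named variables

A term is a generator that may be placed at any binding depth; binders are Lean functions. -/

structure World where
  depth : ℕ
  val : ℕ → ℕ

/-- A larger world binds further variables and keeps the old ones. Judgments about a term quantify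
over all larger worlds and thus remain valid under binders. -/
instance : Preorder World where
  le w w' := w.depth ≤ w'.depth ∧ ∀ i < w.depth, w'.val i = w.val i
  le_refl w := ⟨le_rfl, fun _ _ => rfl⟩
  le_trans u v w h h' :=
    ⟨h.1.trans h'.1, fun i hi => (h'.2 i (hi.trans_le h.1)).trans (h.2 i hi)⟩

def World.push (w : World) (y : ℕ) : World := ⟨w.depth + 1, update w.val w.depth y⟩

theorem World.le_push (w : World) (y : ℕ) : w ≤ w.push y :=
  ⟨Nat.le_succ _, fun i hi => update_of_ne (by omega) _ _⟩

def Term : Type := ℕ → Gen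

namespace Term

def var (x : ℕ) : Term := fun _ => .var x

def emit (a : TapeSymbol) : Term := fun _ => .emit a

def cat (x y : Term) : Term := fun d => .seq (x d) (y d)

def sum (b : Term) (g : Term → Term) : Term := fun d => .sum (b d) (g (var d) (d + 1))

def iter (i k : Term) (g : Term → Term) : Term := fun d =>
  .iter (i d) (k d) (g (var d) (d + 1))

def inp (a : TapeSymbol) (x : Term) : Term := fun d => .inp a (x d)

def one : Term := emit .tally

/-- The value is one more than the argument: `num 1` is two and `num 2` is three. -/
def num : ℕ → Term
  | 0 => one
  | n + 1 => cat (num n) one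

def sub (x y : Term) : Term := iter x y fun _ => one

def mul (x y : Term) : Term := sum x fun _ => y

def not (x : Term) : Term := sub one x

/-- The double negation turns any nonzero truth value into one, so that `x` is generated at most
once. -/
def when (c x : Term) : Term := sum (not (not c)) fun _ => x

def lt (x y : Term) : Term := sub y x

def eq (x y : Term) : Term := not (cat (lt x y) (lt y x))

def and (x y : Term) : Term := not (cat (not x) (not y))

def imp (x y : Term) : Term := cat (not x) y

def all (b : Term) (g : Term → Term) : Term := not (sum b fun y => not (g y))

def count (b : Term) (g : Term → Term) : Term := sum b fun y => not (not (g y))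

/-- The quotient is the number of positive multiples of `y` that are at most `x`, and for positive
`y` there are at most `x` of them. -/
def div (x y : Term) : Term := count x fun z => not (lt x (mul (cat z one) y))

def mod (x y : Term) : Term := sub x (mul y (div x y))

/-- `x / y ^ p`. -/
def divPow (x y p : Term) : Term := iter x p fun z => sub z (div z y)

def bit (s j : Term) : Term := eq (mod (divPow s (num 1) j) (num 1)) one

/-- The list generated by the term in the world `w`. -/
def eval (I : List TapeSymbol) (w : World) (x : Term) : List TapeSymbol :=
  (x w.depth).eval I w.depth w.val

end Term

variable (I : List TapeSymbol) (w : World)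

/-- In `w` and its extensions the term `x` generates the list `L`. -/
def Den (x : Term) (L : List TapeSymbol) : Prop := ∀ w', w ≤ w' → x.eval I w' = L

/-- In `w` and its extensions the term `x` has the value `k`. -/
def Num (x : Term) (k : ℕ) : Prop := ∀ w', w ≤ w' → (x.eval I w').length = k

/-- In `w` and its extensions the term `x` is nonzero if and only if `P` holds. -/
def Tr (x : Term) (P : Prop) : Prop := ∀ w', w ≤ w' → ((x.eval I w').length ≠ 0 ↔ P)

variable {I w} {w' : World} {x y b : Term} {g : Term → Term} {L L' : List TapeSymbol}
  {k l : ℕ} {P Q : Prop}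

theorem Den.mono (h : Den I w x L) (hw : w ≤ w') : Den I w' x L :=
  fun v hv => h v (hw.trans hv)

theorem Num.mono (h : Num I w x k) (hw : w ≤ w') : Num I w' x k :=
  fun v hv => h v (hw.trans hv)

theorem Den.congr (h : Den I w x L) (hL : L = L') : Den I w x L' := hL ▸ h

theorem Num.congr (h : Num I w x k) (hk : k = l) : Num I w x l := hk ▸ h

theorem Tr.congr (h : Tr I w x P) (hP : P ↔ Q) : Tr I w x Q :=
  fun w' hw => (h w' hw).trans hP

theorem Den.num (h : Den I w x L) : Num I w x L.length := fun w' hw => by rw [h w' hw]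

theorem Num.var {i : ℕ} (hi : i < w.depth) : Num I w (Term.var i) (w.val i) := fun w' hw => by
  simp [Term.eval, Term.var, Gen.eval, hw.2 i hi]

theorem Den.emit (a : TapeSymbol) : Den I w (.emit a) [a] := fun _ _ => rfl

theorem Den.cat (hx : Den I w x L) (hy : Den I w y L') : Den I w (x.cat y) (L ++ L') :=
  fun w' hw => congrArg₂ _ (hx w' hw) (hy w' hw)

theorem Num.one : Num I w .one 1 := fun _ _ => rfl

theorem Num.add (hx : Num I w x k) (hy : Num I w y l) : Num I w (x.cat y) (k + l) :=
  fun w' hw => List.length_append.trans (congrArg₂ _ (hx w' hw) (hy w' hw))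

theorem Num.num (n : ℕ) : Num I w (.num n) (n + 1) := by
  induction n with
  | zero => exact .one
  | succ n ih => exact ih.add .one

theorem Term.eval_sum (b : Term) (g : Term → Term) (w : World) :
    (Term.sum b g).eval I w = (List.range (b.eval I w).length).flatMap fun y =>
      (g (.var w.depth)).eval I (w.push y) := rfl

theorem Num.var_push (w : World) (n : ℕ) : Num I (w.push n) (.var w.depth) n := by
  have : Num I (w.push n) (.var w.depth) ((w.push n).val w.depth) := .var (Nat.lt_succ_self _)
  simpa [World.push] using this

/-- The premise treats an arbitrary term `v` of value `n` in an arbitrary larger world, so binding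
depths never appear when the rule is applied. -/
theorem Den.sum {F : ℕ → List TapeSymbol} (hb : Num I w b k)
    (hg : ∀ w', w ≤ w' → ∀ v n, n < k → Num I w' v n → Den I w' (g v) (F n)) :
    Den I w (.sum b g) ((List.range k).flatMap F) := fun w' hw => by
  rw [Term.eval_sum, hb w' hw]
  refine List.flatMap_congr fun n hn => ?_
  exact hg (w'.push n) (hw.trans (w'.le_push n)) _ n (List.mem_range.1 hn) (.var_push _ _) _ le_rfl

theorem Num.sum {f : ℕ → ℕ} (hb : Num I w b k)
    (hg : ∀ w', w ≤ w' → ∀ v n, n < k → Num I w' v n → Num I w' (g v) (f n)) :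
    Num I w (.sum b g) (∑ n ∈ Finset.range k, f n) := fun w' hw => by
  rw [Term.eval_sum, hb w' hw, List.length_flatMap, Finset.sum_range, ← List.sum_ofFn,
    List.ofFn_eq_map, ← List.map_coe_finRange_eq_range, List.map_map]
  congr 1
  refine List.map_congr_left fun n _ => ?_
  exact hg (w'.push n) (hw.trans (w'.le_push n)) _ n n.2 (.var_push _ _) _ le_rfl

theorem Tr.ex {p : ℕ → Prop} (hb : Num I w b k)
    (hg : ∀ w', w ≤ w' → ∀ v n, n < k → Num I w' v n → Tr I w' (g v) (p n)) :
    Tr I w (.sum b g) (∃ n < k, p n) := fun w' hw => by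
  rw [Term.eval_sum, hb w' hw, Ne, List.length_eq_zero_iff, List.flatMap_eq_nil_iff]
  simp only [List.mem_range, not_forall, exists_prop]
  refine exists_congr fun n => and_congr_right fun hn => ?_
  rw [← List.length_eq_zero_iff]
  exact hg (w'.push n) (hw.trans (w'.le_push n)) _ n hn (.var_push _ _) _ le_rfl

theorem Num.iter {i c : Term} {f : ℕ → ℕ} (hi : Num I w i k) (hc : Num I w c l)
    (hg : ∀ w', w ≤ w' → ∀ v n, Num I w' v n → Num I w' (g v) (f n)) :
    Num I w (.iter i c g) ((fun x => x - f x)^[l] k) := fun w' hw => by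
  have h : ∀ n, ((g (.var w'.depth)).eval I (w'.push n)).length = f n := fun n =>
    hg (w'.push n) (hw.trans (w'.le_push n)) _ n (.var_push _ _) _ le_rfl
  have h' : (Term.iter i c g).eval I w' = List.replicate
      ((fun x => x - ((g (.var w'.depth)).eval I (w'.push x)).length)^[(c.eval I w').length]
        (i.eval I w').length) .tally := rfl
  rw [h', List.length_replicate, hi w' hw, hc w' hw]
  simp only [h]

theorem Tr.inp {a : TapeSymbol} (hx : Num I w x k) : Tr I w (.inp a x) (I[k]? = some a) :=
  fun w' hw => by
  have h : (Term.inp a x).eval I w' =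
    if I[(x.eval I w').length]? = some a then [.tally] else [] := rfl
  rw [h, hx w' hw]
  split_ifs with h <;> simp [h]

theorem Term.length_eval_sub (x y : Term) (w : World) :
    ((x.sub y).eval I w).length = (x.eval I w).length - (y.eval I w).length := by
  have h : (x.sub y).eval I w = List.replicate
      ((fun x => x - 1)^[(y.eval I w).length] (x.eval I w).length) .tally := rfl
  rw [h, List.length_replicate]
  generalize (y.eval I w).length = l
  induction l with
  | zero => rfl
  | succ l ih => rw [iterate_succ_apply', ih, Nat.sub_sub]

theorem Num.sub (hx : Num I w x k) (hy : Num I w y l) : Num I w (x.sub y) (k - l) :=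
  fun w' hw => by rw [Term.length_eval_sub, hx w' hw, hy w' hw]

theorem Num.mul (hx : Num I w x k) (hy : Num I w y l) : Num I w (x.mul y) (k * l) :=
  (Num.sum (f := fun _ => l) hx fun _ hw _ _ _ _ => hy.mono hw).congr (by simp)

theorem Num.tr (hx : Num I w x k) : Tr I w x (k ≠ 0) := fun w' hw => by rw [hx w' hw]

theorem Term.length_eval_not (x : Term) (w : World) :
    (x.not.eval I w).length = 1 - (x.eval I w).length :=
  Term.length_eval_sub _ _ _

theorem Tr.not (hx : Tr I w x P) : Tr I w x.not (¬ P) := fun w' hw => by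
  rw [Term.length_eval_not, ← hx w' hw]
  omega

theorem Tr.num [Decidable P] (hx : Tr I w x P) : Num I w x.not.not (if P then 1 else 0) :=
  fun w' hw => by
  have := hx w' hw
  rw [Term.length_eval_not, Term.length_eval_not]
  split_ifs with h <;> simp only [h, iff_true, iff_false] at this <;> omega

theorem Den.when [Decidable P] (hx : Tr I w x P) (hy : Den I w y L) :
    Den I w (.when x y) (if P then L else []) := by
  refine (Den.sum (F := fun _ => L) hx.num fun _ hw _ _ _ _ => hy.mono hw).congr ?_
  split_ifs <;> simp

theorem Tr.or (hx : Tr I w x P) (hy : Tr I w y Q) : Tr I w (x.cat y) (P ∨ Q) := fun w' hw => by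
  have h : (x.cat y).eval I w' = x.eval I w' ++ y.eval I w' := rfl
  rw [← hx w' hw, ← hy w' hw, h, List.length_append]
  omega

theorem Tr.and (hx : Tr I w x P) (hy : Tr I w y Q) : Tr I w (x.and y) (P ∧ Q) :=
  (hx.not.or hy.not).not.congr (by tauto)

theorem Tr.imp (hx : Tr I w x P) (hy : Tr I w y Q) : Tr I w (x.imp y) (P → Q) :=
  (hx.not.or hy).congr imp_iff_not_or.symm

theorem Tr.lt (hx : Num I w x k) (hy : Num I w y l) : Tr I w (x.lt y) (k < l) :=
  (hy.sub hx).tr.congr (by omega)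

theorem Tr.eq (hx : Num I w x k) (hy : Num I w y l) : Tr I w (x.eq y) (k = l) :=
  ((Tr.lt hx hy).or (Tr.lt hy hx)).not.congr (by omega)

theorem Tr.all {p : ℕ → Prop} (hb : Num I w b k)
    (hg : ∀ w', w ≤ w' → ∀ v n, n < k → Num I w' v n → Tr I w' (g v) (p n)) :
    Tr I w (.all b g) (∀ n < k, p n) :=
  (Tr.ex (p := fun n => ¬ p n) hb fun w' hw v n hn hv => (hg w' hw v n hn hv).not).not.congr
    (by simp)

theorem Num.count {p : ℕ → Prop} [DecidablePred p] (hb : Num I w b k)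
    (hg : ∀ w', w ≤ w' → ∀ v n, n < k → Num I w' v n → Tr I w' (g v) (p n)) :
    Num I w (.count b g) {n ∈ Finset.range k | p n}.card :=
  (Num.sum hb fun w' hw v n hn hv => (hg w' hw v n hn hv).num).congr
    (Finset.card_filter _ _).symm

theorem Num.div (hx : Num I w x k) (hy : Num I w y l) (hl : 0 < l) :
    Num I w (x.div y) (k / l) := by
  refine (Num.count (p := fun z => ¬ k < (z + 1) * l) hx fun w' hw v n _ hv =>
    (Tr.lt (hx.mono hw) ((hv.add .one).mul (hy.mono hw))).not).congr ?_
  have : {z ∈ Finset.range k | ¬ k < (z + 1) * l} = Finset.range (k / l) := by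
    ext z
    simp only [Finset.mem_filter, Finset.mem_range, not_lt, ← Nat.le_div_iff_mul_le hl]
    have := Nat.div_le_self k l
    omega
  rw [this, Finset.card_range]

theorem Num.mod (hx : Num I w x k) (hy : Num I w y l) (hl : 0 < l) :
    Num I w (x.mod y) (k % l) :=
  (hx.sub (hy.mul (hx.div hy hl))).congr Nat.mod_eq_sub_mul_div.symm

theorem Num.divPow {p : Term} {m : ℕ} (hx : Num I w x k) (hy : Num I w y l) (hl : 0 < l)
    (hp : Num I w p m) : Num I w (x.divPow y p) (k / l ^ m) := by
  -- Subtracting `z - z / l` from `z` leaves `z / l`.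
  refine (Num.iter (f := fun z => z - z / l) hx hp fun w' hw v n hv =>
    hv.sub (hv.div (hy.mono hw) hl)).congr ?_
  induction m generalizing p with
  | zero => simp
  | succ m ih =>
    -- The induction hypothesis needs some term of value `m`; the predecessor of `p` is one.
    rw [iterate_succ_apply', ih (p := .sub p .one) (hp.sub .one), pow_succ, ← Nat.div_div_eq_div_mul]
    exact Nat.sub_sub_self (Nat.div_le_self _ _)

theorem Tr.bit {s j : Term} (hs : Num I w s k) (hj : Num I w j l) :
    Tr I w (s.bit j) (k.testBit l = true) :=
  (Tr.eq ((hs.divPow (.num 1) (by omega) hj).mod (.num 1) (by omega)) .one).congr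
    (by simp [Nat.testBit_eq_decide_div_mod_eq])

end StackProg

/-! ### Constraint satisfaction instances with numbers as variables and values -/

/-- A constraint whose variables and values are natural numbers. -/
abbrev NatConstraint : Type := List ℕ × List (List ℕ)

namespace NatConstraint

/-- `C` is a constraint over the variables below `N` and the values below `D`. -/
structure Valid (N D : ℕ) (C : NatConstraint) : Prop where
  scope_ne_nil : C.1 ≠ []
  scope_nodup : C.1.Nodup
  scope_lt : ∀ x ∈ C.1, x < N
  rel_nodup : C.2.Nodup
  rel_length : ∀ t ∈ C.2, t.length = C.1.length
  rel_lt : ∀ t ∈ C.2, ∀ v ∈ t, v < D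

def encode (C : NatConstraint) : List TapeSymbol :=
  (C.1.flatMap fun x => List.replicate x .tally ++ [.comma]) ++ [.semicolon] ++
    (C.2.flatMap fun t =>
      (t.flatMap fun v => List.replicate v .tally ++ [.comma]) ++ [.semicolon]) ++ [.hash]

end NatConstraint

theorem List.map_val_map_ofNat {N : ℕ} [NeZero N] {l : List ℕ} (h : ∀ x ∈ l, x < N) :
    (l.map (Fin.ofNat N)).map Fin.val = l := by
  rw [List.map_map]
  conv_rhs => rw [← List.map_id l]
  exact List.map_congr_left fun x hx => Nat.mod_eq_of_lt (h x hx)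

theorem List.map_map_val_map_map_ofNat {N : ℕ} [NeZero N] {l : List (List ℕ)}
    (h : ∀ t ∈ l, ∀ x ∈ t, x < N) :
    (l.map (List.map (Fin.ofNat N))).map (List.map Fin.val) = l := by
  rw [List.map_map]
  conv_rhs => rw [← List.map_id l]
  exact List.map_congr_left fun t ht => List.map_val_map_ofNat (h t ht)

def NatConstraint.Valid.toConstraint {N D : ℕ} [NeZero N] [NeZero D] {C : NatConstraint}
    (h : C.Valid N D) : CSPConstraint N D where
  scope := C.1.map (Fin.ofNat N)
  scope_ne_nil := by simpa using h.scope_ne_nil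
  scope_nodup := List.Nodup.of_map Fin.val (by
    rw [List.map_val_map_ofNat h.scope_lt]
    exact h.scope_nodup)
  rel := C.2.map (List.map (Fin.ofNat D))
  rel_nodup := List.Nodup.of_map (List.map Fin.val) (by
    rw [List.map_map_val_map_map_ofNat h.rel_lt]
    exact h.rel_nodup)
  rel_length s hs := by
    obtain ⟨t, ht, rfl⟩ := List.mem_map.1 hs
    simpa using h.rel_length t ht

section

variable {N D : ℕ} [NeZero N] [NeZero D] {C : NatConstraint}

theorem NatConstraint.Valid.map_scope (h : C.Valid N D) :
    h.toConstraint.scope.map Fin.val = C.1 := List.map_val_map_ofNat h.scope_lt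

theorem NatConstraint.Valid.map_rel (h : C.Valid N D) :
    h.toConstraint.rel.map (List.map Fin.val) = C.2 := List.map_map_val_map_map_ofNat h.rel_lt

theorem NatConstraint.Valid.mem_scope (h : C.Valid N D) (x : Fin N) :
    x ∈ h.toConstraint.scope ↔ (x : ℕ) ∈ C.1 := by
  rw [← h.map_scope, List.mem_map_of_injective Fin.val_injective]

theorem NatConstraint.Valid.mem_rel (h : C.Valid N D) (t : List (Fin D)) :
    t ∈ h.toConstraint.rel ↔ t.map Fin.val ∈ C.2 := by
  conv_rhs => rw [← h.map_rel]
  rw [List.mem_map_of_injective (List.map_injective_iff.2 Fin.val_injective)]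

/-- A list of constraints over the variables below `N` and the values below `D`. -/
structure ValidConstraints (N D : ℕ) (cs : List NatConstraint) : Prop where
  valid : ∀ C ∈ cs, C.Valid N D
  nodup : (cs.map Prod.fst).Nodup
  var_occurs : ∀ x < N, ∃ C ∈ cs, x ∈ C.1
  val_occurs : ∀ v < D, ∃ C ∈ cs, ∃ t ∈ C.2, v ∈ t

namespace ValidConstraints

variable {cs : List NatConstraint} (h : ValidConstraints N D cs)

def constraints : List (CSPConstraint N D) :=
  cs.attach.map fun C => (h.valid C.1 C.2).toConstraint

theorem mem_constraints (C : CSPConstraint N D) :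
    C ∈ h.constraints ↔ ∃ (C' : NatConstraint) (h' : C' ∈ cs), (h.valid C' h').toConstraint = C := by
  simp [constraints]

abbrev toInstance : CSPInstance where
  vars := N
  dom := D
  constraints := h.constraints
  constraints_nodup := by
    refine List.Nodup.of_map (fun p => p.1.map Fin.val) ?_
    have : h.constraints.map (fun C => C.scope.map Fin.val) = cs.map Prod.fst := by
      rw [constraints, List.map_map]
      conv_rhs => rw [← List.attach_map_subtype_val cs, List.map_map]
      exact List.map_congr_left fun C _ => (h.valid C.1 C.2).map_scope
    rw [List.map_map]
    exact this ▸ h.nodup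
  var_occurs x := by
    obtain ⟨C, hC, hx⟩ := h.var_occurs x x.2
    exact ⟨_, (h.mem_constraints _).2 ⟨C, hC, rfl⟩, ((h.valid C hC).mem_scope x).2 hx⟩
  val_occurs v := by
    obtain ⟨C, hC, s, hs, hv⟩ := h.val_occurs v v.2
    rw [← (h.valid C hC).map_rel] at hs
    obtain ⟨t, ht, rfl⟩ := List.mem_map.1 hs
    exact ⟨_, (h.mem_constraints _).2 ⟨C, hC, rfl⟩, t, ht,
      (List.mem_map_of_injective Fin.val_injective).1 hv⟩

theorem encode_toInstance : h.toInstance.encode =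
    List.replicate N .tally ++ [.hash] ++ List.replicate D .tally ++ [.hash] ++
      cs.flatMap NatConstraint.encode := by
  have key : ∀ {C : NatConstraint} (hC : C.Valid N D), C.encode =
      ((hC.toConstraint.scope.map Fin.val).flatMap fun x =>
        List.replicate x .tally ++ [.comma]) ++
        [.semicolon] ++ (hC.toConstraint.rel.flatMap fun t =>
          ((t.map Fin.val).flatMap fun v => List.replicate v .tally ++ [.comma]) ++
            [.semicolon]) ++
        [.hash] := by
    intro C hC
    rw [NatConstraint.encode, hC.map_scope]
    conv_lhs => rw [← hC.map_rel, List.flatMap_map]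
  have hcs : cs.flatMap NatConstraint.encode =
      cs.attach.flatMap fun C => NatConstraint.encode C.1 := by
    conv_lhs => rw [← List.attach_map_subtype_val cs, List.flatMap_map]
  simp only [CSPInstance.encode, constraints, hcs, List.flatMap_map, key (h.valid _ (Subtype.prop _)),
    List.bind_eq_flatMap, List.pure_def, ← List.map_eq_flatMap]

theorem consistent_toInstance : h.toInstance.Consistent ↔
    ∃ τ : ℕ → ℕ, (∀ x, τ x < D) ∧ ∀ C ∈ cs, C.1.map τ ∈ C.2 := by
  constructor
  · rintro ⟨τ, hτ⟩
    refine ⟨fun x => (τ (Fin.ofNat N x)).val, fun x => (τ _).2, fun C hC => ?_⟩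
    have := hτ _ ((h.mem_constraints _).2 ⟨C, hC, rfl⟩)
    have := ((h.valid C hC).mem_rel _).1 this
    change List.map Fin.val (List.map τ (List.map (Fin.ofNat N) C.1)) ∈ C.2 at this
    simpa only [List.map_map, Function.comp_def] using this
  · rintro ⟨τ, hτD, hτ⟩
    refine ⟨fun x => ⟨τ x, hτD x⟩, fun C hC => ?_⟩
    obtain ⟨C, hC', rfl⟩ := (h.mem_constraints _).1 hC
    refine ((h.valid C hC').mem_rel _).2 ?_
    have := hτ C hC'
    rw [← (h.valid C hC').map_scope] at this
    simpa only [List.map_map, Function.comp_def] using this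

theorem degree_toInstance (x : Fin N) :
    h.toInstance.degree x = (cs.filter fun C => decide ((x : ℕ) ∈ C.1)).length := by
  have hcs : (cs.filter fun C => decide ((x : ℕ) ∈ C.1)).length =
      (cs.attach.filter fun C => decide ((x : ℕ) ∈ C.1.1)).length := by
    conv_lhs => rw [← List.attach_map_subtype_val cs, List.filter_map, List.length_map]
    rfl
  simp only [CSPInstance.degree, constraints, hcs, List.filter_map, List.length_map,
    Function.comp_def, (h.valid _ (Subtype.prop _)).mem_scope]

end ValidConstraints

end

/-! ### The instances of a formula -/

/-- A clause whose variables are natural numbers. -/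
abbrev NatClause : Type := List (ℕ × Bool)

namespace BlockReduction

/-- The block of variables of the formula that is copied to slot `r`; every three of the `t` blocks
appear in the slots `3 * q`, `3 * q + 1`, `3 * q + 2` for some `q < t ^ 3`. -/
def block (t r : ℕ) : ℕ := r / 3 / t ^ (r % 3) % t

/-- The variable of the formula of which `x` is a copy. -/
def owner (b t x : ℕ) : ℕ := block t (x / b) * b + x % b

/-- In group `q`, under the assignment with bits `s`, all copies of the variable of `l` have the
value that makes `l` true. -/
def LitSat (b t q s : ℕ) (l : ℕ × Bool) : Prop :=
  ∀ j < 3 * b, owner b t (q * (3 * b) + j) = l.1 → s.testBit j = l.2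

/-- A literal whose variable has no copy in the group counts as satisfied. Thus every clause may be
imposed on every group, and it has an effect only where all its variables are present. -/
def GroupSat (Cs : List NatClause) (b t q s : ℕ) : Prop := ∀ C ∈ Cs, ∃ l ∈ C, LitSat b t q s l

def bits (w s : ℕ) : List ℕ := (List.range w).map fun j => if s.testBit j then 1 else 0

open Classical in
noncomputable def groupConstraint (Cs : List NatClause) (b t q : ℕ) : NatConstraint :=
  ((List.range (3 * b)).map fun j => q * (3 * b) + j,
    ((List.range (8 ^ b)).filter fun s => decide (GroupSat Cs b t q s)).map (bits (3 * b)))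

/-- The copies of the variable `v`. -/
def copies (b t v : ℕ) : List ℕ :=
  (List.range (t * t * t * (3 * b))).filter fun x => decide (owner b t x = v)

/-- Equality of all copies at once is a single constraint with two tuples, whatever the number of
copies; a chain of binary equalities would put an inner copy into two constraints. -/
def copyConstraint (b t v : ℕ) : NatConstraint :=
  (copies b t v, (List.range 2).map fun e => (copies b t v).map fun _ => e)

noncomputable def constraints (Cs : List NatClause) (b t : ℕ) : List NatConstraint :=
  (List.range (t * t * t)).map (groupConstraint Cs b t) ++
    (List.range (t * b)).map (copyConstraint b t)

variable {Cs : List NatClause} {b t : ℕ}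

theorem owner_lt (hb : 0 < b) (ht : 0 < t) (x : ℕ) : owner b t x < t * b := by
  have h₁ : block t (x / b) + 1 ≤ t := Nat.mod_lt _ ht
  have h₂ := Nat.mod_lt x hb
  have h₃ := Nat.mul_le_mul_right b h₁
  rw [add_mul] at h₃
  unfold owner
  omega

theorem owner_mod (x : ℕ) : owner b t x % b = x % b := by
  simp [owner]

/-- The block in slot `i` of group `q` is the `i`-th digit of `q` in base `t`. -/
theorem owner_slot (hb : 0 < b) {q i r : ℕ} (hi : i < 3) (hr : r < b) :
    owner b t (q * (3 * b) + (i * b + r)) = q / t ^ i % t * b + r := by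
  have h : q * (3 * b) + (i * b + r) = r + b * (3 * q + i) := by ring
  have h₁ : (q * (3 * b) + (i * b + r)) / b = 3 * q + i := by
    rw [h, Nat.add_mul_div_left _ _ hb, Nat.div_eq_of_lt hr, zero_add]
  have h₂ : (q * (3 * b) + (i * b + r)) % b = r := by
    rw [h, Nat.add_mul_mod_self_left, Nat.mod_eq_of_lt hr]
  have h₃ : (3 * q + i) / 3 = q := by omega
  have h₄ : (3 * q + i) % 3 = i := by omega
  rw [owner, h₁, h₂, block, h₃, h₄]

theorem slot_lt {q j : ℕ} (hq : q < t * t * t) (hj : j < 3 * b) :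
    q * (3 * b) + j < t * t * t * (3 * b) := by
  have := Nat.mul_le_mul_right (3 * b) hq
  rw [Nat.succ_mul] at this
  omega

theorem mem_copies {v x : ℕ} : x ∈ copies b t v ↔ x < t * t * t * (3 * b) ∧ owner b t x = v := by
  simp [copies]

theorem copies_ne_nil (hb : 0 < b) {v : ℕ} (hv : v < t * b) : copies b t v ≠ [] := by
  have hvt : v / b < t := Nat.div_lt_of_lt_mul (by rwa [mul_comm])
  have hr := Nat.mod_lt v hb
  -- The group with number `v / b < t` has `v / b` as its lowest digit and so carries the block of
  -- `v` in slot `0`.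
  refine List.ne_nil_of_mem (mem_copies.2 ⟨slot_lt (q := v / b) (j := 0 * b + v % b) ?_ ?_, ?_⟩)
  · exact hvt.trans_le ((Nat.le_mul_self t).trans (Nat.le_mul_of_pos_right _ (Nat.zero_lt_of_lt hvt)))
  · omega
  · rw [owner_slot hb (by omega) hr, pow_zero, Nat.div_one, Nat.mod_eq_of_lt hvt, Nat.div_add_mod']

theorem bits_injOn (w : ℕ) {s s' : ℕ} (hs : s < 2 ^ w) (hs' : s' < 2 ^ w)
    (h : bits w s = bits w s') : s = s' := by
  refine Nat.eq_of_testBit_eq fun j => ?_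
  by_cases hj : j < w
  · have := List.map_inj_left.1 h j (List.mem_range.2 hj)
    revert this
    cases s.testBit j <;> cases s'.testBit j <;> simp
  · have hle : 2 ^ w ≤ 2 ^ j := Nat.pow_le_pow_right (by omega) (by omega)
    rw [Nat.testBit_lt_two_pow (by omega), Nat.testBit_lt_two_pow (by omega)]

theorem eight_pow (b : ℕ) : 8 ^ b = 2 ^ (3 * b) := by
  rw [pow_mul]
  rfl

theorem mem_groupConstraint {q x : ℕ} (hb : 0 < b) :
    x ∈ (groupConstraint Cs b t q).1 ↔ x / (3 * b) = q := by
  simp only [groupConstraint, List.mem_map, List.mem_range]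
  constructor
  · rintro ⟨j, hj, rfl⟩
    rw [mul_comm, Nat.mul_add_div (by omega), Nat.div_eq_of_lt hj, add_zero]
  · rintro rfl
    exact ⟨x % (3 * b), Nat.mod_lt _ (by omega), Nat.div_add_mod' _ _⟩

theorem groupConstraint_valid (hb : 0 < b) {q : ℕ} (hq : q < t * t * t) :
    (groupConstraint Cs b t q).Valid (t * t * t * (3 * b)) 2 where
  scope_ne_nil := by
    simp only [groupConstraint, ne_eq, List.map_eq_nil_iff, List.range_eq_nil]
    omega
  scope_nodup := List.Nodup.map (fun i j h => by simpa using h) List.nodup_range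
  scope_lt x hx := by
    simp only [groupConstraint, List.mem_map, List.mem_range] at hx
    obtain ⟨j, hj, rfl⟩ := hx
    exact slot_lt hq hj
  rel_nodup := by
    refine List.Nodup.map_on ?_ (List.nodup_range.filter _)
    intro s hs s' hs' h
    simp only [List.mem_filter, List.mem_range, eight_pow] at hs hs'
    exact bits_injOn _ hs.1 hs'.1 h
  rel_length s hs := by
    simp only [groupConstraint, List.mem_map] at hs
    obtain ⟨s, -, rfl⟩ := hs
    simp [groupConstraint, bits]
  rel_lt s hs v hv := by
    simp only [groupConstraint, List.mem_map] at hs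
    obtain ⟨s, -, rfl⟩ := hs
    simp only [bits, List.mem_map] at hv
    obtain ⟨j, -, rfl⟩ := hv
    split_ifs <;> omega

theorem copyConstraint_valid (hb : 0 < b) {v : ℕ} (hv : v < t * b) :
    (copyConstraint b t v).Valid (t * t * t * (3 * b)) 2 where
  scope_ne_nil := copies_ne_nil hb hv
  scope_nodup := List.nodup_range.filter _
  scope_lt x hx := (mem_copies.1 hx).1
  rel_nodup := by
    refine List.Nodup.map_on ?_ List.nodup_range
    intro e _ e' _ h
    obtain ⟨x, hx⟩ := List.exists_mem_of_ne_nil _ (copies_ne_nil hb hv)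
    exact List.map_inj_left.1 h x hx
  rel_length s hs := by
    simp only [copyConstraint, List.mem_map] at hs
    obtain ⟨s, -, rfl⟩ := hs
    simp [copyConstraint]
  rel_lt s hs v hv := by
    simp only [copyConstraint, List.mem_map, List.mem_range] at hs
    obtain ⟨s, hs, rfl⟩ := hs
    simp only [List.mem_map] at hv
    obtain ⟨j, -, rfl⟩ := hv
    exact hs

theorem constraints_valid (hb : 2 ≤ b) (ht : 0 < t) :
    ValidConstraints (t * t * t * (3 * b)) 2 (constraints Cs b t) where
  valid C hC := by
    simp only [constraints, List.mem_append, List.mem_map, List.mem_range] at hC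
    rcases hC with ⟨q, hq, rfl⟩ | ⟨v, hv, rfl⟩
    · exact groupConstraint_valid (by omega) hq
    · exact copyConstraint_valid (by omega) hv
  nodup := by
    rw [constraints, List.map_append, List.map_map, List.map_map]
    refine List.Nodup.append (List.Nodup.map_on ?_ List.nodup_range)
      (List.Nodup.map_on ?_ List.nodup_range) ?_
    · intro q _ q' _ h
      have h₁ : q * (3 * b) ∈ (groupConstraint Cs b t q).1 :=
        (mem_groupConstraint (by omega)).2 (Nat.mul_div_cancel _ (by omega))
      have h₂ : q * (3 * b) ∈ (groupConstraint Cs b t q').1 :=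
        (show (groupConstraint Cs b t q).1 = (groupConstraint Cs b t q').1 from h) ▸ h₁
      rw [mem_groupConstraint (by omega)] at h₁ h₂
      exact h₁.symm.trans h₂
    · intro v hv v' _ h
      obtain ⟨x, hx⟩ :=
        List.exists_mem_of_ne_nil _ (copies_ne_nil (by omega) (List.mem_range.1 hv))
      have hx' : x ∈ copies b t v' := (show copies b t v = copies b t v' from h) ▸ hx
      exact (mem_copies.1 hx).2.symm.trans (mem_copies.1 hx').2
    · intro S hS hS'
      obtain ⟨q, -, rfl⟩ := List.mem_map.1 hS
      obtain ⟨v, -, h⟩ := List.mem_map.1 hS'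
      have h : copies b t v = (groupConstraint Cs b t q).1 := h
      -- The group contains the neighbours `q * (3 * b)` and `q * (3 * b) + 1`, which are
      -- incongruent modulo `b` because `b ≥ 2`, whereas all copies of one variable are congruent to
      -- it. Hence no group scope is a copy scope.
      have h₁ : q * (3 * b) ∈ copies b t v := by
        rw [h, mem_groupConstraint (by omega), Nat.mul_div_cancel _ (by omega)]
      have h₂ : q * (3 * b) + 1 ∈ copies b t v := by
        rw [h, mem_groupConstraint (by omega), mul_comm, Nat.mul_add_div (by omega),
          Nat.div_eq_of_lt (by omega), add_zero]
      have h₃ := owner_mod (b := b) (t := t) (q * (3 * b))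
      have h₄ := owner_mod (b := b) (t := t) (q * (3 * b) + 1)
      rw [(mem_copies.1 h₁).2] at h₃
      have h₅ : q * (3 * b) = b * (q * 3) := by ring
      rw [(mem_copies.1 h₂).2, h₃, h₅, Nat.mul_mod_right, Nat.mul_add_mod,
        Nat.mod_eq_of_lt hb] at h₄
      omega
  var_occurs x hx := by
    refine ⟨groupConstraint Cs b t (x / (3 * b)), ?_, (mem_groupConstraint (by omega)).2 rfl⟩
    refine List.mem_append_left _ (List.mem_map_of_mem (List.mem_range.2 ?_))
    exact Nat.div_lt_of_lt_mul (by rwa [mul_comm])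
  val_occurs v hv := by
    -- The constant tuples of the equality constraint of variable `0` already contain both values.
    have h0 : 0 < t * b := Nat.mul_pos ht (by omega)
    obtain ⟨x, hx⟩ := List.exists_mem_of_ne_nil _ (copies_ne_nil (t := t) (by omega) h0)
    refine ⟨copyConstraint b t 0, ?_, (copies b t 0).map fun _ => v, ?_, ?_⟩
    · exact List.mem_append_right _ (List.mem_map_of_mem (List.mem_range.2 h0))
    · exact List.mem_map_of_mem (List.mem_range.2 hv)
    · exact List.mem_map.2 ⟨x, hx, rfl⟩

theorem length_filter_map_range_le_one {α : Type} (f : ℕ → α) (p : α → Bool) (k a : ℕ)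
    (h : ∀ i < k, p (f i) = true → i = a) : (((List.range k).map f).filter p).length ≤ 1 := by
  rw [List.filter_map, List.length_map]
  have hsub : (List.range k).filter (p ∘ f) ⊆ [a] := fun i hi => by
    simp only [List.mem_filter, List.mem_range] at hi
    simpa using h i hi.1 hi.2
  exact (List.subperm_of_subset (List.nodup_range.filter _) hsub).length_le

/-- The groups partition the variables of the instance, and so do the classes of copies: `x` lies in
group `x / (3 * b)` and in the class of its owner, and nowhere else. -/
theorem degree_le (hb : 0 < b) (x : ℕ) :
    ((constraints Cs b t).filter fun C => decide (x ∈ C.1)).length ≤ 2 := by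
  rw [constraints, List.filter_append, List.length_append]
  refine Nat.add_le_add (length_filter_map_range_le_one _ _ _ (x / (3 * b)) ?_)
    (length_filter_map_range_le_one _ _ _ (owner b t x) ?_)
  · intro q _ h
    exact ((mem_groupConstraint hb).1 (of_decide_eq_true h)).symm
  · intro v _ h
    exact (mem_copies.1 (of_decide_eq_true h)).2.symm

/-- Every three variables of the formula have copies in a common group. -/
theorem exists_group (hb : 0 < b) (ht : 0 < t) (v : ℕ → ℕ) (hv : ∀ i, v i / b < t) :
    ∃ q < t * t * t, ∀ i < 3, owner b t (q * (3 * b) + (i * b + v i % b)) = v i := by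
  -- The digits of the group number in base `t` are the blocks of the three variables.
  refine ⟨v 0 / b + t * (v 1 / b + t * (v 2 / b)), ?_, fun i hi => ?_⟩
  · have h₀ := hv 0
    have h₁ : v 1 / b + t * (v 2 / b) + 1 ≤ t * t := by
      have := Nat.mul_le_mul_left t (hv 2)
      have := hv 1
      rw [Nat.mul_succ] at *
      omega
    have h₂ := Nat.mul_le_mul_left t h₁
    rw [mul_assoc]
    rw [Nat.mul_succ] at h₂
    omega
  · rw [owner_slot hb hi (Nat.mod_lt _ hb)]
    have h : (v 0 / b + t * (v 1 / b + t * (v 2 / b))) / t ^ i % t = v i / b := by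
      have h₁ : (v 0 / b + t * (v 1 / b + t * (v 2 / b))) / t = v 1 / b + t * (v 2 / b) := by
        rw [Nat.add_mul_div_left _ _ ht, Nat.div_eq_of_lt (hv 0), zero_add]
      have h₂ : (v 1 / b + t * (v 2 / b)) / t = v 2 / b := by
        rw [Nat.add_mul_div_left _ _ ht, Nat.div_eq_of_lt (hv 1), zero_add]
      interval_cases i
      · rw [pow_zero, Nat.div_one, Nat.add_mul_mod_self_left, Nat.mod_eq_of_lt (hv 0)]
      · rw [pow_one, h₁, Nat.add_mul_mod_self_left, Nat.mod_eq_of_lt (hv 1)]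
      · rw [pow_two, ← Nat.div_div_eq_div_mul, h₁, h₂, Nat.mod_eq_of_lt (hv 2)]
    rw [h, Nat.div_add_mod']

theorem exists_bits_eq (w : ℕ) (f : ℕ → Bool) :
    ∃ s < 2 ^ w, ∀ j < w, s.testBit j = f j := by
  refine ⟨Nat.ofBits fun j : Fin w => f j, Nat.ofBits_lt_two_pow _, fun j hj => ?_⟩
  rw [Nat.testBit_ofBits_lt _ _ hj]

/-- A solution gives all copies of a variable the same value, which defines `σ`; the group that
contains the variables of a clause supplies a literal true under `σ`. Conversely, every copy takes
the value of its owner. Width three is used to fit a clause into one group. -/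
theorem constraints_consistent_iff (hb : 0 < b) (ht : 0 < t)
    (hlen : ∀ C ∈ Cs, C.length ≤ 3) (hvar : ∀ C ∈ Cs, ∀ l ∈ C, l.1 / b < t) :
    (∃ τ : ℕ → ℕ, (∀ x, τ x < 2) ∧ ∀ C ∈ constraints Cs b t, C.1.map τ ∈ C.2) ↔
      ∃ σ : ℕ → Bool, ∀ C ∈ Cs, ∃ l ∈ C, σ l.1 = l.2 := by
  classical
  constructor
  · rintro ⟨τ, hτ2, hτ⟩
    have hgroup : ∀ q < t * t * t, ∃ s, GroupSat Cs b t q s ∧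
        ∀ j < 3 * b, τ (q * (3 * b) + j) = if s.testBit j then 1 else 0 := by
      intro q hq
      have := hτ _ (List.mem_append_left _ (List.mem_map_of_mem (List.mem_range.2 hq)))
      simp only [groupConstraint, List.map_map] at this
      obtain ⟨s, hs, h⟩ := List.mem_map.1 this
      refine ⟨s, of_decide_eq_true (List.mem_filter.1 hs).2, fun j hj => ?_⟩
      exact (List.map_inj_left.1 h j (List.mem_range.2 hj)).symm
    have hcopy : ∀ x < t * t * t * (3 * b), ∀ y < t * t * t * (3 * b),
        owner b t x = owner b t y → τ x = τ y := by
      intro x hx y hy hxy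
      have := hτ _ (List.mem_append_right _
        (List.mem_map_of_mem (List.mem_range.2 (owner_lt hb ht x))))
      simp only [copyConstraint] at this
      obtain ⟨e, -, h⟩ := List.mem_map.1 this
      have h := List.map_inj_left.1 h
      rw [← h x (mem_copies.2 ⟨hx, rfl⟩), ← h y (mem_copies.2 ⟨hy, hxy.symm⟩)]
    refine ⟨fun v => decide (∃ x < t * t * t * (3 * b), owner b t x = v ∧ τ x = 1),
      fun C hC => ?_⟩
    -- Clauses with fewer than three literals are padded with the variable `0`, whose block exists
    -- because `t` is positive.
    obtain ⟨q, hq, hcover⟩ := exists_group hb ht (fun i => (C.getD i (0, true)).1) (fun i => by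
      by_cases hi : i < C.length
      · rw [List.getD_eq_getElem _ _ hi]
        exact hvar C hC _ (List.getElem_mem hi)
      · rw [List.getD_eq_default _ _ (by omega), Nat.zero_div]
        exact ht)
    obtain ⟨s, hs, hbits⟩ := hgroup q hq
    obtain ⟨l, hl, hsat⟩ := hs C hC
    refine ⟨l, hl, ?_⟩
    obtain ⟨i, hi, rfl⟩ := List.mem_iff_getElem.1 hl
    have hi3 : i < 3 := hi.trans_le (hlen C hC)
    have howner := hcover i hi3
    rw [List.getD_eq_getElem _ _ hi] at howner
    have hr := Nat.mod_lt (C[i].1) hb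
    have hj : i * b + C[i].1 % b < 3 * b := by
      have := Nat.mul_le_mul_right b hi3
      rw [Nat.succ_mul] at this
      omega
    have hbit := hsat _ hj howner
    have hval := hbits _ hj
    rw [hbit] at hval
    have hlt := slot_lt hq hj
    cases hsgn : C[i].2 with
    | true =>
      rw [hsgn, if_pos rfl] at hval
      exact decide_eq_true ⟨_, hlt, howner, hval⟩
    | false =>
      rw [hsgn, if_neg (by simp)] at hval
      refine decide_eq_false ?_
      rintro ⟨x, hx, hxo, hx1⟩
      rw [hcopy x hx _ hlt (hxo.trans howner.symm), hval] at hx1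
      omega
  · rintro ⟨σ, hσ⟩
    refine ⟨fun x => if σ (owner b t x) then 1 else 0, fun x => by dsimp only; split_ifs <;> omega,
      fun C hC => ?_⟩
    simp only [constraints, List.mem_append, List.mem_map, List.mem_range] at hC
    rcases hC with ⟨q, hq, rfl⟩ | ⟨v, hv, rfl⟩
    · obtain ⟨s, hs, hbits⟩ := exists_bits_eq (3 * b) fun j => σ (owner b t (q * (3 * b) + j))
      simp only [groupConstraint, List.map_map]
      refine List.mem_map.2 ⟨s, List.mem_filter.2 ⟨List.mem_range.2 (by rwa [eight_pow]),
        decide_eq_true fun C hC => ?_⟩, List.map_congr_left fun j hj => ?_⟩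
      · obtain ⟨l, hl, h⟩ := hσ C hC
        exact ⟨l, hl, fun j hj ho => by rw [hbits j hj, ho, h]⟩
      · rw [hbits j (List.mem_range.1 hj)]
        rfl
    · simp only [copyConstraint]
      refine List.mem_map.2 ⟨if σ v then 1 else 0, List.mem_range.2 (by split_ifs <;> omega),
        List.map_congr_left fun x hx => ?_⟩
      rw [(mem_copies.1 hx).2]

end BlockReduction

namespace BlockReduction

open StackProg

/-! ### Reading the clauses off the encoding of a formula -/

/-- The number of tallies at the end of the list. -/
def trail (A : List TapeSymbol) : ℕ :=
  {x ∈ Finset.range A.length | ∀ u < A.length, ¬ u < x → A[u]? = some .tally}.card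

def signSymbol (e : Bool) : TapeSymbol := if e then .plus else .minus

theorem trail_append_tally (A : List TapeSymbol) : trail (A ++ [.tally]) = trail A + 1 := by
  have h : {x ∈ Finset.range (A ++ [TapeSymbol.tally]).length |
      ∀ u < (A ++ [TapeSymbol.tally]).length, ¬ u < x →
        (A ++ [TapeSymbol.tally])[u]? = some .tally} = insert A.length
      {x ∈ Finset.range A.length | ∀ u < A.length, ¬ u < x → A[u]? = some .tally} := by
    ext x
    simp only [List.length_append, List.length_singleton, Finset.mem_filter, Finset.mem_range,
      Finset.mem_insert]
    constructor
    · rintro ⟨hx, h⟩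
      by_cases hxA : x = A.length
      · exact .inl hxA
      · refine .inr ⟨by omega, fun u hu hux => ?_⟩
        rw [← h u (by omega) hux, List.getElem?_append_left hu]
    · rintro (rfl | ⟨hx, h⟩)
      · refine ⟨by omega, fun u hu hux => ?_⟩
        obtain rfl : u = A.length := by omega
        simp
      · refine ⟨by omega, fun u hu hux => ?_⟩
        by_cases huA : u < A.length
        · rw [List.getElem?_append_left huA, h u huA hux]
        · obtain rfl : u = A.length := by omega
          simp
  rw [trail, h, Finset.card_insert_of_notMem (by simp), trail]

theorem trail_append_of_ne (A : List TapeSymbol) {a : TapeSymbol} (ha : a ≠ .tally) :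
    trail (A ++ [a]) = 0 := by
  rw [trail, Finset.card_eq_zero, Finset.filter_eq_empty_iff]
  intro x hx h
  have := h A.length (by simp) (by simp at hx; omega)
  simp at this
  exact ha this

theorem trail_append_replicate (A : List TapeSymbol) (k : ℕ) :
    trail (A ++ List.replicate k .tally) = trail A + k := by
  induction k with
  | zero => simp
  | succ k ih => rw [List.replicate_succ', ← List.append_assoc, trail_append_tally, ih, add_assoc]

/-- The literal `l` occurs in `L` after the last semicolon, where `L` is preceded by `J`. -/
def LitAt (J L : List TapeSymbol) (l : ℕ × Bool) : Prop :=
  ∃ y < L.length, L[y]? = some (signSymbol l.2) ∧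
    (∀ u < L.length, y < u → L[u]? ≠ some .semicolon) ∧ trail (J ++ L.take y) = l.1

/-- A semicolon in the second part closes the clause, after which literals of the first part no
longer count. This permits induction along the encoding. -/
theorem litAt_append (J L L' : List TapeSymbol) (l : ℕ × Bool) :
    LitAt J (L ++ L') l ↔ LitAt (J ++ L) L' l ∨ TapeSymbol.semicolon ∉ L' ∧ LitAt J L l := by
  constructor
  · rintro ⟨y, hy, hsign, hsemi, htrail⟩
    rw [List.length_append] at hy
    by_cases hyL : y < L.length
    · refine .inr ⟨fun hmem => ?_, y, hyL, ?_, fun u hu hyu => ?_, ?_⟩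
      · obtain ⟨i, hi, h⟩ := List.mem_iff_getElem.1 hmem
        refine hsemi (L.length + i) (by simp [hi]) (by omega) ?_
        rw [List.getElem?_append_right (by omega), Nat.add_sub_cancel_left,
          List.getElem?_eq_getElem hi, h]
      · rwa [List.getElem?_append_left hyL] at hsign
      · have := hsemi u (by rw [List.length_append]; omega) hyu
        rwa [List.getElem?_append_left hu] at this
      · rwa [List.take_append_of_le_length hyL.le] at htrail
    · obtain ⟨y, rfl⟩ := Nat.exists_eq_add_of_le (not_lt.1 hyL)
      refine .inl ⟨y, by omega, ?_, fun u hu hyu => ?_, ?_⟩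
      · rwa [List.getElem?_append_right (by omega), Nat.add_sub_cancel_left] at hsign
      · have := hsemi (L.length + u) (by rw [List.length_append]; omega) (by omega)
        rwa [List.getElem?_append_right (by omega), Nat.add_sub_cancel_left] at this
      · rwa [List.take_length_add_append, ← List.append_assoc] at htrail
  · rintro (⟨y, hy, hsign, hsemi, htrail⟩ | ⟨hmem, y, hy, hsign, hsemi, htrail⟩)
    · refine ⟨L.length + y, by rw [List.length_append]; omega, ?_, fun u hu hyu => ?_, ?_⟩
      · rwa [List.getElem?_append_right (by omega), Nat.add_sub_cancel_left]
      · rw [List.length_append] at hu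
        rw [List.getElem?_append_right (by omega)]
        exact hsemi _ (by omega) (by omega)
      · rwa [List.take_length_add_append, ← List.append_assoc]
    · refine ⟨y, by rw [List.length_append]; omega, ?_, fun u hu hyu => ?_, ?_⟩
      · rwa [List.getElem?_append_left hy]
      · rw [List.length_append] at hu
        by_cases huL : u < L.length
        · rw [List.getElem?_append_left huL]
          exact hsemi u huL hyu
        · rw [List.getElem?_append_right (by omega)]
          exact fun h => hmem (List.mem_of_getElem? h)
      · rwa [List.take_append_of_le_length hy.le]

theorem not_litAt_of_forall_ne (J L : List TapeSymbol) (l : ℕ × Bool)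
    (h : ∀ a ∈ L, a ≠ .plus ∧ a ≠ .minus) : ¬ LitAt J L l := by
  rintro ⟨y, -, hsign, -⟩
  have := h _ (List.mem_of_getElem? hsign)
  unfold signSymbol at this
  split_ifs at this <;> simp_all

theorem litAt_singleton (J : List TapeSymbol) (e : Bool) (l : ℕ × Bool) :
    LitAt J [signSymbol e] l ↔ l = (trail J, e) := by
  have hsign : ∀ e e', signSymbol e = signSymbol e' ↔ e = e' := by decide
  constructor
  · rintro ⟨y, hy, hs, -, ht⟩
    obtain rfl : y = 0 := by simpa using hy
    simp only [List.length_singleton, zero_lt_one, List.getElem?_eq_getElem,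
      List.getElem_singleton, Option.some.injEq, hsign] at hs
    rw [List.take_zero, List.append_nil] at ht
    rw [ht, hs]
  · rintro rfl
    refine ⟨0, by simp, by simp, fun u hu hu' => ?_, by simp⟩
    simp at hu
    omega

def encodeLit (l : ℕ × Bool) : List TapeSymbol :=
  List.replicate l.1 .tally ++ [signSymbol l.2]

def encodeClause (C : NatClause) : List TapeSymbol := C.flatMap encodeLit ++ [.semicolon]

theorem semicolon_notMem_encodeLits (C : NatClause) :
    TapeSymbol.semicolon ∉ C.flatMap encodeLit := by
  simp only [List.mem_flatMap, encodeLit, List.mem_append, List.mem_replicate, List.mem_singleton,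
    signSymbol, not_exists, not_and, not_or]
  intro l _
  split_ifs <;> simp

theorem litAt_encodeLits (J : List TapeSymbol) (hJ : trail J = 0) (C : NatClause)
    (l : ℕ × Bool) : LitAt J (C.flatMap encodeLit) l ↔ l ∈ C := by
  induction C generalizing J with
  | nil => simp [LitAt]
  | cons l' C ih =>
    have hsign : signSymbol l'.2 ≠ .tally := by
      unfold signSymbol
      split_ifs <;> simp
    have htrail : trail (J ++ encodeLit l') = 0 := by
      rw [encodeLit, ← List.append_assoc, trail_append_of_ne _ hsign]
    have hone : LitAt J (encodeLit l') l ↔ l = l' := by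
      rw [encodeLit, litAt_append, litAt_singleton, trail_append_replicate, hJ, zero_add]
      have := not_litAt_of_forall_ne J (List.replicate l'.1 .tally) l (by
        intro a ha
        simp [List.eq_of_mem_replicate ha])
      simp [this]
    rw [List.flatMap_cons, litAt_append, ih _ htrail, hone, List.mem_cons]
    have := semicolon_notMem_encodeLits C
    tauto

/-- Every semicolon in `L` is preceded by a literal of its clause that satisfies `Q`, where `L` is
preceded by `J`. -/
def ClausesSat (Q : ℕ × Bool → Prop) (J L : List TapeSymbol) : Prop :=
  ∀ z < L.length, L[z]? = some .semicolon → ∃ l, LitAt [] (J ++ L.take z) l ∧ Q l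

theorem clausesSat_append (Q : ℕ × Bool → Prop) (J L L' : List TapeSymbol) :
    ClausesSat Q J (L ++ L') ↔ ClausesSat Q J L ∧ ClausesSat Q (J ++ L) L' := by
  constructor
  · refine fun h => ⟨fun z hz hsemi => ?_, fun z hz hsemi => ?_⟩
    · have := h z (by rw [List.length_append]; omega) (by rwa [List.getElem?_append_left hz])
      rwa [List.take_append_of_le_length hz.le] at this
    · have := h (L.length + z) (by rw [List.length_append]; omega)
        (by rwa [List.getElem?_append_right (by omega), Nat.add_sub_cancel_left])
      rwa [List.take_length_add_append, ← List.append_assoc] at this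
  · rintro ⟨h, h'⟩ z hz hsemi
    rw [List.length_append] at hz
    by_cases hzL : z < L.length
    · rw [List.take_append_of_le_length hzL.le]
      exact h z hzL (by rwa [List.getElem?_append_left hzL] at hsemi)
    · obtain ⟨z, rfl⟩ := Nat.exists_eq_add_of_le (not_lt.1 hzL)
      rw [List.take_length_add_append, ← List.append_assoc]
      exact h' z (by omega)
        (by rwa [List.getElem?_append_right (by omega), Nat.add_sub_cancel_left] at hsemi)

theorem clausesSat_of_notMem (Q : ℕ × Bool → Prop) (J L : List TapeSymbol)
    (h : TapeSymbol.semicolon ∉ L) : ClausesSat Q J L :=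
  fun _ _ hz => absurd (List.mem_of_getElem? hz) h

/-- The hypotheses on `J` say that no number and no clause is pending. They hold again after each
clause because it ends with a semicolon, so the induction proceeds. -/
theorem clausesSat_encodeClauses (Q : ℕ × Bool → Prop) (J : List TapeSymbol) (hJ : trail J = 0)
    (hJ' : ∀ l, ¬ LitAt [] J l) (Cs : List NatClause) :
    ClausesSat Q J (Cs.flatMap encodeClause) ↔ ∀ C ∈ Cs, ∃ l ∈ C, Q l := by
  induction Cs generalizing J with
  | nil => simp [ClausesSat]
  | cons C Cs ih =>
    have hlits : ∀ l, LitAt [] (J ++ C.flatMap encodeLit) l ↔ l ∈ C := fun l => by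
      rw [litAt_append, List.nil_append, litAt_encodeLits J hJ]
      simp [hJ']
    have hclause : ClausesSat Q J (encodeClause C) ↔ ∃ l ∈ C, Q l := by
      rw [encodeClause, clausesSat_append]
      constructor
      · rintro ⟨-, h⟩
        obtain ⟨l, hl, hQ⟩ := h 0 (by simp) (by simp)
        rw [List.take_zero, List.append_nil, hlits] at hl
        exact ⟨l, hl, hQ⟩
      · rintro ⟨l, hl, hQ⟩
        refine ⟨clausesSat_of_notMem _ _ _ (semicolon_notMem_encodeLits C), fun z hz _ => ?_⟩
        obtain rfl : z = 0 := by simpa using hz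
        rw [List.take_zero, List.append_nil]
        exact ⟨l, (hlits l).2 hl, hQ⟩
    rw [List.flatMap_cons, clausesSat_append, hclause, ih]
    · simp
    · rw [encodeClause, ← List.append_assoc, trail_append_of_ne _ (by simp)]
    · intro l h
      rw [encodeClause, ← List.append_assoc, litAt_append] at h
      rcases h with h | h
      · exact not_litAt_of_forall_ne _ _ _ (by simp) h
      · simp at h

def encodeFormula (n : ℕ) (Cs : List NatClause) : List TapeSymbol :=
  List.replicate n .tally ++ [.hash] ++ Cs.flatMap encodeClause

theorem clausesSat_encodeFormula (Q : ℕ × Bool → Prop) (n : ℕ) (Cs : List NatClause) :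
    ClausesSat Q [] (encodeFormula n Cs) ↔ ∀ C ∈ Cs, ∃ l ∈ C, Q l := by
  rw [encodeFormula, clausesSat_append, List.nil_append, clausesSat_encodeClauses]
  · refine and_iff_right (clausesSat_of_notMem _ _ _ ?_)
    simp
  · exact trail_append_of_ne _ (by simp)
  · intro l
    refine not_litAt_of_forall_ne _ _ _ fun a ha => ?_
    rcases List.mem_append.1 ha with ha | ha
    · simp [List.eq_of_mem_replicate ha]
    · simp [List.mem_singleton.1 ha]

/-- The number of variables is recovered as the length of the initial run of tallies, which ends at
the first `hash`. -/
theorem card_tally_prefix (n : ℕ) (Cs : List NatClause) :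
    {y ∈ Finset.range (encodeFormula n Cs).length |
      ∀ z < y + 1, (encodeFormula n Cs)[z]? = some .tally}.card = n := by
  have h : {y ∈ Finset.range (encodeFormula n Cs).length |
      ∀ z < y + 1, (encodeFormula n Cs)[z]? = some .tally} = Finset.range n := by
    ext y
    simp only [Finset.mem_filter, Finset.mem_range, encodeFormula, List.append_assoc]
    constructor
    · rintro ⟨-, h⟩
      by_contra hy
      have := h n (by omega)
      simp at this
    · intro hy
      refine ⟨by simp; omega, fun z hz => ?_⟩
      rw [List.getElem?_append_left (by simp; omega), List.getElem?_replicate, if_pos (by omega)]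
  rw [h, Finset.card_range]

/-! ### The reduction as a generator -/

/-- The number of variables of the formula. -/
def varsTerm (len : Term) : Term :=
  .count len fun y => .all (.cat y .one) fun z => .inp .tally z

def blocksTerm (len b : Term) : Term := .cat (.div (varsTerm len) b) .one

def widthTerm (b : Term) : Term := .mul (.num 2) b

def groupsTerm (len b : Term) : Term :=
  .mul (.mul (blocksTerm len b) (blocksTerm len b)) (blocksTerm len b)

def totalTerm (len b : Term) : Term := .mul (groupsTerm len b) (widthTerm b)

def ownerTerm (len b x : Term) : Term :=
  .cat (.mul (.mod (.divPow (.div (.div x b) (.num 2)) (blocksTerm len b)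
    (.mod (.div x b) (.num 2))) (blocksTerm len b)) b) (.mod x b)

def trailTerm (y : Term) : Term :=
  .count y fun x => .all y fun u => .imp (.not (.lt u x)) (.inp .tally u)

/-- The literal is addressed by the position `y` of its sign: its variable is the number of tallies
directly before `y`, and it is positive if the entry at `y` is `plus`. -/
def litSatTerm (len b q s y : Term) : Term :=
  .all (widthTerm b) fun j =>
    .imp (.eq (ownerTerm len b (.cat (.mul q (widthTerm b)) j)) (trailTerm y))
      (.and (.imp (.bit s j) (.inp .plus y)) (.imp (.inp .plus y) (.bit s j)))

/-- A clause is addressed by the position `z` of its closing semicolon, and its literals by the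
signs before `z` with no semicolon in between. -/
def groupSatTerm (len b q s : Term) : Term :=
  .all len fun z => .imp (.inp .semicolon z)
    (.sum z fun y => .and (.cat (.inp .plus y) (.inp .minus y))
      (.and (.all z fun u => .imp (.lt y u) (.not (.inp .semicolon u)))
        (litSatTerm len b q s y)))

/-- `Num` controls only the length of a list; before a number is output its symbols are made
tallies. -/
def tallyTerm (x : Term) : Term := .sum x fun _ => .emit .tally

def entryTerm (x : Term) : Term := .cat (tallyTerm x) (.emit .comma)

/-- The value `8 ^ b` enters as a separate term `pw`: generated lengths are polynomial in the values
of the variables, so it cannot be generated from `b`. -/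
def groupTerm (len b pw q : Term) : Term :=
  .cat (.cat (.cat
    (.sum (widthTerm b) fun j => entryTerm (.cat (.mul q (widthTerm b)) j))
    (.emit .semicolon))
    (.sum pw fun s => .when (groupSatTerm len b q s)
      (.cat (.sum (widthTerm b) fun j => entryTerm (.not (.not (.bit s j))))
        (.emit .semicolon))))
    (.emit .hash)

def copyTerm (len b v : Term) : Term :=
  .cat (.cat (.cat
    (.sum (totalTerm len b) fun x => .when (.eq (ownerTerm len b x) v) (entryTerm x))
    (.emit .semicolon))
    (.sum (.num 1) fun e =>
      (.cat (.sum (totalTerm len b) fun x => .when (.eq (ownerTerm len b x) v) (entryTerm e))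
        (.emit .semicolon))))
    (.emit .hash)

def reductionTerm (len b pw : Term) : Term :=
  .cat (.cat (.cat (.cat (.cat (tallyTerm (totalTerm len b)) (.emit .hash))
    (tallyTerm (.num 1))) (.emit .hash))
    (.sum (groupsTerm len b) fun q => groupTerm len b pw q))
    (.sum (.mul (blocksTerm len b) b) fun v => copyTerm len b v)

section

variable {n b₀ k : ℕ} {Cs : List NatClause} {w : World} {len b pw x : Term}

theorem Den.tally {I} (hx : Num I w x k) : Den I w (tallyTerm x) (List.replicate k .tally) :=
  (Den.sum (F := fun _ => [TapeSymbol.tally]) hx fun _ _ _ _ _ _ => .emit _).congr (by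
    rw [← List.map_eq_flatMap, List.map_const', List.length_range])

theorem Den.entry {I} (hx : Num I w x k) :
    Den I w (entryTerm x) (List.replicate k .tally ++ [.comma]) :=
  (Den.tally hx).cat (.emit _)

theorem num_trail {y : Term} (hy : Num (encodeFormula n Cs) w y k)
    (hk : k ≤ (encodeFormula n Cs).length) :
    Num (encodeFormula n Cs) w (trailTerm y) (trail ((encodeFormula n Cs).take k)) := by
  refine (Num.count hy fun w₁ hw₁ _ _ _ hx => Tr.all (hy.mono hw₁) fun w₂ hw₂ _ _ _ hu =>
    (Tr.lt hu (hx.mono hw₂)).not.imp (Tr.inp hu)).congr ?_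
  rw [trail, List.length_take, min_eq_left hk]
  congr 1
  refine Finset.filter_congr fun x _ => forall₂_congr fun u hu => ?_
  rw [List.getElem?_take_of_lt hu]

/-- The terms `len` and `b` denote the length of the encoded formula and the block size. -/
structure Params (n : ℕ) (Cs : List NatClause) (b₀ : ℕ) (w : World) (len b : Term) : Prop where
  len : Num (encodeFormula n Cs) w len (encodeFormula n Cs).length
  size : Num (encodeFormula n Cs) w b b₀
  pos : 0 < b₀

namespace Params

theorem mono {w' : World} (h : Params n Cs b₀ w len b) (hw : w ≤ w') :
    Params n Cs b₀ w' len b := ⟨h.len.mono hw, h.size.mono hw, h.pos⟩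

variable (h : Params n Cs b₀ w len b)
include h

theorem vars : Num (encodeFormula n Cs) w (varsTerm len) n :=
  (Num.count h.len fun _ _ _ _ _ hy =>
    Tr.all (hy.add .one) fun _ _ _ _ _ hz => Tr.inp hz).congr (card_tally_prefix n Cs)

theorem blocks : Num (encodeFormula n Cs) w (blocksTerm len b) (n / b₀ + 1) :=
  (h.vars.div h.size h.pos).add .one

theorem width : Num (encodeFormula n Cs) w (widthTerm b) (3 * b₀) := (Num.num 2).mul h.size

theorem groups : Num (encodeFormula n Cs) w (groupsTerm len b)
    ((n / b₀ + 1) * (n / b₀ + 1) * (n / b₀ + 1)) :=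
  (h.blocks.mul h.blocks).mul h.blocks

theorem total : Num (encodeFormula n Cs) w (totalTerm len b)
    ((n / b₀ + 1) * (n / b₀ + 1) * (n / b₀ + 1) * (3 * b₀)) := h.groups.mul h.width

theorem owner (hx : Num (encodeFormula n Cs) w x k) :
    Num (encodeFormula n Cs) w (ownerTerm len b x) (owner b₀ (n / b₀ + 1) k) :=
  have hr := hx.div h.size h.pos
  ((((hr.div (.num 2) (by omega)).divPow h.blocks (Nat.succ_pos _)
    (hr.mod (.num 2) (by omega))).mod h.blocks (Nat.succ_pos _)).mul h.size).add
      (hx.mod h.size h.pos)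

theorem litSat {q s y : Term} {q₀ s₀ k : ℕ} (hq : Num (encodeFormula n Cs) w q q₀)
    (hs : Num (encodeFormula n Cs) w s s₀) (hy : Num (encodeFormula n Cs) w y k)
    (hk : k ≤ (encodeFormula n Cs).length) :
    Tr (encodeFormula n Cs) w (litSatTerm len b q s y)
      (LitSat b₀ (n / b₀ + 1) q₀ s₀ (trail ((encodeFormula n Cs).take k),
        decide ((encodeFormula n Cs)[k]? = some .plus))) := by
  refine (Tr.all (p := fun j => BlockReduction.owner b₀ (n / b₀ + 1) (q₀ * (3 * b₀) + j) =
      trail ((encodeFormula n Cs).take k) →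
        ((s₀.testBit j = true → (encodeFormula n Cs)[k]? = some .plus) ∧
          ((encodeFormula n Cs)[k]? = some .plus → s₀.testBit j = true)))
    h.width fun w' hw j j₀ _ hj => ?_).congr (forall₂_congr fun j _ => ?_)
  · have h' := h.mono hw
    exact (Tr.eq (h'.owner (((hq.mono hw).mul h'.width).add hj)) (num_trail (hy.mono hw) hk)).imp
      (((Tr.bit (hs.mono hw) hj).imp (Tr.inp (hy.mono hw))).and
        ((Tr.inp (hy.mono hw)).imp (Tr.bit (hs.mono hw) hj)))
  · rw [← iff_def]
    exact imp_congr_right fun _ => by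
      by_cases hp : (encodeFormula n Cs)[k]? = some .plus <;> simp [hp]

/-- By `clausesSat_encodeFormula` the condition on clauses becomes one on positions in the encoding,
which is literally what the term tests. -/
theorem groupSat {q s : Term} {q₀ s₀ : ℕ} (hq : Num (encodeFormula n Cs) w q q₀)
    (hs : Num (encodeFormula n Cs) w s s₀) :
    Tr (encodeFormula n Cs) w (groupSatTerm len b q s) (GroupSat Cs b₀ (n / b₀ + 1) q₀ s₀) := by
  rw [GroupSat, ← clausesSat_encodeFormula _ n]
  refine (Tr.all h.len fun w₁ hw₁ z z₀ hz₀ hz => (Tr.inp hz).imp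
    (Tr.ex hz fun w₂ hw₂ y y₀ hy₀ hy => ((Tr.inp hy).or (Tr.inp hy)).and
      ((Tr.all (hz.mono hw₂) fun w₃ hw₃ u _ _ hu =>
        (Tr.lt (hy.mono hw₃) hu).imp (Tr.inp hu).not).and
          ((h.mono (hw₁.trans hw₂)).litSat (hq.mono (hw₁.trans hw₂)) (hs.mono (hw₁.trans hw₂))
            hy (hy₀.trans hz₀).le)))).congr (forall₂_congr fun z hz => imp_congr_right fun _ => ?_)
  have hlen : ((encodeFormula n Cs).take z).length = z := by simp [hz.le]
  simp only [LitAt, hlen, List.nil_append]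
  constructor
  · rintro ⟨y, hy, hsign, hsemi, hlit⟩
    refine ⟨(trail ((encodeFormula n Cs).take y),
      decide ((encodeFormula n Cs)[y]? = some .plus)), ⟨y, hy, ?_, fun u hu hyu => ?_, ?_⟩, hlit⟩
    · rw [List.getElem?_take_of_lt hy]
      rcases hsign with hsign | hsign <;> simp [hsign, signSymbol]
    · rw [List.getElem?_take_of_lt hu]
      exact hsemi u hu hyu
    · rw [List.take_take, min_eq_left hy.le]
  · rintro ⟨l, ⟨y, hy, hsign, hsemi, htrail⟩, hlit⟩
    rw [List.getElem?_take_of_lt hy] at hsign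
    rw [List.take_take, min_eq_left hy.le] at htrail
    refine ⟨y, hy, ?_, fun u hu hyu => ?_, ?_⟩
    · rw [hsign]
      cases l.2 <;> simp [signSymbol]
    · have := hsemi u hu hyu
      rwa [List.getElem?_take_of_lt hu] at this
    · rw [htrail, hsign]
      obtain ⟨v, e⟩ := l
      cases e <;> simpa [signSymbol] using hlit

end Params

theorem flatMap_filter {α β : Type} (p : α → Prop) [DecidablePred p] (f : α → List β)
    (l : List α) :
    (l.filter fun x => decide (p x)).flatMap f = l.flatMap fun x => if p x then f x else [] := by
  induction l with
  | nil => rfl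
  | cons x l ih => by_cases hx : p x <;> simp [hx, ih]

namespace Params

variable (h : Params n Cs b₀ w len b)
include h

theorem group {q : Term} {q₀ : ℕ} (hpw : Num (encodeFormula n Cs) w pw (8 ^ b₀))
    (hq : Num (encodeFormula n Cs) w q q₀) :
    Den (encodeFormula n Cs) w (groupTerm len b pw q)
      (groupConstraint Cs b₀ (n / b₀ + 1) q₀).encode := by
  classical
  refine ((((Den.sum h.width fun w' hw j j₀ _ hj =>
    Den.entry (((hq.mono hw).mul (h.mono hw).width).add hj)).cat (.emit _)).cat
    (Den.sum hpw fun w₁ hw₁ s s₀ _ hs => Den.when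
      ((h.mono hw₁).groupSat (hq.mono hw₁) hs)
      ((Den.sum (h.mono hw₁).width fun w₂ hw₂ j j₀ _ hj =>
        Den.entry (Tr.bit (hs.mono hw₂) hj).num).cat (.emit _)))).cat (.emit _)).congr ?_
  simp only [groupConstraint, NatConstraint.encode, bits, List.flatMap_map, flatMap_filter]

theorem copy {v : Term} {v₀ : ℕ} (hv : Num (encodeFormula n Cs) w v v₀) :
    Den (encodeFormula n Cs) w (copyTerm len b v)
      (copyConstraint b₀ (n / b₀ + 1) v₀).encode := by
  refine ((((Den.sum h.total fun w' hw x x₀ _ hx =>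
    Den.when (Tr.eq ((h.mono hw).owner hx) (hv.mono hw)) (Den.entry hx)).cat (.emit _)).cat
    (Den.sum (.num 1) fun w₁ hw₁ e e₀ _ he =>
      (Den.sum (h.mono hw₁).total fun w₂ hw₂ x x₀ _ hx =>
        Den.when (Tr.eq ((h.mono (hw₁.trans hw₂)).owner hx) (hv.mono (hw₁.trans hw₂)))
          (Den.entry (he.mono hw₂))).cat (.emit _))).cat (.emit _)).congr ?_
  simp only [copyConstraint, copies, NatConstraint.encode, List.flatMap_map, flatMap_filter]

/-- The reduction generates the encoding of the instance. -/
theorem reduction (hpw : Num (encodeFormula n Cs) w pw (8 ^ b₀)) (hb : 2 ≤ b₀)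
    [NeZero ((n / b₀ + 1) * (n / b₀ + 1) * (n / b₀ + 1) * (3 * b₀))] :
    Den (encodeFormula n Cs) w (reductionTerm len b pw)
      (constraints_valid (Cs := Cs) hb (Nat.succ_pos (n / b₀))).toInstance.encode := by
  refine ((((((Den.tally h.total).cat (.emit _)).cat (Den.tally (.num 1))).cat (.emit _)).cat
    (Den.sum h.groups fun w' hw q q₀ _ hq => (h.mono hw).group (hpw.mono hw) hq)).cat
    (Den.sum (h.blocks.mul h.size) fun w' hw v v₀ _ hv => (h.mono hw).copy hv)).congr ?_
  rw [ValidConstraints.encode_toInstance, constraints, List.flatMap_append, List.flatMap_map,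
    List.flatMap_map, ← List.append_assoc]

end Params

end

end BlockReduction

namespace StackProg

open Turing Function

variable {T : FinTM2} (sym : TapeSymbol → T.Γ T.k₀)

/-! ### Running the embedded machine -/

/-- One step of the machine; halting configurations are unchanged. -/
def stepD (c : TM2.Cfg T.Γ T.Λ T.σ) : TM2.Cfg T.Γ T.Λ T.σ := (TM2.step T.m c).getD c

theorem stepD_of_halted {c : TM2.Cfg T.Γ T.Λ T.σ} (h : c.l = none) : stepD c = c := by
  obtain ⟨l, v, S⟩ := c
  cases h
  rfl

theorem stepD_iterate_of_halted {c : TM2.Cfg T.Γ T.Λ T.σ} (h : c.l = none) (k : ℕ) :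
    stepD^[k] c = c := Function.iterate_fixed (stepD_of_halted h) k

theorem flip_bind_iterate_none {C : Type} (f : C → Option C) (k : ℕ) :
    (flip bind f)^[k] none = none := Function.iterate_fixed rfl k

theorem stepD_iterate_of_runs {k : ℕ} {a c : TM2.Cfg T.Γ T.Λ T.σ}
    (h : (flip bind (TM2.step T.m))^[k] (some a) = some c) : stepD^[k] a = c := by
  induction k generalizing a with
  | zero => simpa using h
  | succ k ih =>
    rw [iterate_succ_apply] at h ⊢
    cases hs : TM2.step T.m a with
    | none =>
      have : (flip bind (TM2.step T.m)) (some a) = none := hs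
      rw [this, flip_bind_iterate_none] at h
      cases h
    | some b =>
      have : (flip bind (TM2.step T.m)) (some a) = some b := hs
      rw [this] at h
      have : stepD a = b := by simp [stepD, hs]
      rw [this]
      exact ih h

/-- If the machine halts within `t` steps, then after `k` steps it has halted with the same
configuration or not at all. -/
theorem stepD_iterate_eq {t k : ℕ} {a c : TM2.Cfg T.Γ T.Λ T.σ} (hc : c.l = none)
    (h : stepD^[t] a = c) (hk : (stepD^[k] a).l = none ∨ t ≤ k) : stepD^[k] a = c := by
  rcases le_total t k with htk | hkt
  · obtain ⟨i, rfl⟩ := Nat.exists_eq_add_of_le htk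
    rw [add_comm, iterate_add_apply, h, stepD_iterate_of_halted hc]
  · rcases hk with hk | hk
    · obtain ⟨i, rfl⟩ := Nat.exists_eq_add_of_le hkt
      rw [add_comm, iterate_add_apply, stepD_iterate_of_halted hk] at h
      exact h
    · rw [le_antisymm hkt hk, h]

/-- Bounds the growth of a stack in one step; adding up both branches is crude but sufficient. -/
def pushes {K : Type} {Γ : K → Type} {Λ σ : Type} : TM2.Stmt Γ Λ σ → ℕ
  | .push _ _ q => pushes q + 1
  | .peek _ _ q => pushes q
  | .pop _ _ q => pushes q
  | .load _ q => pushes q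
  | .branch _ q₁ q₂ => pushes q₁ + pushes q₂
  | .goto _ => 0
  | .halt => 0

theorem length_stepAux_le {K : Type} [DecidableEq K] {Γ : K → Type} {Λ σ : Type}
    (q : TM2.Stmt Γ Λ σ) (v : σ) (S : ∀ k, List (Γ k)) (k : K) :
    ((TM2.stepAux q v S).stk k).length ≤ (S k).length + pushes q := by
  induction q generalizing v S with
  | push k' f q ih =>
    refine (ih v _).trans ?_
    by_cases h : k = k'
    · subst h
      simp only [update_self, List.length_cons, pushes]
      omega
    · simp only [update_of_ne h, pushes]
      omega
  | pop k' f q ih =>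
    refine (ih _ _).trans ?_
    by_cases h : k = k'
    · subst h
      simp only [update_self, List.length_tail, pushes]
      omega
    · simp only [update_of_ne h, pushes]
      omega
  | peek k' f q ih => exact ih _ _
  | load f q ih => exact ih _ _
  | branch f q₁ q₂ ih₁ ih₂ =>
    simp only [TM2.stepAux, pushes]
    cases f v
    · exact (ih₂ _ _).trans (by omega)
    · exact (ih₁ _ _).trans (by omega)
  | goto f => simp [TM2.stepAux]
  | halt => simp [TM2.stepAux]

variable (T) in
-- Stacks grow by a bounded amount per step, so after a clocked run they can be emptied in
-- polynomial time.
theorem exists_length_stepD_le : ∃ P, ∀ (c : TM2.Cfg T.Γ T.Λ T.σ) (i : ℕ) (k : T.K),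
    ((stepD^[i] c).stk k).length ≤ (c.stk k).length + i * P := by
  have := T.ΛFin
  obtain ⟨P, hP⟩ : ∃ P, ∀ l, pushes (T.m l) ≤ P :=
    ⟨Finset.univ.sup fun l => pushes (T.m l), fun l =>
      Finset.le_sup (f := fun l => pushes (T.m l)) (Finset.mem_univ l)⟩
  refine ⟨P, fun c i k => ?_⟩
  induction i with
  | zero => simp
  | succ i ih =>
    rw [iterate_succ_apply']
    generalize stepD^[i] c = c' at *
    have : ((stepD c').stk k).length ≤ (c'.stk k).length + P := by
      obtain ⟨l, v, S⟩ := c'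
      cases l with
      | none => simp [stepD]
      | some l => exact (length_stepAux_le (T.m l) v S k).trans (Nat.add_le_add_left (hP l) _)
    rw [Nat.succ_mul]
    omega

variable (T) in
/-- The initial configuration with empty stacks. -/
def idle : TM2.Cfg T.Γ T.Λ T.σ := ⟨some T.main, T.initialState, fun _ => []⟩

abbrev Prog.feedAll (x : ℕ) : Prog T := .loop (.nonempty x) (.cmd (.feed x))

abbrev Prog.run (x : ℕ) : Prog T := .loop (.nonempty x) (.seq (.cmd (.pop x)) (.cmd .step))

/-- Empties the stacks and resets the embedded machine. -/
def Prog.clearStacks : List T.K → Prog T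
  | [] => .cmd .start
  | k :: ks => .seq (.loop (.stackNonempty k) (.cmd (.drop k))) (clearStacks ks)

/-- A compiled generator leaves its word reversed in the register; feeding reverses it once more, so
the machine receives the word itself. -/
theorem exec_feedAll (R : ℕ → List TapeSymbol) (x : ℕ) :
    Exec sym (.feedAll x) ⟨R, idle T⟩
      ⟨update R x [], initList T ((R x).reverse.map sym)⟩ (2 * (R x).length + 1) := by
  have key := Exec.loop_iterate (sym := sym) (t := .nonempty x) (p := .cmd (.feed x))
    (fun i => ⟨update R x ((R x).drop i), ⟨some T.main, T.initialState,
      update (fun _ => []) T.k₀ (((R x).take i).reverse.map sym)⟩⟩)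
    (R x).length 1
    (fun i hi => by simp [Test.eval_nonempty, hi])
    (by simp [Test.eval_nonempty_false])
    (fun i hi => by
      convert! Exec.cmd (sym := sym) (Cmd.feed x : Cmd T) _ using 1
      have : ((R x).take (i + 1)).reverse = (R x)[i] :: ((R x).take i).reverse := by
        rw [List.take_succ_eq_append_getElem hi, List.reverse_append]
        rfl
      simp [Cmd.eval, this, List.getElem?_eq_getElem hi])
  simp only [List.drop_zero, update_eq_self, List.drop_length, List.take_zero, List.reverse_nil,
    List.map_nil, List.take_length] at key
  rw [initList_eq]
  exact key.weaken (by omega)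

theorem exec_run (R : ℕ → List TapeSymbol) (c) (x : ℕ) :
    Exec (T := T) sym (.run x) ⟨R, c⟩
      ⟨update R x [], stepD^[(R x).length] c⟩ (3 * (R x).length + 1) := by
  have key := Exec.loop_iterate (sym := sym) (t := .nonempty x)
    (p := .seq (.cmd (.pop x)) (.cmd .step))
    (fun i => ⟨update R x ((R x).drop i), stepD^[i] c⟩) (R x).length 2
    (fun i hi => by simp [Test.eval_nonempty, hi]) (by simp [Test.eval_nonempty_false])
    (fun i hi => by
      refine (Exec.seq (Exec.cmd _ _) ?_ : Exec sym _ _ _ (1 + 1))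
      convert! Exec.cmd (sym := sym) (Cmd.step : Cmd T) _ using 1
      simp [Cmd.eval, iterate_succ_apply', stepD])
  simp only [List.drop_zero, update_eq_self, List.drop_length] at key
  exact key.weaken (by omega)

theorem exec_clearStack (R : ℕ → List TapeSymbol) (l v) (S : ∀ k, List (T.Γ k)) (k : T.K) :
    Exec sym (.loop (.stackNonempty k) (.cmd (.drop k))) ⟨R, ⟨l, v, S⟩⟩
      ⟨R, ⟨l, v, update S k []⟩⟩ (2 * (S k).length + 1) := by
  have key := Exec.loop_iterate (sym := sym) (t := .stackNonempty k) (p := .cmd (.drop k))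
    (fun i => ⟨R, ⟨l, v, update S k ((S k).drop i)⟩⟩) (S k).length 1
    (fun i hi => by simp [Test.eval, hi]) (by simp [Test.eval])
    (fun i hi => by
      convert! Exec.cmd (sym := sym) (Cmd.drop k : Cmd T) _ using 1
      simp [Cmd.eval])
  simp only [List.drop_zero, update_eq_self, List.drop_length] at key
  exact key.weaken (by omega)

theorem exec_clearStacks (R : ℕ → List TapeSymbol) (l v) (S : ∀ k, List (T.Γ k)) (ks : List T.K)
    (H : ℕ) (hH : ∀ k, (S k).length ≤ H) (hS : ∀ k, k ∉ ks → S k = []) :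
    Exec sym (.clearStacks ks) ⟨R, ⟨l, v, S⟩⟩ ⟨R, idle T⟩ (ks.length * (2 * H + 1) + 1) := by
  induction ks generalizing S with
  | nil =>
    have : S = fun _ => [] := funext fun k => hS k (by simp)
    subst this
    exact (Exec.cmd Cmd.start _).weaken (by omega)
  | cons k ks ih =>
    refine ((exec_clearStack sym R l v S k).seq (ih (update S k []) ?_ ?_)).weaken ?_
    · intro k'
      by_cases h : k' = k
      · subst h
        simp
      · rw [update_of_ne h]
        exact hH k'
    · intro k' hk'
      by_cases h : k' = k
      · subst h
        simp
      · rw [update_of_ne h]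
        exact hS k' (by simp [h, hk'])
    · have := hH k
      rw [List.length_cons, Nat.add_mul]
      omega

/-! ### The search for a sufficient parameter -/

open Gen

/-- The environment in phase `b`: the length of the input, `b` and `8 ^ b`. -/
def phaseEnv (I : List TapeSymbol) (b : ℕ) : ℕ → ℕ :=
  update (update (update (fun _ => 0) 0 I.length) 1 b) 2 (8 ^ b)

/-- The registers in phase `b`. -/
def phaseReg (I : List TapeSymbol) (b : ℕ) : ℕ → List TapeSymbol :=
  update (update (update (update (fun _ => []) 0 I) (envReg 0) (List.replicate I.length .tally))
    (envReg 1) (List.replicate b .tally)) (envReg 2) (List.replicate (8 ^ b) .tally)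

theorem phaseReg_holds (I : List TapeSymbol) (b : ℕ) :
    Holds I 3 0 (phaseEnv I b) (phaseReg I b) where
  input := by simp [phaseReg, envReg]
  aux := by simp [phaseReg, envReg]
  env x := by
    simp only [phaseReg, phaseEnv, update_apply, envReg_inj]
    have : envReg x ≠ 0 := envReg_ne (by omega)
    split_ifs <;> simp_all
  zero x hx := by
    simp only [phaseEnv, update_apply]
    split_ifs <;> omega
  tmp x _ := by
    have : tmpReg x ≠ 0 := tmpReg_ne (by omega)
    simp [phaseReg, this]

theorem phaseEnv_le {I : List TapeSymbol} {b W : ℕ} (hI : I.length ≤ W) (hb : 8 ^ b ≤ W) (x : ℕ) :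
    phaseEnv I b x ≤ W := by
  have : b < 8 ^ b := Nat.lt_pow_self (by omega)
  simp only [phaseEnv, update_apply]
  split_ifs <;> omega

/-- Multiplies the variable of depth `2` by `8`. -/
def timesEight : Gen := Term.mul (Term.num 7) (Term.var 2) 3

theorem length_eval_timesEight (I : List TapeSymbol) (b : ℕ) :
    (timesEight.eval I 3 (phaseEnv I b)).length = 8 ^ (b + 1) := by
  have h : Num I ⟨3, phaseEnv I b⟩ (.var 2) (8 ^ b) := .var (i := 2) (by simp)
  have := (Num.num 7).mul h _ le_rfl
  rw [pow_succ, mul_comm]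
  exact this

/-- Increments `b`, runs the machine on the word generated by `red` for the number of steps
generated by `clk`, and resets the machine if it has not halted. -/
noncomputable def phase (red clk : Gen) : Prog T :=
  haveI := T.kFin
  .seq (timesEight.compile 3 0 3)
    (.seq (.clear (envReg 2))
      (.seq (.addLength 3 (envReg 2))
        (.seq (.cmd (.push (envReg 1) .tally))
          (.seq (red.compile 3 0 2)
            (.seq (clk.compile 3 0 3)
              (.seq (.feedAll 2)
                (.seq (.run 3)
                  (.cond .running (.clearStacks (Finset.univ : Finset T.K).toList)))))))))

/-- The configuration that the machine has reached at the end of phase `b`. -/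
def phaseRun (red clk : Gen) (I : List TapeSymbol) (b : ℕ) : TM2.Cfg T.Γ T.Λ T.σ :=
  stepD^[(clk.eval I 3 (phaseEnv I b)).length]
    (initList T ((red.eval I 3 (phaseEnv I b)).map sym))

open Classical in
-- Apart from the increment of `b` a phase restores its starting situation: the scratch registers
-- are empty, and an unfinished run has been wiped. Hence phases can be iterated, each in time
-- polynomial in the length of the input and `8 ^ (b + 1)`.
theorem exec_phase (red clk : Gen) : ∃ f, PolyLE f ∧ ∀ I b W, I.length ≤ W → 8 ^ (b + 1) ≤ W →
    Exec sym (phase red clk) ⟨phaseReg I b, idle T⟩ ⟨phaseReg I (b + 1),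
      if (phaseRun sym red clk I (b + 1)).l = none then phaseRun sym red clk I (b + 1)
      else idle T⟩ (f W) := by
  let _ := T.kFin
  obtain ⟨f₁, hf₁, h₁⟩ := timesEight.exec_compile (T := T) (sym := sym)
  obtain ⟨f₂, hf₂, h₂⟩ := red.exec_compile (T := T) (sym := sym)
  obtain ⟨f₃, hf₃, h₃⟩ := clk.exec_compile (T := T) (sym := sym)
  obtain ⟨g₂, hg₂, l₂⟩ := red.length_eval_le
  obtain ⟨g₃, hg₃, l₃⟩ := clk.length_eval_le
  obtain ⟨P, hP⟩ := exists_length_stepD_le T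
  refine ⟨fun W => f₁ W + ((2 * W + 1) + ((3 * W + 1) + (1 + (f₂ W + (f₃ W + ((2 * g₂ W + 1) +
    ((3 * g₃ W + 1) + ((Finset.univ : Finset T.K).toList.length *
      (2 * (g₂ W + g₃ W * P) + 1) + 1 + 1)))))))), ?_, fun I b W hI hb => ?_⟩
  · have c := PolyLE.const
    have hid := PolyLE.id
    exact hf₁.add ((((c 2).mul hid).add (c 1)).add ((((c 3).mul hid).add (c 1)).add
      ((c 1).add (hf₂.add (hf₃.add ((((c 2).mul hg₂).add (c 1)).add ((((c 3).mul hg₃).add (c 1)).add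
      ((((c _).mul (((c 2).mul (hg₂.add (hg₃.mul (c P)))).add (c 1))).add (c 1)).add (c 1)))))))))
  have hb' : 8 ^ b ≤ W := (Nat.pow_le_pow_right (by omega) (Nat.le_succ b)).trans hb
  have e₀ := phaseEnv_le hI hb'
  have e₁ := phaseEnv_le hI hb
  have H₀ := phaseReg_holds I b
  have H₁ := phaseReg_holds I (b + 1)
  have t₂ : Target 0 2 := .inl rfl
  have t₃ : Target 0 3 := .inr (.inl rfl)
  have ev : ∀ x y, x < 4 → phaseReg I y x = if x = 0 then I else [] := by
    intro x y hx
    have h0 := (envReg_ne (x := 0) hx).symm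
    have h1 := (envReg_ne (x := 1) hx).symm
    have h2 := (envReg_ne (x := 2) hx).symm
    simp [phaseReg, update_apply, h0, h1, h2]
  have n₁ := h₁ I 3 0 3 _ _ (idle T) W e₀ hI H₀ t₃
  rw [ev 3 b (by omega), if_neg (by omega), List.append_nil] at n₁
  have n₂ := h₂ I 3 0 2 _ _ (idle T) W e₁ hI H₁ t₂
  rw [ev 2 (b + 1) (by omega), if_neg (by omega), List.append_nil] at n₂
  have n₃ := h₃ I 3 0 3 _ _ (idle T) W e₁ hI
    (H₁.update_target t₂ (red.eval I 3 (phaseEnv I (b + 1))).reverse) t₃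
  rw [update_of_ne (by omega), ev 3 (b + 1) (by omega), if_neg (by omega), List.append_nil] at n₃
  have m₁ := (exec_clear (T := T) (sym := sym) (update (phaseReg I b) 3
    (timesEight.eval I 3 (phaseEnv I b)).reverse) (idle T) (envReg 2)).weaken
    (show _ ≤ 2 * W + 1 by
      rw [update_of_ne (envReg_ne (by omega)), H₀.env, List.length_replicate]
      have := e₀ 2
      omega)
  have m₂ := (exec_addLength (T := T) (sym := sym) (update (update (phaseReg I b) 3
    (timesEight.eval I 3 (phaseEnv I b)).reverse) (envReg 2) []) (idle T)
    (envReg_ne (x := 2) (y := 3) (by omega)).symm).weaken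
    (show _ ≤ 3 * W + 1 by
      rw [update_of_ne (envReg_ne (by omega)).symm, update_self, List.length_reverse,
        length_eval_timesEight]
      omega)
  have m₃ := Exec.cmd (T := T) (sym := sym) (.push (envReg 1) .tally) ⟨update (update (update
    (update (phaseReg I b) 3 (timesEight.eval I 3 (phaseEnv I b)).reverse) (envReg 2) []) 3 [])
    (envReg 2) (List.replicate (8 ^ (b + 1)) .tally), idle T⟩
  have m₄ : (Cmd.push (envReg 1) .tally : Cmd T).eval sym ⟨update (update (update
      (update (phaseReg I b) 3 (timesEight.eval I 3 (phaseEnv I b)).reverse) (envReg 2) []) 3 [])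
      (envReg 2) (List.replicate (8 ^ (b + 1)) .tally), idle T⟩ =
      ⟨phaseReg I (b + 1), idle T⟩ := by
    simp only [Cmd.eval, Memory.mk.injEq, and_true]
    have h1 : envReg 1 ≠ 3 := envReg_ne (by omega)
    have h2 : envReg 2 ≠ 3 := envReg_ne (by omega)
    have h3 : envReg 0 ≠ 3 := envReg_ne (by omega)
    funext z
    simp only [phaseReg, update_apply]
    clear * - h1 h2 h3
    split_ifs <;> simp_all [List.replicate_succ]
  rw [m₄] at m₃
  have m₅ := exec_feedAll (T := T) sym (update (update (phaseReg I (b + 1)) 2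
    (red.eval I 3 (phaseEnv I (b + 1))).reverse) 3 (clk.eval I 3 (phaseEnv I (b + 1))).reverse) 2
  have m₆ := exec_run (T := T) sym (update (update (update (phaseReg I (b + 1)) 2
    (red.eval I 3 (phaseEnv I (b + 1))).reverse) 3 (clk.eval I 3 (phaseEnv I (b + 1))).reverse) 2 [])
    (initList T ((red.eval I 3 (phaseEnv I (b + 1))).map sym)) 3
  have hfin : update (update (update (update (phaseReg I (b + 1)) 2
      (red.eval I 3 (phaseEnv I (b + 1))).reverse) 3
      (clk.eval I 3 (phaseEnv I (b + 1))).reverse) 2 []) 3 [] = phaseReg I (b + 1) := by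
    funext z
    have h2 := ev 2 (b + 1) (by omega)
    have h3 := ev 3 (b + 1) (by omega)
    simp only [update_apply]
    clear * - h2 h3
    split_ifs <;> simp_all
  rw [hfin] at m₆
  have q₂ := l₂ I 3 _ W e₁
  have q₃ := l₃ I 3 _ W e₁
  simp only [update_of_ne (show 2 ≠ 3 by omega), update_of_ne (show 3 ≠ 2 by omega),
    update_self, List.reverse_reverse, List.length_reverse] at m₅ m₆
  change Exec sym _ _ ⟨_, phaseRun sym red clk I (b + 1)⟩ _ at m₆
  have m₇ : Exec sym (.cond .running (.clearStacks (Finset.univ : Finset T.K).toList))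
      ⟨phaseReg I (b + 1), phaseRun sym red clk I (b + 1)⟩ ⟨phaseReg I (b + 1),
        if (phaseRun sym red clk I (b + 1)).l = none then phaseRun sym red clk I (b + 1)
        else idle T⟩ ((Finset.univ : Finset T.K).toList.length *
      (2 * (g₂ W + g₃ W * P) + 1) + 1 + 1) := by
    have hlen : ∀ k, ((phaseRun sym red clk I (b + 1)).stk k).length ≤ g₂ W + g₃ W * P := by
      intro k
      refine (hP _ _ k).trans (Nat.add_le_add ?_ (Nat.mul_le_mul_right _ q₃))
      rw [initList_eq]
      by_cases hk : k = T.k₀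
      · subst hk
        simpa using q₂
      · simp [update_of_ne hk]
    generalize phaseRun sym red clk I (b + 1) = c at hlen ⊢
    obtain ⟨l, v, S⟩ := c
    by_cases hl : l = none
    · subst hl
      rw [if_pos rfl]
      exact (Exec.condFalse rfl).weaken (by omega)
    · rw [if_neg hl]
      refine Exec.condTrue ?_ (exec_clearStacks sym _ l v S _ _ hlen (by simp))
      cases l
      · exact absurd rfl hl
      · rfl
  refine n₁.seq (m₁.seq (Exec.seq ?_ (m₃.seq (n₂.seq (n₃.seq ((m₅.weaken ?_).seq
    ((m₆.weaken ?_).seq m₇)))))))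
  · convert! m₂ using 3
    rw [update_of_ne (envReg_ne (by omega)).symm, update_self, List.length_reverse,
      length_eval_timesEight, update_self, List.append_nil]
  · omega
  · omega

end StackProg

namespace StackProg

open Turing Function

variable {T : FinTM2} (sym : TapeSymbol → T.Γ T.k₀)

open Gen

/-! ### The complete search -/

/-- Pushes `n + 1` tallies. -/
def Prog.pushTallies (x : ℕ) : ℕ → Prog T
  | 0 => .cmd (.push x .tally)
  | n + 1 => .seq (.cmd (.push x .tally)) (pushTallies x n)

theorem exec_pushTallies (R : ℕ → List TapeSymbol) (c) (x n : ℕ) :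
    Exec (T := T) sym (.pushTallies x n) ⟨R, c⟩
      ⟨update R x (List.replicate (n + 1) .tally ++ R x), c⟩ (n + 1) := by
  induction n generalizing R with
  | zero => exact Exec.cmd _ _
  | succ n ih =>
    have := Exec.seq (Exec.cmd (.push x .tally) ⟨R, c⟩) (ih (update R x (.tally :: R x)))
    rw [update_self, update_idem] at this
    rw [List.replicate_succ' (n := n + 1), List.append_assoc]
    exact this.weaken (by omega)

/-- Copies the input to register `0` and its length to register `envReg 0`, and initializes the
other registers for phase `1`. -/
def setup : Prog T :=
  .seq (.loop (.nonempty 0) (.seq (.cmd (.move 0 1)) (.cmd (.push (envReg 0) .tally))))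
    (.seq (.moveAll 1 0)
      (.seq (.pushTallies (envReg 1) 0) (.seq (.pushTallies (envReg 2) 7) (.cmd .start))))

theorem exec_setup (I : List TapeSymbol) :
    Exec (T := T) sym setup (Memory.initial I) ⟨phaseReg I 1, idle T⟩ (5 * I.length + 12) := by
  have h0 : envReg 0 ≠ 0 := envReg_ne (by omega)
  have h1 : envReg 0 ≠ 1 := envReg_ne (by omega)
  set c₀ : TM2.Cfg T.Γ T.Λ T.σ := ⟨none, T.initialState, fun _ => []⟩
  have a := Exec.loop_iterate (sym := sym) (t := .nonempty 0)
    (p := .seq (.cmd (.move 0 1)) (.cmd (.push (envReg 0) .tally)))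
    (fun i => ⟨update (update (update (fun _ => []) 0 (I.drop i)) 1 (I.take i).reverse) (envReg 0)
      (List.replicate i .tally), c₀⟩) I.length 2
    (fun i hi => by simp [Test.eval_nonempty, h0.symm, hi])
    (by simp [Test.eval_nonempty_false, h0.symm])
    (fun i hi => by
      refine (Exec.seq (Exec.cmd _ _) ?_ : Exec sym _ _ _ (1 + 1))
      convert! Exec.cmd (sym := sym) (Cmd.push (envReg 0) .tally : Cmd T) _ using 1
      have : (I.take (i + 1)).reverse = I[i] :: (I.take i).reverse := by
        rw [List.take_succ_eq_append_getElem hi, List.reverse_append]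
        rfl
      simp only [Cmd.eval, update_of_ne h0.symm, update_self,
        update_of_ne (show 0 ≠ 1 by omega), List.head?_drop, List.getElem?_eq_getElem hi,
        Memory.mk.injEq, and_true, this, List.tail_drop]
      funext z
      simp only [update_apply]
      clear * - h0 h1
      split_ifs <;> simp_all [List.replicate_succ])
  have b := exec_moveAll (sym := sym) (update (update (update (fun _ => []) 0 (I.drop I.length)) 1
    (I.take I.length).reverse) (envReg 0) (List.replicate I.length .tally)) c₀
    (show 1 ≠ 0 by omega)
  have h10 : envReg 1 ≠ 0 := envReg_ne (by omega)
  have h11 : envReg 1 ≠ 1 := envReg_ne (by omega)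
  have h20 : envReg 2 ≠ 0 := envReg_ne (by omega)
  have h21 : envReg 2 ≠ 1 := envReg_ne (by omega)
  have h01 : envReg 0 ≠ envReg 1 := by simp
  have h02 : envReg 0 ≠ envReg 2 := by simp
  have h12 : envReg 1 ≠ envReg 2 := by simp
  set R₁ : ℕ → List TapeSymbol := update (update (update (fun _ => []) 0 []) 1 I.reverse)
    (envReg 0) (List.replicate I.length .tally)
  set R₂ : ℕ → List TapeSymbol := update (update (fun _ => []) 0 I) (envReg 0)
    (List.replicate I.length .tally)
  set R₃ : ℕ → List TapeSymbol := update R₂ (envReg 1) [.tally]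
  have c := exec_pushTallies sym R₂ c₀ (envReg 1) 0
  have d := exec_pushTallies sym R₃ c₀ (envReg 2) 7
  refine Exec.weaken (Exec.seq (s' := ⟨R₁, c₀⟩) (m := 3 * I.length + 1) ?_
    (Exec.seq (s' := ⟨R₂, c₀⟩) (m := 2 * I.length + 1) ?_
    (Exec.seq (s' := ⟨R₃, c₀⟩) (m := 1) ?_
    (Exec.seq (s' := ⟨phaseReg I 1, c₀⟩) (m := 8) ?_ (Exec.cmd _ _))))) (by omega)
  · have e : Memory.initial I = (⟨update (update (update (fun _ => []) 0 (I.drop 0)) 1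
        (I.take 0).reverse) (envReg 0) (List.replicate 0 .tally), c₀⟩ : Memory T) := by
      simp only [Memory.initial, Memory.mk.injEq, List.drop_zero, List.take_zero, c₀, and_true]
      funext z
      simp only [update_apply]
      clear * - h0 h1
      split_ifs <;> simp_all
    rw [e]
    simp only [List.drop_length, List.take_length] at a
    exact a.weaken (by omega)
  · simp only [List.drop_length, List.take_length] at b
    have e : R₁ 1 = I.reverse := by simp [R₁, update_of_ne h1.symm]
    have e' : update (update R₁ 1 []) 0 ((R₁ 1).reverse ++ R₁ 0) = R₂ := by
      have e'' : R₁ 0 = [] := by simp [R₁, update_of_ne h0.symm]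
      rw [e, e'', List.reverse_reverse, List.append_nil]
      funext z
      simp only [R₁, R₂, update_apply]
      clear * - h0 h1
      split_ifs <;> simp_all
    change Exec sym _ ⟨R₁, _⟩ ⟨update (update R₁ 1 []) 0 ((R₁ 1).reverse ++ R₁ 0), _⟩
      (2 * (R₁ 1).length + 1) at b
    rwa [e', e, List.length_reverse] at b
  · have e : R₂ (envReg 1) = [] := by simp [R₂, update_of_ne h10]
    rwa [e] at c
  · have e : R₃ (envReg 2) = [] := by
      simp [R₂, R₃, update_of_ne h20]
    rwa [e] at d

/-- Empties the registers. -/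
def cleanup : Prog T :=
  .seq (.clear (envReg 0)) (.seq (.clear (envReg 1)) (.seq (.clear (envReg 2)) (.clear 0)))

theorem exec_cleanup (I : List TapeSymbol) (b : ℕ) (c) {W : ℕ} (hI : I.length ≤ W)
    (hb : 8 ^ b ≤ W) : Exec (T := T) sym cleanup ⟨phaseReg I b, c⟩ ⟨fun _ => [], c⟩ (8 * W + 4) := by
  have a := exec_clear (sym := sym) (phaseReg I b) c (envReg 0)
  have b' := exec_clear (sym := sym) (update (phaseReg I b) (envReg 0) []) c (envReg 1)
  have d := exec_clear (sym := sym) (update (update (phaseReg I b) (envReg 0) []) (envReg 1) []) c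
    (envReg 2)
  have e := exec_clear (sym := sym) (update (update (update (phaseReg I b) (envReg 0) [])
    (envReg 1) []) (envReg 2) []) c 0
  have hlt : b < 8 ^ b := Nat.lt_pow_self (by omega)
  have h00 : envReg 0 ≠ 0 := envReg_ne (by omega)
  have h10 : envReg 1 ≠ 0 := envReg_ne (by omega)
  have h20 : envReg 2 ≠ 0 := envReg_ne (by omega)
  have h01 : envReg 0 ≠ envReg 1 := by simp
  have h02 : envReg 0 ≠ envReg 2 := by simp
  have h12 : envReg 1 ≠ envReg 2 := by simp
  have key := (a.seq (b'.seq (d.seq e))).weaken (n := 8 * W + 4) (by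
    simp only [phaseReg, update_self, update_of_ne h01, update_of_ne h02, update_of_ne h12,
      update_of_ne h01.symm, update_of_ne h02.symm, update_of_ne h12.symm, update_of_ne h00.symm,
      update_of_ne h10.symm, update_of_ne h20.symm, List.length_replicate]
    omega)
  convert! key using 2
  funext z
  simp only [update_apply, phaseReg]
  clear * -
  split_ifs <;> simp_all

/-- Runs the machine on the words generated by `red` for `b = 2, 3, …`, in phase `b` for the number
of steps generated by `clk`, until it halts. -/
noncomputable def search (red clk : Gen) : Prog T :=
  .seq setup (.seq (.loop .running (phase red clk)) cleanup)

/-- The search may stop before phase `k`, and then the second hypothesis guarantees the right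
answer. There are fewer than `k < 8 ^ k` phases, each polynomial in `W`, so the total is polynomial
in the length of the input and `8 ^ k`. -/
theorem exec_search (red clk : Gen) : ∃ f, PolyLE f ∧ ∀ I ans k, 2 ≤ k →
    (∀ b, 2 ≤ b → (phaseRun sym red clk I b).l = none → phaseRun sym red clk I b = haltList T ans) →
    (phaseRun sym red clk I k).l = none →
    Exec sym (search red clk) (Memory.initial I) (Memory.final ans) (f (I.length + 8 ^ k)) := by
  classical
  obtain ⟨f, hf, h⟩ := exec_phase sym red clk
  refine ⟨fun W => (5 * W + 12) + ((W * (f W + 1) + 1) + (8 * W + 4)), ?_,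
    fun I ans k hk hans hhalt => ?_⟩
  · have c := PolyLE.const
    have hid := PolyLE.id
    exact (((c 5).mul hid).add (c 12)).add (((hid.mul (hf.add (c 1))).add (c 1)).add
      (((c 8).mul hid).add (c 4)))
  set W := I.length + 8 ^ k
  have hlt : k < 8 ^ k := Nat.lt_pow_self (by omega)
  obtain ⟨b, hb, loop⟩ : ∃ b ≤ k, Exec sym (.loop .running (phase red clk))
      ⟨phaseReg I 1, idle T⟩ ⟨phaseReg I b, haltList T ans⟩ ((k - 1) * (f W + 1) + 1) := by
    -- Induction on the number `i + 1` of phases up to phase `k`. A phase increments `b` before it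
    -- runs the machine, so the start at `b = 1` makes `2` the first block size.
    have gen : ∀ i b, 1 ≤ b → b + i + 1 = k → ∃ b' ≤ k, Exec sym (.loop .running (phase red clk))
        ⟨phaseReg I b, idle T⟩ ⟨phaseReg I b', haltList T ans⟩ ((i + 1) * (f W + 1) + 1) := by
      intro i
      induction i with
      | zero =>
        intro b hb hk'
        subst hk'
        have p := h I b W (by omega) (Nat.le_add_left _ _)
        rw [if_pos hhalt, hans _ (by omega) hhalt] at p
        refine ⟨b + 1, le_rfl, (Exec.loopTrue rfl p (Exec.loopFalse ?_)).weaken (by omega)⟩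
        rfl
      | succ i ih =>
        intro b hb hk'
        have p := h I b W (by omega)
          ((Nat.pow_le_pow_right (by omega) (show b + 1 ≤ k by omega)).trans (by omega))
        by_cases hc : (phaseRun sym red clk I (b + 1)).l = none
        · rw [if_pos hc, hans _ (by omega) hc] at p
          refine ⟨b + 1, by omega, (Exec.loopTrue rfl p (Exec.loopFalse ?_)).weaken ?_⟩
          · rfl
          · rw [Nat.add_mul (i + 1)]
            have := Nat.zero_le ((i + 1) * (f W + 1))
            omega
        · rw [if_neg hc] at p
          obtain ⟨b', hb', q⟩ := ih (b + 1) (by omega) (by omega)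
          refine ⟨b', hb', (Exec.loopTrue rfl p q).weaken ?_⟩
          rw [Nat.add_mul (i + 1)]
          omega
    obtain ⟨b', hb', q⟩ := gen (k - 2) 1 le_rfl (by omega)
    exact ⟨b', hb', q.weaken (by rw [show k - 2 + 1 = k - 1 by omega])⟩
  refine (Exec.seq (exec_setup sym I) (loop.seq (exec_cleanup sym I b _ (W := W) (by omega)
    ((Nat.pow_le_pow_right (by omega) hb).trans (by omega))))).weaken ?_
  have hW : I.length ≤ W := Nat.le_add_right _ _
  change _ ≤ (5 * W + 12) + ((W * (f W + 1) + 1) + (8 * W + 4))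
  have : (k - 1) * (f W + 1) ≤ W * (f W + 1) := Nat.mul_le_mul_right _ (by omega)
  omega

end StackProg

/-! ### Choice of the block size -/

theorem Computable.nat_op {op : ℕ → ℕ → ℕ} (hop : Primrec₂ op) {f g : ℕ → ℕ} (hf : Computable f)
    (hg : Computable g) : Computable fun n => op (f n) (g n) := hop.to_comp.comp hf hg

/-- If `f(N) = o(N)`, then the smallest block size `b` such that `f` is at most `b` on the number of
variables of the block instance is `o(n)`. -/
theorem IsEffLittleO.exists_block_size {f : ℕ → ℕ} (hf : IsEffLittleO f id) (C : ℕ) :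
    ∃ g, IsEffLittleO g id ∧ ∀ n, ∃ b, 2 ≤ b ∧
      f ((n / b + 1) * (n / b + 1) * (n / b + 1) * (3 * b)) ≤ b ∧ C * b ≤ g n := by
  obtain ⟨-, -, μ, n₀, hμc, hμm, hμu, hμ⟩ := hf
  -- The fourth root gives `s ^ 4 ≤ μ`, which beats the factor `t ^ 3 ≤ s ^ 3` in `N` with one power
  -- of `s` to spare; `s ^ 2 ≤ n` makes the additive constant `K` negligible against `n / s`.
  set s : ℕ → ℕ := fun n => min (μ n).sqrt.sqrt n.sqrt
  have hsc : Computable s := .nat_op Primrec.nat_min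
    (Primrec.nat_sqrt.to_comp.comp (Primrec.nat_sqrt.to_comp.comp hμc)) Primrec.nat_sqrt.to_comp
  have hsm : Monotone s := fun a b h => min_le_min
    (Nat.sqrt_le_sqrt (Nat.sqrt_le_sqrt (hμm h))) (Nat.sqrt_le_sqrt h)
  have hsu : ∀ k, ∃ n, k ≤ s n := fun k => by
    obtain ⟨n, hn⟩ := hμu (k * k * (k * k))
    refine ⟨max n (k * k), le_min ?_ ?_⟩
    · exact Nat.le_sqrt.2 (Nat.le_sqrt.2 (hn.trans (hμm (le_max_left _ _))))
    · exact Nat.le_sqrt.2 (le_max_right _ _)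
  have hss : ∀ n, s n * s n ≤ n := fun n => Nat.le_sqrt.1 (min_le_right _ _)
  have hsμ : ∀ n, s n * s n * (s n * s n) ≤ μ n := fun n =>
    Nat.le_sqrt.1 (Nat.le_sqrt.1 (min_le_left _ _))
  obtain ⟨n₁, hn₁⟩ := hsu 3
  obtain ⟨n₂, hn₂⟩ := hμu 3
  -- Serves as the block size for the finitely many `n` below `max n₀ n₁`; it exceeds these `n` and
  -- is large enough for `μ (3 * K) ≥ 3`.
  set K := max n₀ n₁ + n₂ + 2 with hK
  refine ⟨fun n => C * (n / s n + K), ⟨?_, Computable.id, fun n => s n / (2 * C + 1), ?_⟩,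
    fun n => ?_⟩
  · exact .nat_op Primrec.nat_mul (.const C)
      (.nat_op Primrec.nat_add (.nat_op Primrec.nat_div Computable.id hsc) (.const K))
  · obtain ⟨n₃, hn₃⟩ := hsu K
    refine ⟨n₃, .nat_op Primrec.nat_div hsc (.const _),
      fun a b h => Nat.div_le_div_right (hsm h), fun k => ?_, fun n hn => ?_⟩
    · obtain ⟨n, hn⟩ := hsu (k * (2 * C + 1))
      exact ⟨n, (Nat.le_div_iff_mul_le (by omega)).2 hn⟩
    -- With `m = s / (2 * C + 1)` one has `2 * m * C ≤ s`, and both `s * (n / s)` and `s * K` are at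
    -- most `n`; this gives `m * (C * (n / s + K)) ≤ n`.
    · have hm : s n / (2 * C + 1) * (2 * C + 1) ≤ s n := Nat.div_mul_le_self _ _
      set m := s n / (2 * C + 1)
      have h2 : 2 * (m * C) ≤ s n := by nlinarith
      have hq : s n * (n / s n) ≤ n := Nat.mul_div_le _ _
      have hKs : K ≤ s n := hn₃.trans (hsm hn)
      have h3 : s n * K ≤ n := (Nat.mul_le_mul_left _ hKs).trans (hss n)
      have h4 := Nat.mul_le_mul_right (n / s n + K) h2
      change m * (C * (n / s n + K)) ≤ n
      rw [← mul_assoc]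
      rw [mul_assoc, Nat.mul_add (s n)] at h4
      omega
  · have hq := Nat.zero_le (n / s n)
    by_cases hn : max n₀ n₁ ≤ n
    · have hs3 : 3 ≤ s n := hn₁.trans (hsm ((le_max_right _ _).trans hn))
      -- Adding one would suffice for at most `s` blocks; adding two also ensures `b ≥ 2`.
      refine ⟨n / s n + 2, by omega, ?_, Nat.mul_le_mul_left _ (by omega)⟩
      set b := n / s n + 2
      set t := n / b + 1
      have hsb : n < s n * b := by
        have := Nat.lt_mul_div_succ n (show 0 < s n by omega)
        exact this.trans_le (Nat.mul_le_mul_left _ (by omega))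
      have ht : t ≤ s n := by
        exact Nat.div_lt_of_lt_mul (by rwa [mul_comm])
      have htb : n < b * t := Nat.lt_mul_div_succ n (by omega)
      set N := t * t * t * (3 * b)
      have ht1 : 1 ≤ t := Nat.succ_pos _
      have hN : n ≤ N := by
        have : t * 1 ≤ t * t * t := by
          rw [mul_assoc]
          exact Nat.mul_le_mul_left _ (Nat.mul_pos ht1 ht1)
        have := Nat.mul_le_mul_right (3 * b) this
        have e : t * 1 * (3 * b) = 3 * (b * t) := by ring
        omega
      have h1 := hμ N (((le_max_left _ _).trans hn).trans hN)
      have h2 : s n * s n * (s n * s n) * f N ≤ N :=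
        (Nat.mul_le_mul_right _ ((hsμ n).trans (hμm hN))).trans h1
      have h3 : N ≤ s n * s n * s n * (3 * b) :=
        Nat.mul_le_mul_right _ (Nat.mul_le_mul (Nat.mul_le_mul ht ht) ht)
      -- Cancelling `s ^ 3` leaves `s * f N ≤ 3 * b`, and `s ≥ 3` yields `f N ≤ b`.
      have h4 : s n * s n * s n * (s n * f N) ≤ s n * s n * s n * (3 * b) := by
        refine le_trans (le_of_eq ?_) (h2.trans h3)
        ring
      have h5 := Nat.le_of_mul_le_mul_left h4 (by positivity)
      have h6 := (Nat.mul_le_mul_right (f N) hs3).trans h5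
      omega
    -- Here `n < K`, so there is a single block and `N = 3 * K`.
    · refine ⟨K, by omega, ?_, Nat.mul_le_mul_left _ (by omega)⟩
      rw [Nat.div_eq_of_lt (by omega)]
      have h1 := hμ ((0 + 1) * (0 + 1) * (0 + 1) * (3 * K)) (by omega)
      have h2 : 3 ≤ μ ((0 + 1) * (0 + 1) * (0 + 1) * (3 * K)) := hn₂.trans (hμm (by omega))
      have h3 := (Nat.mul_le_mul_right _ h2).trans h1
      simp only [id] at h3
      omega

/-! ### Time bounds -/

theorem SolvableInTime.mono {α : Type} {encode : α → List TapeSymbol} {yes : α → Prop}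
    {time time' : α → ℕ} (h : SolvableInTime encode yes time) (ht : ∀ a, time a ≤ time' a) :
    SolvableInTime encode yes time' := by
  obtain ⟨M, hM⟩ := h
  refine ⟨M, fun a => ?_⟩
  obtain ⟨answer, hans, ⟨out⟩⟩ := hM a
  exact ⟨answer, hans, ⟨⟨out.toEvalsTo, out.steps_le_m.trans (ht a)⟩⟩⟩

theorem PolyLE.exists_subexp_bound {f : ℕ → ℕ} (hf : PolyLE f) :
    ∃ C c, ∀ l b k, C * b ≤ k → f (l + 8 ^ b) + 1 ≤ c * 2 ^ k * (l + 1) ^ c := by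
  obtain ⟨C, hC⟩ := hf
  -- `3 * C` comes from `(8 ^ b) ^ C = 2 ^ (3 * C * b)`. The second constant must serve both as a
  -- factor and as an exponent, hence the sum of `2 * 3 ^ C` and `C`.
  refine ⟨3 * C, 2 * 3 ^ C + C, fun l b k hk => ?_⟩
  have h1 : l + 8 ^ b + 2 ≤ 3 * 8 ^ b * (l + 1) := by
    have : 1 ≤ 8 ^ b := Nat.one_le_pow _ _ (by omega)
    nlinarith
  have h2 := Nat.pow_le_pow_left h1 C
  have h3 : (8 ^ b) ^ C ≤ 2 ^ k := by
    rw [← pow_mul, show 8 = 2 ^ 3 from rfl, ← pow_mul]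
    exact Nat.pow_le_pow_right (by omega) (by linarith)
  have h4 : (l + 1) ^ C ≤ (l + 1) ^ (2 * 3 ^ C + C) := Nat.pow_le_pow_right (by omega) (by omega)
  have h5 : 1 ≤ (l + 8 ^ b + 2) ^ C := Nat.one_le_pow _ _ (Nat.succ_pos _)
  calc f (l + 8 ^ b) + 1 ≤ 2 * (l + 8 ^ b + 2) ^ C := by
        have := hC (l + 8 ^ b)
        omega
    _ ≤ 2 * (3 ^ C * (8 ^ b) ^ C * (l + 1) ^ C) := by
        rw [← mul_pow, ← mul_pow]
        exact Nat.mul_le_mul_left _ h2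
    _ ≤ 2 * (3 ^ C * 2 ^ k * (l + 1) ^ (2 * 3 ^ C + C)) := by gcongr
    _ ≤ (2 * 3 ^ C + C) * 2 ^ k * (l + 1) ^ (2 * 3 ^ C + C) := by
        have : 2 * 3 ^ C ≤ 2 * 3 ^ C + C := by omega
        calc _ = 2 * 3 ^ C * 2 ^ k * (l + 1) ^ (2 * 3 ^ C + C) := by ring
          _ ≤ _ := by gcongr

/-! ### Formulas -/

namespace CNFFormula

/-- The clauses, with variables replaced by numbers. -/
def natClauses (F : CNFFormula) : List NatClause :=
  F.formula.clauses.toList.map fun C => C.map fun l => ((l.1 : ℕ), l.2)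

theorem encode_eq_encodeFormula (F : CNFFormula) :
    F.encode = BlockReduction.encodeFormula F.vars F.natClauses := by
  simp only [encode, BlockReduction.encodeFormula, natClauses, List.flatMap_map,
    BlockReduction.encodeClause, BlockReduction.encodeLit, BlockReduction.signSymbol]

theorem satisfiable_iff (F : CNFFormula) :
    F.Satisfiable ↔ ∃ σ : ℕ → Bool, ∀ C ∈ F.natClauses, ∃ l ∈ C, σ l.1 = l.2 := by
  have key : ∀ τ, Std.Sat.CNF.Sat τ F.formula ↔
      ∀ C ∈ F.formula.clauses.toList, ∃ l ∈ C, τ l.1 = l.2 := fun τ => by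
    simp only [Std.Sat.CNF.Sat, Std.Sat.CNF.eval, Std.Sat.CNF.Clause.eval, Array.all_eq_true',
      List.any_eq_true, beq_iff_eq, Array.mem_toList_iff]
  simp only [Satisfiable, key]
  constructor
  · rintro ⟨τ, hτ⟩
    refine ⟨fun x => if h : x < F.vars then τ ⟨x, h⟩ else false, fun C hC => ?_⟩
    obtain ⟨C', hC', rfl⟩ := List.mem_map.1 hC
    obtain ⟨l, hl, h⟩ := hτ C' hC'
    exact ⟨_, List.mem_map.2 ⟨l, hl, rfl⟩, by simpa using h⟩
  · rintro ⟨σ, hσ⟩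
    refine ⟨fun x => σ x, fun C hC => ?_⟩
    obtain ⟨l, hl, h⟩ := hσ _ (List.mem_map.2 ⟨C, hC, rfl⟩)
    obtain ⟨l', hl', rfl⟩ := List.mem_map.1 hl
    exact ⟨l', hl', h⟩

theorem length_le_of_mem_natClauses {F : CNFFormula} {k : ℕ} (h : F.WidthLE k) {C : NatClause}
    (hC : C ∈ F.natClauses) : C.length ≤ k := by
  obtain ⟨C', hC', rfl⟩ := List.mem_map.1 hC
  rw [List.length_map]
  exact h C' (Array.mem_toList_iff.1 hC')

theorem var_lt_of_mem_natClauses {F : CNFFormula} {C : NatClause} (hC : C ∈ F.natClauses)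
    {l : ℕ × Bool} (hl : l ∈ C) : l.1 < F.vars := by
  obtain ⟨C', hC', rfl⟩ := List.mem_map.1 hC
  obtain ⟨l', hl', rfl⟩ := List.mem_map.1 hl
  exact l'.1.2

end CNFFormula

namespace StackProg

/-- The power `x ^ n`. -/
def Term.pow (x : Term) : ℕ → Term
  | 0 => .one
  | n + 1 => .mul (pow x n) x

theorem Num.pow {I : List TapeSymbol} {w : World} {x : Term} {k : ℕ} (hx : Num I w x k) (n : ℕ) :
    Num I w (x.pow n) (k ^ n) := by
  induction n with
  | zero => exact .one
  | succ n ih => exact ih.mul hx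

end StackProg

/-! ### The block instance, its generator and its clock -/

namespace BlockReduction

open StackProg

/-- The block instance. -/
noncomputable def blockInstance (n : ℕ) (Cs : List NatClause) {b : ℕ} (hb : 2 ≤ b) : CSPInstance :=
  haveI : NeZero ((n / b + 1) * (n / b + 1) * (n / b + 1) * (3 * b)) := ⟨by positivity⟩
  (constraints_valid (Cs := Cs) hb (Nat.succ_pos (n / b))).toInstance

variable {n b : ℕ} {Cs : List NatClause}

theorem deg_blockInstance_le (hb : 2 ≤ b) : (blockInstance n Cs hb).deg ≤ 2 := by
  have : NeZero ((n / b + 1) * (n / b + 1) * (n / b + 1) * (3 * b)) := ⟨by positivity⟩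
  refine Finset.sup_le fun x _ => ?_
  exact (ValidConstraints.degree_toInstance
    (constraints_valid (Cs := Cs) hb (Nat.succ_pos (n / b))) x).trans_le (degree_le (by omega) x)

theorem consistent_blockInstance (hb : 2 ≤ b) (hlen : ∀ C ∈ Cs, C.length ≤ 3)
    (hvar : ∀ C ∈ Cs, ∀ l ∈ C, l.1 < n) :
    (blockInstance n Cs hb).Consistent ↔ ∃ σ : ℕ → Bool, ∀ C ∈ Cs, ∃ l ∈ C, σ l.1 = l.2 := by
  have : NeZero ((n / b + 1) * (n / b + 1) * (n / b + 1) * (3 * b)) := ⟨by positivity⟩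
  refine (ValidConstraints.consistent_toInstance _).trans
    (constraints_consistent_iff (by omega) (Nat.succ_pos _) hlen fun C hC l hl => ?_)
  exact Nat.lt_succ_of_le (Nat.div_le_div_right (hvar C hC l hl).le)

/-- Generates the encoding of the block instance. -/
def instanceTerm : Term := reductionTerm (.var 0) (.var 1) (.var 2)

/-- Generates the number of steps for which the machine is run on the block instance. -/
def clockTerm (c : ℕ) : Term := (((Term.var 2).cat instanceTerm).cat (.num c)).pow (c + 2)

theorem den_instanceTerm (n : ℕ) (Cs : List NatClause) (hb : 2 ≤ b) :
    Den (encodeFormula n Cs) ⟨3, phaseEnv (encodeFormula n Cs) b⟩ instanceTerm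
      (blockInstance n Cs hb).encode := by
  have : NeZero ((n / b + 1) * (n / b + 1) * (n / b + 1) * (3 * b)) := ⟨by positivity⟩
  have hv : ∀ i < 3, Num (encodeFormula n Cs) ⟨3, phaseEnv (encodeFormula n Cs) b⟩ (.var i)
      (phaseEnv (encodeFormula n Cs) b i) := fun i hi => .var hi
  have h : Params n Cs b ⟨3, phaseEnv (encodeFormula n Cs) b⟩ (.var 0) (.var 1) :=
    ⟨hv 0 (by omega), hv 1 (by omega), by omega⟩
  exact h.reduction (hv 2 (by omega)) hb

theorem num_clockTerm (n : ℕ) (Cs : List NatClause) (hb : 2 ≤ b) (c : ℕ) :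
    Num (encodeFormula n Cs) ⟨3, phaseEnv (encodeFormula n Cs) b⟩ (clockTerm c)
      ((8 ^ b + (blockInstance n Cs hb).encode.length + (c + 1)) ^ (c + 2)) := by
  have hv : Num (encodeFormula n Cs) ⟨3, phaseEnv (encodeFormula n Cs) b⟩ (.var 2) (8 ^ b) :=
    .var (i := 2) (Nat.lt_succ_self 2)
  exact ((hv.add (den_instanceTerm n Cs hb).num).add (.num c)).pow (c + 2)

theorem eval_instanceTerm (n : ℕ) (Cs : List NatClause) (hb : 2 ≤ b) :
    (instanceTerm 3).eval (encodeFormula n Cs) 3 (phaseEnv (encodeFormula n Cs) b) =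
      (blockInstance n Cs hb).encode := by
  have := den_instanceTerm n Cs hb ⟨3, phaseEnv (encodeFormula n Cs) b⟩ le_rfl
  rwa [Term.eval] at this

theorem length_eval_clockTerm (n : ℕ) (Cs : List NatClause) (hb : 2 ≤ b) (c : ℕ) :
    ((clockTerm c 3).eval (encodeFormula n Cs) 3 (phaseEnv (encodeFormula n Cs) b)).length =
      (8 ^ b + (blockInstance n Cs hb).encode.length + (c + 1)) ^ (c + 2) := by
  have := num_clockTerm n Cs hb c ⟨3, phaseEnv (encodeFormula n Cs) b⟩ le_rfl
  rwa [Term.eval] at this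

/-- The factors `c`, `2 ^ k` and `l + 1` are each at most the base on the right. With `k = f(N) ≤ b`
the left side is the time bound of the CSP machine on an instance of length `l`, so the clock of
phase `b` lets it finish. -/
theorem le_clock {c k b l : ℕ} (h : k ≤ b) :
    c * 2 ^ k * (l + 1) ^ c ≤ (8 ^ b + l + (c + 1)) ^ (c + 2) := by
  have h8 : 2 ^ k ≤ 8 ^ b := (Nat.pow_le_pow_right (by omega) h).trans
    (Nat.pow_le_pow_left (by omega) b)
  have := Nat.zero_le (8 ^ b)
  calc c * 2 ^ k * (l + 1) ^ c
      ≤ (8 ^ b + l + (c + 1)) * (8 ^ b + l + (c + 1)) * (8 ^ b + l + (c + 1)) ^ c := by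
        gcongr <;> omega
    _ = _ := by ring

end BlockReduction

/-! ### From CSP of bounded degree to 3-CNF-Sat -/

open StackProg BlockReduction in
theorem KCNFSatSubexp.of_cspDegSubexp {d : ℕ} (hd : 2 ≤ d) (h : CSPDegSubexp d) :
    KCNFSatSubexp 3 := by
  classical
  obtain ⟨f, c, hf, M, hM⟩ := h
  set sym : TapeSymbol → M.tm.Γ M.tm.k₀ := M.inputAlphabet.invFun
  obtain ⟨q, hq, hsearch⟩ := exec_search sym (instanceTerm 3) (clockTerm c 3)
  obtain ⟨C, c', hqC⟩ := hq.exists_subexp_bound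
  obtain ⟨g, hg, hblock⟩ := hf.exists_block_size C
  -- The block size `b n` occurs only in the analysis of the running time; the machine never
  -- computes it.
  choose b hb hfb hgb using hblock
  refine ⟨g, c', hg, ?_⟩
  refine (solvableInTime_of_exec sym (fun F : {F : CNFFormula // F.WidthLE 3} => F.1.encode)
    (fun F => F.1.Satisfiable) (fun F => q (F.1.encode.length + 8 ^ b F.1.vars)) M.outputAlphabet
    (search (instanceTerm 3) (clockTerm c 3)) fun F => ?_).mono fun F => hqC _ _ _ (hgb _)
  obtain ⟨F, hF⟩ := F
  simp only [F.encode_eq_encodeFormula]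
  set I := encodeFormula F.vars F.natClauses
  refine ⟨decide F.Satisfiable, decide_eq_true_iff, ?_⟩
  -- For every `b ≥ 2` the block instance is equivalent to the formula. The answer is therefore
  -- right whenever the run has halted, and the run has halted as soon as `f(N) ≤ b`.
  have run : ∀ b (hb : 2 ≤ b), ((phaseRun sym (instanceTerm 3) (clockTerm c 3) I b).l = none ∨
      f ((F.vars / b + 1) * (F.vars / b + 1) * (F.vars / b + 1) * (3 * b)) ≤ b) →
      phaseRun sym (instanceTerm 3) (clockTerm c 3) I b =
        Turing.haltList M.tm [M.outputAlphabet.symm (decide F.Satisfiable)] := by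
    intro b hb hk
    obtain ⟨answer, hans, ⟨out⟩⟩ :=
      hM ⟨blockInstance F.vars F.natClauses hb, (deg_blockInstance_le hb).trans hd⟩
    have hcons := consistent_blockInstance (n := F.vars) (Cs := F.natClauses) hb
      (fun C hC => CNFFormula.length_le_of_mem_natClauses hF hC)
      (fun C hC l hl => CNFFormula.var_lt_of_mem_natClauses hC hl)
    have hans' : decide F.Satisfiable = answer := by
      rw [Bool.eq_iff_iff, decide_eq_true_iff, hans, F.satisfiable_iff]
      exact hcons.symm
    rw [hans']
    rw [phaseRun, eval_instanceTerm F.vars F.natClauses hb,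
      length_eval_clockTerm F.vars F.natClauses hb] at hk ⊢
    refine stepD_iterate_eq rfl (stepD_iterate_of_runs out.evals_in_steps) ?_
    exact hk.imp_right fun hk => out.steps_le_m.trans (le_clock hk)
  refine hsearch I _ (b F.vars) (hb _) (fun b hb h => run b hb (.inl h)) ?_
  rw [run _ (hb _) (.inr (hfb _))]
  rfl

theorem mainTheorem10 (hETH : ExponentialTimeHypothesis) (d : ℕ) (hd : 2 ≤ d) :
    ¬ CSPDegSubexp d :=
  fun h => hETH 3 le_rfl (.of_cspDegSubexp hd h)
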